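/- For a lattice simplex \(\Delta=\operatorname{conv}(\mathbf v_0,\dots,\mathbf v_d)\subset\mathbb R^d\) of dimension \(d\), let \[ \Lambda_\Delta=\Bigl\{(x_0,\dots,x_d)\in[0,1)^{d+1}:\ \sum_{i=0}^d x_i(\mathbf v_i,1)\in\mathbb Z^{d+1}\Bigr\}, \] a finite group under coordinatewise addition modulo \(1\), well defined up to permutation of coordinates. **Theorem.** Let \(k\ge1\) and \(v\ge2\) be integers. Consider, in all dimensions \(d\), the \(d\)-dimensional Gorenstein lattice simplices in \(\mathbb R^d\) which are not lattice pyramids and whose \(h^*\)-polynomial is \[ 1+t^k+t^{2k}+\cdots+t^{(v-1)k}. \] (Here \(\mathcal P\) is Gorenstein if some positive integer multiple \(r\mathcal P\) is unimodularly equivalent to a reflexive polytope, and a lattice pyramid is a polytope unimodularly equivalent to \(\operatorname{conv}(\mathcal Q\times\{0\},(0,\dots,0,1))\) for a lattice polytope \(\mathcal Q\) in one dimension less.) Their unimodular equivalence classes are in bijection with the following data: (i) a strict divisor chain \(1=M_0<M_1<\cdots<M_s=v\), that is, \(M_{i-1}\) is a proper divisor of \(M_i\) for \(i=1,\dots,s\);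 (ii) for each \(i=1,\dots,s\), a subset \(J_i\subseteq\mathcal L_{i-1}\), where \(\mathcal L_0=\emptyset\), \(\mathcal L_i=(\mathcal L_{i-1}\setminus J_i)\cup\{\ell_i\}\), and \(\ell_1,\dots,\ell_s\) are distinct formal symbols. The bijection can be made explicit. Given the data, put \(n_i=M_i/M_{i-1}\) and \(L_i=k\bigl(M_i-\sum_{\ell_u\in J_i}M_{u-1}\bigr)\), and let \(N=L_1+\cdots+L_s\), the coordinates of \([0,1)^N\) being divided into \(s\) blocks of sizes \(L_1,\dots,L_s\). Define \(\mathbf c_1,\dots,\mathbf c_s\in[0,1)^N\) recursively: each coordinate of \(\mathbf c_i\) in the \(i\)-th block is \(1/n_i\), and each coordinate of \(\mathbf c_i\) outside the \(i\)-th block is \(1/n_i\) times the corresponding coordinate of \(\sum_{\ell_u\in J_i}\mathbf c_u\). The data correspond to the class of exactly those simplices \(\Delta\) under consideration for which, up to permutation of coordinates, \(\Lambda_\Delta\) is the subgroup of \([0,1)^N\) (with addition modulo \(1\)) generated by \(\mathbf c_1,\dots,\mathbf c_s\). -/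

import Mathlib

open scoped Pointwise

noncomputable section

namespace GorSimplex

/-! ### Lattice polytopes -/

/-- The lattice point `z ∈ ℤ^d` as a point of `ℝ^d`. -/
def toReal {d : ℕ} (z : Fin d → ℤ) : Fin d → ℝ := fun i => (z i : ℝ)

/-- A lattice polytope: the convex hull of a nonempty finite set of lattice points. -/
def IsLatticePolytope {d : ℕ} (P : Set (Fin d → ℝ)) : Prop :=
  ∃ S : Finset (Fin d → ℤ), S.Nonempty ∧ P = convexHull ℝ (toReal '' (S : Set (Fin d → ℤ)))

/-- A lattice simplex of dimension `d` in `ℝ^d`: the convex hull of `d + 1` affinely independent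
lattice points. -/
def IsLatticeSimplex {d : ℕ} (P : Set (Fin d → ℝ)) : Prop :=
  ∃ w : Fin (d + 1) → (Fin d → ℤ), AffineIndependent ℝ (fun i => toReal (w i)) ∧
    P = convexHull ℝ (Set.range fun i => toReal (w i))

/-- The map `x ↦ x U + w` of `ℝ^d` given by an integer matrix `U` (acting on row vectors) and a
lattice vector `w`. -/
def affMap {d : ℕ} (U : Matrix (Fin d) (Fin d) ℤ) (w : Fin d → ℤ) (x : Fin d → ℝ) : Fin d → ℝ :=
  Matrix.vecMul x (U.map (Int.cast : ℤ → ℝ)) + toReal w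

/-- Unimodular equivalence of subsets of `ℝ^d`: `Q = P U + w` with `U` an integer matrix of
determinant `1` or `-1` and `w` a lattice vector. -/
def UnimodEquiv {d : ℕ} (P Q : Set (Fin d → ℝ)) : Prop :=
  ∃ (U : Matrix (Fin d) (Fin d) ℤ) (w : Fin d → ℤ), IsUnit U.det ∧ Q = affMap U w '' P

theorem UnimodEquiv.refl {d : ℕ} (P : Set (Fin d → ℝ)) : UnimodEquiv P P := by
  refine ⟨1, 0, by simp, ?_⟩
  have h : affMap (1 : Matrix (Fin d) (Fin d) ℤ) 0 = id := by
    funext x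
    have h0 : toReal (0 : Fin d → ℤ) = 0 := by funext i; simp [toReal]
    simp [affMap, h0, Matrix.map_one]
  rw [h, Set.image_id]

theorem affMap_affMap {d : ℕ} (U V : Matrix (Fin d) (Fin d) ℤ) (w z : Fin d → ℤ)
    (x : Fin d → ℝ) :
    affMap V z (affMap U w x) = affMap (U * V) (Matrix.vecMul w V + z) x := by
  have h1 : (U * V).map (Int.cast : ℤ → ℝ)
      = U.map (Int.cast : ℤ → ℝ) * V.map (Int.cast : ℤ → ℝ) :=
    Matrix.map_mul (f := Int.castRingHom ℝ)
  have h2 : toReal (Matrix.vecMul w V + z)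
      = Matrix.vecMul (toReal w) (V.map (Int.cast : ℤ → ℝ)) + toReal z := by
    funext i
    simp [toReal, Matrix.vecMul, dotProduct]
  simp only [affMap, h1, h2, Matrix.add_vecMul, Matrix.vecMul_vecMul, add_assoc]

theorem UnimodEquiv.trans {d : ℕ} {P Q R : Set (Fin d → ℝ)} (h₁ : UnimodEquiv P Q)
    (h₂ : UnimodEquiv Q R) : UnimodEquiv P R := by
  obtain ⟨U, w, hU, rfl⟩ := h₁
  obtain ⟨V, z, hV, rfl⟩ := h₂
  refine ⟨U * V, Matrix.vecMul w V + z, by rw [Matrix.det_mul]; exact hU.mul hV, ?_⟩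
  rw [Set.image_image]
  exact Set.image_congr fun x _ => affMap_affMap U V w z x

theorem UnimodEquiv.symm {d : ℕ} {P Q : Set (Fin d → ℝ)} (h : UnimodEquiv P Q) :
    UnimodEquiv Q P := by
  obtain ⟨U, w, hU, rfl⟩ := h
  refine ⟨U⁻¹, -Matrix.vecMul w U⁻¹, (Matrix.isUnit_nonsing_inv_det_iff).2 hU, ?_⟩
  rw [Set.image_image]
  have h0 : toReal (0 : Fin d → ℤ) = 0 := by funext i; simp [toReal]
  have h : ∀ x, affMap U⁻¹ (-Matrix.vecMul w U⁻¹) (affMap U w x) = x := by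
    intro x
    rw [affMap_affMap, Matrix.mul_nonsing_inv _ hU]
    simp [affMap, h0, Matrix.map_one]
  simp [h]

/-- The lattice pyramid `conv (P × {0}, (0, …, 0, 1)) ⊂ ℝ^(d+1)` over `P ⊂ ℝ^d`. -/
def pyr {d : ℕ} (P : Set (Fin d → ℝ)) : Set (Fin (d + 1) → ℝ) :=
  convexHull ℝ
    ((fun x : Fin d → ℝ => (Fin.snoc (α := fun _ => ℝ) x 0 : Fin (d + 1) → ℝ)) '' P ∪
      {Pi.single (Fin.last d) 1})

/-- `P` is a lattice pyramid: up to unimodular equivalence it is the lattice pyramid over some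
lattice polytope in one dimension less. (Iterated pyramids are included, the base of the last
step being itself a lattice polytope.) -/
def IsLatticePyramid : {d : ℕ} → Set (Fin d → ℝ) → Prop
  | 0, _ => False
  | e + 1, P => ∃ Q : Set (Fin e → ℝ), IsLatticePolytope Q ∧ UnimodEquiv (pyr Q) P

/-- The dual `{y : ⟨x, y⟩ ≤ 1 for all x ∈ P}`. -/
def dualPolytope {d : ℕ} (P : Set (Fin d → ℝ)) : Set (Fin d → ℝ) :=
  {y | ∀ x ∈ P, x ⬝ᵥ y ≤ 1}

/-- Reflexive polytopes. -/
def IsReflexive {d : ℕ} (P : Set (Fin d → ℝ)) : Prop :=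
  IsLatticePolytope P ∧ (0 : Fin d → ℝ) ∈ interior P ∧ IsLatticePolytope (dualPolytope P)

/-- `P` is Gorenstein: some positive integer multiple `r P` is unimodularly equivalent to a
reflexive polytope. -/
def IsGorenstein {d : ℕ} (P : Set (Fin d → ℝ)) : Prop :=
  ∃ r : ℕ, 0 < r ∧ ∃ Q : Set (Fin d → ℝ), IsReflexive Q ∧ UnimodEquiv ((r : ℝ) • P) Q

/-- The number of lattice points of the dilate `m P`. -/
def latticeCount {d : ℕ} (P : Set (Fin d → ℝ)) (m : ℕ) : ℕ :=
  Set.ncard {z : Fin d → ℤ | toReal z ∈ (m : ℝ) • P}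

/-- The Ehrhart series `1 + ∑_{m ≥ 1} |m P ∩ ℤ^d| t^m`. -/
def ehrhartSeries {d : ℕ} (P : Set (Fin d → ℝ)) : PowerSeries ℤ :=
  PowerSeries.mk fun m => if m = 0 then 1 else (latticeCount P m : ℤ)

/-- `h` is the `h^*`-polynomial of the `d`-dimensional polytope `P ⊂ ℝ^d`, that is
`Ehr_P(t) (1 - t)^(d+1) = h(t)`. -/
def HasHStar {d : ℕ} (P : Set (Fin d → ℝ)) (h : Polynomial ℤ) : Prop :=
  ehrhartSeries P * (1 - PowerSeries.X) ^ (d + 1) = (h : PowerSeries ℤ)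

/-! ### The simplices to be classified -/

/-- Gorenstein lattice simplices of dimension `d` in `ℝ^d` that are not lattice pyramids and have
`h^*`-polynomial `1 + t^k + t^(2k) + ⋯ + t^((v-1)k)`. -/
def GoodSimplex (v k d : ℕ) : Type :=
  {P : Set (Fin d → ℝ) // IsLatticeSimplex P ∧ IsGorenstein P ∧ ¬ IsLatticePyramid P ∧
    HasHStar P (∑ i ∈ Finset.range v, (Polynomial.X : Polynomial ℤ) ^ (i * k))}

/-- Unimodular equivalence on these simplices, in a fixed dimension. -/
instance unimodSetoid (v k d : ℕ) : Setoid (GoodSimplex v k d) where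
  r P Q := UnimodEquiv P.1 Q.1
  iseqv := ⟨fun P => UnimodEquiv.refl P.1, UnimodEquiv.symm, UnimodEquiv.trans⟩

/-- The unimodular equivalence classes of these simplices, of all dimensions `d`. -/
def SimplexClass (v k : ℕ) : Type :=
  Σ d : ℕ, Quotient (unimodSetoid v k d)

/-- The unimodular equivalence class of a simplex. -/
def GoodSimplex.toClass {v k d : ℕ} (P : GoodSimplex v k d) : SimplexClass v k :=
  ⟨d, Quotient.mk (unimodSetoid v k d) P⟩

/-! ### The combinatorial data -/

/-- The sets `𝓛_0 = ∅`, `𝓛_i = (𝓛_{i-1} ∖ J_i) ∪ {ℓ_i}` for `0 ≤ i ≤ s`. The formal symbol `ℓ_i`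
and the set `J_i` (`1 ≤ i ≤ s`) are indexed by the element `i - 1` of `Fin s`. -/
def symbolSet {s : ℕ} (J : Fin s → Finset (Fin s)) (i : Fin (s + 1)) : Finset (Fin s) :=
  Fin.induction (motive := fun _ => Finset (Fin s)) ∅ (fun j L => (L \ J j) ∪ {j}) i

theorem lt_of_mem_symbolSet {s : ℕ} (J : Fin s → Finset (Fin s)) (i : Fin (s + 1)) :
    ∀ u ∈ symbolSet J i, u.castSucc < i := by
  induction i using Fin.induction with
  | zero => simp [symbolSet]
  | succ j ih =>
    intro u hu
    rw [symbolSet, Fin.induction_succ] at hu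
    rcases Finset.mem_union.1 hu with h | h
    · exact (ih u (Finset.mem_sdiff.1 h).1).trans (Fin.castSucc_lt_succ)
    · rw [Finset.mem_singleton.1 h]
      exact Fin.castSucc_lt_succ

/-- A strict chain `1 = M_0 < M_1 < ⋯ < M_s = v` in the divisor lattice of `v` together with
subsets `J_i ⊆ 𝓛_{i-1}` for `i = 1, …, s`. -/
@[ext] structure ChainDatum (v : ℕ) where
  /-- the length of the chain -/
  s : ℕ
  /-- the members of the chain -/
  M : Fin (s + 1) → ℕ
  M_first : M 0 = 1
  M_last : M (Fin.last s) = v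
  M_lt : ∀ i : Fin s, M i.castSucc < M i.succ
  M_dvd : ∀ i : Fin s, M i.castSucc ∣ M i.succ
  /-- the subsets `J_i` -/
  J : Fin s → Finset (Fin s)
  J_subset : ∀ i : Fin s, J i ⊆ symbolSet J i.castSucc

namespace ChainDatum

variable {v : ℕ}

theorem lt_of_mem_J (D : ChainDatum v) {u j : Fin D.s} (h : u ∈ D.J j) : u < j :=
  Fin.castSucc_lt_castSucc_iff.1 (lt_of_mem_symbolSet D.J _ u (D.J_subset j h))

/-! ### The finite group attached to the data -/

/-- The quotients `n_i = M_i / M_{i-1}` of the chain. -/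
def ratio (D : ChainDatum v) (j : Fin D.s) : ℕ := D.M j.succ / D.M j.castSucc

/-- The number `k (M_i - ∑_{ℓ_u ∈ J_i} M_{u-1})` of coordinates in the `i`-th block. -/
def blockSize (D : ChainDatum v) (k : ℕ) (j : Fin D.s) : ℕ :=
  k * (D.M j.succ - ∑ u ∈ D.J j, D.M u.castSucc)

/-- The set of coordinates: the disjoint union of `s` blocks. -/
abbrev Coord (D : ChainDatum v) (k : ℕ) : Type := Σ j : Fin D.s, Fin (D.blockSize k j)

/-- The generator `c_j` is constant on blocks; this is its value on the block `b`. It is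
`1 / n_j` on the block `b = j`, and on the other blocks `c_j = (∑_{ℓ_u ∈ J_j} c_u) / n_j`. -/
def gen (D : ChainDatum v) (j b : Fin D.s) : ℝ :=
  (if b = j then 1 else ∑ u : {u : Fin D.s // u ∈ D.J j}, D.gen u.1 b) / (D.ratio j : ℝ)
termination_by j
decreasing_by exact D.lt_of_mem_J u.2

theorem gen_eq (D : ChainDatum v) (j b : Fin D.s) :
    D.gen j b =
      (if b = j then 1 else ∑ u : {u : Fin D.s // u ∈ D.J j}, D.gen u.1 b) / (D.ratio j : ℝ) := by
  rw [gen]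

/-- The subgroup of `[0,1)^N` (with addition modulo `1`) generated by `c_1, …, c_s`, where `N` is
the total number of coordinates. -/
def group (D : ChainDatum v) (k : ℕ) : Set (D.Coord k → ℝ) :=
  {x | ∃ a : Fin D.s → ℤ, ∀ i, x i = Int.fract (∑ j, (a j : ℝ) * D.gen j i.1)}

end ChainDatum

/-- The finite group `Λ_Δ` of a simplex with vertices `w_i`: all `x ∈ [0,1)^ι` such that
`∑ x_i (w_i, 1)` is a lattice point. -/
def latticeGroup {ι : Type} [Fintype ι] {d : ℕ} (w : ι → (Fin d → ℤ)) : Set (ι → ℝ) :=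
  {x | (∀ i, x i ∈ Set.Ico (0 : ℝ) 1) ∧
    (∃ z : Fin d → ℤ, ∑ i, x i • toReal (w i) = toReal z) ∧ ∃ m : ℤ, ∑ i, x i = (m : ℝ)}

/-- The simplex `P` is associated with the datum `D`: its vertices can be labelled by the
coordinates of the group of `D` in such a way that `Λ_P` is that group. -/
def IsAssociated {v d : ℕ} (k : ℕ) (P : Set (Fin d → ℝ)) (D : ChainDatum v) : Prop :=
  ∃ w : D.Coord k → (Fin d → ℤ), AffineIndependent ℝ (fun i => toReal (w i)) ∧
    P = convexHull ℝ (Set.range fun i => toReal (w i)) ∧ latticeGroup w = D.group k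

end GorSimplex

end

/-! Replace Λ_Δ by its preimage Γ (`relLattice`), the lattice of all x ∈ ℝ^(d+1) with ∑ x_i (v_i, 1)
integral. It contains ℤ^(d+1), its elements in the unit box form Λ_Δ, and it determines Δ up to
unimodular equivalence (`unimodEquiv_of_relLattice_eq`); conversely, lattices with integral heights
and bounded denominators are realized by simplices (`exists_relLattice_eq`). Cutting the cone over Δ
into translates of the unit box gives h^* = ∑_{x ∈ Λ_Δ} t^(ht x). So the prescribed h^* says that
the box elements of Γ have the heights 0, k, …, (v-1)k, each exactly once (`StepLattice`). Being a
pyramid means that some coordinate is integral on Γ. The Gorenstein condition is then automatic: the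
box element T of largest height dominates all others, T_i = 1 - 1/m_i where the i-th coordinates of
Γ form (1/m_i)ℤ, and the vector (1/m_i) gives an interior lattice point of a dilate at lattice
distance 1 from every facet.

Step lattices behave like positional number systems. Let H ≤ Γ be a step lattice with M box
elements, and c a box element of Γ of height Mk. Uniqueness of heights forces x + ac to stay in the
box for all box elements x of H and all a < n, where nc is the first multiple of c to leave the box,
and it forces nc ∈ H (`exists_step`). Hence H + ℤc is a step lattice with nM box elements
(`extend`). The numbers M occurring for sublattices of Γ form the divisor chain, and the vectors c
are the generators c_i. Modulo 1, n_i c_i is a combination ∑ a_u c_u of earlier generators.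
Comparison with the top element of the sublattice, on the block of u, shows that a_u ≤ 1 and that a
symbol once used is never used again, which is J_i ⊆ 𝓛_{i-1}; counting heights gives the block sizes
(`exists_datum`).

Conversely, for any datum the sum ∑_{u ≤ i} (n_u - 1) c_u telescopes to 1 - ∑_{ℓ_u ∈ 𝓛_i} c_u on the
blocks introduced so far. This is less than 1, so no carries occur and the generated lattice is a
step lattice. The datum is recovered from Γ: the M_i are intrinsic (`isBreak_iff`), c_i is the only
box element of its height, and J_i is read off from the height of n_i c_i modulo 1, since the M_i
are superincreasing. -/

noncomputable section

namespace GorSimplex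

/-! ### Lattices containing `ℤ^ι` and the heights of their elements in the unit box -/

section Box

variable {ι : Type}

/-- The integers as a subgroup of `ℝ`. -/
def intReals : AddSubgroup ℝ := (Int.castAddHom ℝ).range

theorem mem_intReals {r : ℝ} : r ∈ intReals ↔ ∃ z : ℤ, (z : ℝ) = r := Iff.rfl

theorem intCast_mem_intReals (z : ℤ) : (z : ℝ) ∈ intReals := ⟨z, rfl⟩

theorem natCast_mem_intReals (z : ℕ) : (z : ℝ) ∈ intReals := ⟨z, by simp⟩

theorem one_mem_intReals : (1 : ℝ) ∈ intReals := ⟨1, by simp⟩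

theorem eq_zero_of_mem_intReals {r : ℝ} (hr : r ∈ intReals) (h0 : -1 < r) (h1 : r < 1) : r = 0 := by
  obtain ⟨z, rfl⟩ := mem_intReals.1 hr
  have h2 : (-1 : ℤ) < z := by exact_mod_cast h0
  have h3 : z < (1 : ℤ) := by exact_mod_cast h1
  have : z = 0 := by omega
  simp [this]

theorem mul_mem_intReals {r s : ℝ} (hr : r ∈ intReals) (hs : s ∈ intReals) :
    r * s ∈ intReals := by
  obtain ⟨a, rfl⟩ := mem_intReals.1 hr
  obtain ⟨b, rfl⟩ := mem_intReals.1 hs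
  exact ⟨a * b, by simp⟩

variable (ι) in
/-- The lattice `ℤ^ι`. -/
def intLattice : AddSubgroup (ι → ℝ) := AddSubgroup.pi Set.univ fun _ => intReals

theorem mem_intLattice {x : ι → ℝ} : x ∈ intLattice ι ↔ ∀ i, x i ∈ intReals := by
  simp [intLattice, AddSubgroup.mem_pi]

/-- The coordinatewise fractional part. -/
def fr (x : ι → ℝ) : ι → ℝ := fun i => Int.fract (x i)

/-- The half-open unit box `[0,1)^ι`. -/
def InBox (x : ι → ℝ) : Prop := ∀ i, x i ∈ Set.Ico (0 : ℝ) 1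

theorem nsmul_coord (n : ℕ) (c : ι → ℝ) (i : ι) : (n • c) i = n * c i := by simp

theorem inBox_fr (x : ι → ℝ) : InBox (fr x) := fun _ => ⟨Int.fract_nonneg _, Int.fract_lt_one _⟩

theorem inBox_zero : InBox (0 : ι → ℝ) := fun _ => by simp

theorem InBox.fr_eq {x : ι → ℝ} (h : InBox x) : fr x = x :=
  funext fun i => Int.fract_eq_self.2 (h i)

theorem sub_fr_mem (x : ι → ℝ) : x - fr x ∈ intLattice ι :=
  mem_intLattice.2 fun i => ⟨⌊x i⌋, by simp [fr, Int.self_sub_fract]⟩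

theorem fr_eq_fr_iff {x y : ι → ℝ} : fr x = fr y ↔ x - y ∈ intLattice ι := by
  rw [mem_intLattice, funext_iff]
  refine forall_congr' fun i => ?_
  rw [fr, fr, Int.fract_eq_fract]
  exact ⟨fun ⟨z, hz⟩ => ⟨z, hz.symm⟩, fun ⟨z, hz⟩ => ⟨z, hz.symm⟩⟩

theorem InBox.eq_of_sub_mem {x y : ι → ℝ} (hx : InBox x) (hy : InBox y)
    (h : x - y ∈ intLattice ι) : x = y := by
  rw [← hx.fr_eq, ← hy.fr_eq]
  exact fr_eq_fr_iff.2 h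

theorem fr_le {x : ι → ℝ} (hx : ∀ i, 0 ≤ x i) (i : ι) : fr x i ≤ x i := by
  have := Int.floor_nonneg.2 (hx i)
  have h2 : ((0 : ℤ) : ℝ) ≤ ⌊x i⌋ := by exact_mod_cast this
  have h3 := Int.fract_add_floor (x i)
  simp only [fr]
  push_cast at h2
  linarith

theorem mem_of_fr_mem {Γ : AddSubgroup (ι → ℝ)} (h : intLattice ι ≤ Γ) {x : ι → ℝ}
    (hx : fr x ∈ Γ) : x ∈ Γ := by
  have := add_mem (h (sub_fr_mem x)) hx
  simpa using this

theorem fr_mem {Γ : AddSubgroup (ι → ℝ)} (h : intLattice ι ≤ Γ) {x : ι → ℝ} (hx : x ∈ Γ) :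
    fr x ∈ Γ := by
  have := sub_mem hx (h (sub_fr_mem x))
  simpa using this

variable [Fintype ι]

/-- The height, that is the sum of the coordinates. -/
def ht (x : ι → ℝ) : ℝ := ∑ i, x i

theorem ht_add (x y : ι → ℝ) : ht (x + y) = ht x + ht y := by
  simp [ht, Finset.sum_add_distrib]

theorem ht_nsmul (a : ℕ) (x : ι → ℝ) : ht (a • x) = a * ht x := by
  simp [ht, Finset.mul_sum]

theorem ht_zero : ht (0 : ι → ℝ) = 0 := by simp [ht]

theorem ht_sum {α : Type} (s : Finset α) (x : α → ι → ℝ) :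
    ht (∑ a ∈ s, x a) = ∑ a ∈ s, ht (x a) := by
  simp only [ht, Finset.sum_apply]
  exact Finset.sum_comm

theorem ht_nonneg {x : ι → ℝ} (hx : ∀ i, 0 ≤ x i) : 0 ≤ ht x := Finset.sum_nonneg fun _ _ => hx _

theorem eq_of_le_of_ht_eq {x y : ι → ℝ} (h : ∀ i, x i ≤ y i) (hh : ht x = ht y) : x = y := by
  funext i
  exact (Finset.sum_eq_sum_iff_of_le fun i _ => h i).1 hh i (Finset.mem_univ i)

theorem ht_fr_le {x : ι → ℝ} (hx : ∀ i, 0 ≤ x i) : ht (fr x) ≤ ht x :=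
  Finset.sum_le_sum fun i _ => fr_le hx i

theorem inBox_of_ht_fr_eq {x : ι → ℝ} (hx : ∀ i, 0 ≤ x i) (h : ht (fr x) = ht x) : InBox x := by
  rw [← eq_of_le_of_ht_eq (fr_le hx) h]
  exact inBox_fr x

/-- The lattice `Γ` contains `ℤ^ι`, the heights of its elements in the unit box are
`0, k, …, (v - 1) k`, and each of these heights occurs exactly once. -/
structure StepLattice (Γ : AddSubgroup (ι → ℝ)) (k v : ℕ) : Prop where
  int_le : intLattice ι ≤ Γ
  height : ∀ x ∈ Γ, InBox x → ∃ j < v, ht x = (j : ℝ) * k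
  exists_elt : ∀ j < v, ∃ x ∈ Γ, InBox x ∧ ht x = (j : ℝ) * k
  eq_of_ht : ∀ x ∈ Γ, ∀ y ∈ Γ, InBox x → InBox y → ht x = ht y → x = y

/-- An injective self-map of `{0, …, n - 1}` with `f j ≤ j` is the identity. -/
theorem eq_self_of_injOn_of_le {n : ℕ} {f : ℕ → ℕ} (hf : ∀ i < n, ∀ j < n, f i = f j → i = j)
    (hle : ∀ j < n, f j ≤ j) : ∀ j < n, f j = j := by
  intro j
  induction j using Nat.strong_induction_on with
  | _ j ih =>
    intro hj
    by_contra hne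
    have hlt : f j < j := lt_of_le_of_ne (hle j hj) hne
    have h1 := ih (f j) hlt (hlt.trans hj)
    exact hne (hf (f j) (hlt.trans hj) j hj h1)

namespace StepLattice

variable {Γ : AddSubgroup (ι → ℝ)} {k v : ℕ}

theorem pos (h : StepLattice Γ k v) : 0 < v := by
  obtain ⟨j, hj, -⟩ := h.height 0 (zero_mem _) inBox_zero
  omega

/-- The box element of maximal height dominates all box elements. -/
theorem exists_top (h : StepLattice Γ k v) (hk : 1 ≤ k) :
    ∃ T ∈ Γ, InBox T ∧ ht T = ((v - 1 : ℕ) : ℝ) * k ∧ ∀ x ∈ Γ, InBox x → ∀ i, x i ≤ T i := by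
  have hv := h.pos
  have hk0 : (0 : ℝ) < k := by exact_mod_cast hk
  obtain ⟨T, hT, hTb, hTh⟩ := h.exists_elt (v - 1) (by omega)
  have hx : ∀ j, ∃ x : ι → ℝ, j < v → x ∈ Γ ∧ InBox x ∧ ht x = (j : ℝ) * k := by
    intro j
    by_cases hj : j < v
    · obtain ⟨x, h1, h2, h3⟩ := h.exists_elt j hj
      exact ⟨x, fun _ => ⟨h1, h2, h3⟩⟩
    · exact ⟨0, fun h => absurd h hj⟩
  choose g hg using hx
  have hy : ∀ j, ∃ m, j < v → m < v ∧ ht (fr (T - g j)) = (m : ℝ) * k := by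
    intro j
    by_cases hj : j < v
    · obtain ⟨m, h1, h2⟩ := h.height _ (fr_mem h.int_le (sub_mem hT (hg j hj).1)) (inBox_fr _)
      exact ⟨m, fun _ => ⟨h1, h2⟩⟩
    · exact ⟨0, fun h => absurd h hj⟩
  choose m hm using hy
  have hsum : ∀ j < v, ∀ i, 0 ≤ (fr (T - g j) + g j) i := fun j hj i =>
    add_nonneg (inBox_fr _ i).1 ((hg j hj).2.1 i).1
  have hfr : ∀ j, fr (fr (T - g j) + g j) = T := by
    intro j
    conv_rhs => rw [← hTb.fr_eq]
    rw [fr_eq_fr_iff]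
    have := neg_mem (sub_fr_mem (T - g j))
    convert this using 1
    abel
  -- The vectors `fr (T - g j)` and `g j` add up to T modulo 1, so their heights add up to at least
  -- that of T. Pigeonhole below turns this into equality for every j, so that no carry occurs and
  -- `g j ≤ T`.
  have hle : ∀ j < v, v - 1 - m j ≤ j := by
    intro j hj
    have h1 := ht_fr_le (hsum j hj)
    rw [hfr j, ht_add, hTh, (hm j hj).2, (hg j hj).2.2, ← add_mul] at h1
    have h2 := le_of_mul_le_mul_right h1 hk0
    have h3 : v - 1 ≤ m j + j := by exact_mod_cast h2
    omega
  have hinj : ∀ i < v, ∀ j < v, v - 1 - m i = v - 1 - m j → i = j := by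
    intro i hi j hj hij
    have h1 := (hm i hi).1
    have h2 := (hm j hj).1
    have h3 : m i = m j := by omega
    have h4 : fr (T - g i) = fr (T - g j) :=
      h.eq_of_ht _ (fr_mem h.int_le (sub_mem hT (hg i hi).1)) _
        (fr_mem h.int_le (sub_mem hT (hg j hj).1)) (inBox_fr _) (inBox_fr _)
        (by rw [(hm i hi).2, (hm j hj).2, h3])
    rw [fr_eq_fr_iff] at h4
    have h5 : g j - g i ∈ intLattice ι := by convert h4 using 1; abel
    have h6 := (hg j hj).2.1.eq_of_sub_mem (hg i hi).2.1 h5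
    have h7 := (hg j hj).2.2
    rw [h6, (hg i hi).2.2] at h7
    have := mul_right_cancel₀ hk0.ne' h7
    exact_mod_cast this
  have hself := eq_self_of_injOn_of_le hinj hle
  refine ⟨T, hT, hTb, hTh, fun x hx hxb i => ?_⟩
  obtain ⟨j, hj, hxj⟩ := h.height x hx hxb
  have hxg : x = g j := h.eq_of_ht _ hx _ (hg j hj).1 hxb (hg j hj).2.1 (by rw [hxj, (hg j hj).2.2])
  have h1 : m j + j = v - 1 := by have := hself j hj; have := (hm j hj).1; omega
  have h2 : ht (fr (fr (T - g j) + g j)) = ht (fr (T - g j) + g j) := by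
    rw [hfr j, hTh, ht_add, (hm j hj).2, (hg j hj).2.2, ← add_mul, ← h1]
    push_cast
    ring
  have h3 := eq_of_le_of_ht_eq (fr_le (hsum j hj)) h2
  rw [hfr j] at h3
  rw [h3, hxg]
  have := (inBox_fr (T - g j) i).1
  simp only [Pi.add_apply]
  linarith

/-- The `i`-th coordinates of a step lattice form `(1/m) ℤ`, and the top element has the
coordinate `1 - 1/m`. -/
theorem exists_order (h : StepLattice Γ k v) {T : ι → ℝ} (hT : T ∈ Γ) (hTb : InBox T)
    (hle : ∀ x ∈ Γ, InBox x → ∀ i, x i ≤ T i) (i : ι) :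
    ∃ m : ℕ, 0 < m ∧ T i = 1 - 1 / (m : ℝ) ∧ ∀ x ∈ Γ, (m : ℝ) * x i ∈ intReals := by
  set e := 1 - T i with he
  have he0 : 0 < e := by have := (hTb i).2; linarith
  have key : ∀ x ∈ Γ, ∃ q : ℤ, x i = q * e := by
    intro x hx
    refine ⟨⌊x i / e⌋, ?_⟩
    set q := ⌊x i / e⌋ with hq
    have h1 := Int.floor_le (x i / e)
    have h2 := Int.lt_floor_add_one (x i / e)
    rw [← hq, le_div_iff₀ he0] at h1
    rw [← hq, div_lt_iff₀ he0] at h2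
    by_contra hne
    have h3 : 0 < x i - q * e := lt_of_le_of_ne (by linarith) fun h => hne (by linarith)
    -- If x_i leaves a remainder δ with 0 < δ < e on division by e, this element has fractional part
    -- 1 - δ > 1 - e = T_i, against the maximality of T.
    have hy : -(x + q • T) ∈ Γ := neg_mem (add_mem hx (zsmul_mem hT q))
    have h4 := hle _ (fr_mem h.int_le hy) (inBox_fr _) i
    have h5 : fr (-(x + q • T)) i = 1 - (x i - q * e) := by
      simp only [fr]
      rw [Int.fract_eq_iff]
      have : T i < 1 := (hTb i).2
      have : 0 ≤ T i := (hTb i).1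
      refine ⟨by nlinarith, by linarith, -q - 1, ?_⟩
      have h6 : (q • T) i = q * T i := by simp
      rw [Pi.neg_apply, Pi.add_apply, h6]
      push_cast
      rw [he]
      ring
    rw [h5] at h4
    linarith
  -- The all-ones vector shows that 1 is itself a multiple of e, so e = 1/m.
  obtain ⟨q, hq⟩ := key (fun _ => 1) (h.int_le (mem_intLattice.2 fun _ => one_mem_intReals))
  have hq0 : 0 < q := by
    have : 0 < (q : ℝ) * e := by rw [← hq]; norm_num
    exact_mod_cast pos_of_mul_pos_left this he0.le
  obtain ⟨m, rfl⟩ := Int.eq_ofNat_of_zero_le hq0.le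
  have hm : 0 < m := by exact_mod_cast hq0
  have hm' : (0 : ℝ) < m := by exact_mod_cast hm
  have hem : (m : ℝ) * e = 1 := by rw [hq]; simp
  refine ⟨m, hm, ?_, fun x hx => ?_⟩
  · have h1 : e = 1 / m := by rw [eq_div_iff hm'.ne', mul_comm, hem]
    rw [← h1, he]
    ring
  · obtain ⟨q, hq⟩ := key x hx
    refine ⟨q, ?_⟩
    rw [hq]
    simp only [Int.coe_castAddHom]
    linear_combination -(q : ℝ) * hem

theorem exists_denominator (h : StepLattice Γ k v) (hk : 1 ≤ k) :
    ∃ m : ℕ, 0 < m ∧ ∀ x ∈ Γ, ∀ i, (m : ℝ) * x i ∈ intReals := by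
  obtain ⟨T, hT, hTb, -, hle⟩ := h.exists_top hk
  choose m hm0 _ hm using h.exists_order hT hTb hle
  refine ⟨∏ i, m i, Finset.prod_pos fun i _ => hm0 i, fun x hx i => ?_⟩
  obtain ⟨q, hq⟩ := Finset.dvd_prod_of_mem m (Finset.mem_univ i)
  rw [hq]
  push_cast
  rw [mul_comm (m i : ℝ), mul_assoc]
  exact mul_mem_intReals (natCast_mem_intReals q) (hm i x hx)

/-- Adjoining a vector `c` of height `M k` with `n c ∈ Γ`, no carries occurring. -/
theorem mem_sup_zmultiples {M n : ℕ} (h : StepLattice Γ k M) {c : ι → ℝ}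
    (hn : 0 < n) (hnc : n • c ∈ Γ) (hcarry : ∀ x ∈ Γ, InBox x → ∀ a < n, InBox (x + a • c))
    {y : ι → ℝ} (hy : y ∈ Γ ⊔ AddSubgroup.zmultiples c) (hyb : InBox y) :
    ∃ x ∈ Γ, InBox x ∧ ∃ a < n, y = x + a • c := by
  obtain ⟨x, hx, z, hz, rfl⟩ := AddSubgroup.mem_sup.1 hy
  obtain ⟨b, rfl⟩ := AddSubgroup.mem_zmultiples_iff.1 hz
  have hn' : (0 : ℤ) < n := by exact_mod_cast hn
  have hr0 := Int.emod_nonneg b hn'.ne'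
  have hr1 := Int.emod_lt_of_pos b hn'
  obtain ⟨a, ha⟩ := Int.eq_ofNat_of_zero_le hr0
  have han : a < n := by rw [ha] at hr1; exact_mod_cast hr1
  have hx' : x + (b / n) • (n • c) ∈ Γ := add_mem hx (zsmul_mem hnc _)
  refine ⟨fr (x + (b / n) • (n • c)), fr_mem h.int_le hx', inBox_fr _, a, han, ?_⟩
  refine hyb.eq_of_sub_mem (hcarry _ (fr_mem h.int_le hx') (inBox_fr _) a han) ?_
  have := sub_fr_mem (x + (b / n) • (n • c))
  convert this using 1
  -- Division of b with remainder: the quotient part is absorbed into Γ because n c ∈ Γ.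
  have hb : b • c = (b / n) • (n • c) + a • c := by
    rw [← natCast_zsmul c n, ← natCast_zsmul c a, smul_smul, ← add_smul]
    congr 1
    have := Int.emod_add_mul_ediv b n
    rw [ha] at this
    linarith
  rw [hb]
  abel

/-- Without carries the box elements of the larger lattice are x + ac, of height (aM + j)k with j <
M and a < n. Euclidean division by M makes (a, j) run through 0, …, nM - 1 exactly once. -/
theorem extend {M n : ℕ} (hk : 1 ≤ k) (h : StepLattice Γ k M) {c : ι → ℝ}
    (hc : ht c = (M : ℝ) * k) (hn : 0 < n) (hnc : n • c ∈ Γ)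
    (hcarry : ∀ x ∈ Γ, InBox x → ∀ a < n, InBox (x + a • c)) :
    StepLattice (Γ ⊔ AddSubgroup.zmultiples c) k (n * M) := by
  have hk0 : (0 : ℝ) < k := by exact_mod_cast hk
  have hM := h.pos
  have hht : ∀ x : ι → ℝ, ∀ j a : ℕ, ht x = (j : ℝ) * k →
      ht (x + a • c) = ((a * M + j : ℕ) : ℝ) * k := by
    intro x j a hj
    rw [ht_add, ht_nsmul, hc, hj]
    push_cast
    ring
  refine ⟨h.int_le.trans le_sup_left, ?_, ?_, ?_⟩
  · intro y hy hyb
    obtain ⟨x, hx, hxb, a, ha, rfl⟩ := h.mem_sup_zmultiples hn hnc hcarry hy hyb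
    obtain ⟨j, hj, hxj⟩ := h.height x hx hxb
    refine ⟨a * M + j, ?_, hht x j a hxj⟩
    calc a * M + j < a * M + M := by omega
      _ = (a + 1) * M := by ring
      _ ≤ n * M := Nat.mul_le_mul_right _ ha
  · intro j hj
    obtain ⟨x, hx, hxb, hxj⟩ := h.exists_elt (j % M) (Nat.mod_lt _ hM)
    have ha : j / M < n := Nat.div_lt_of_lt_mul (by rwa [mul_comm])
    refine ⟨x + (j / M) • c, AddSubgroup.mem_sup.2 ⟨x, hx, _, ?_, rfl⟩, hcarry x hx hxb _ ha, ?_⟩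
    · exact nsmul_mem (AddSubgroup.mem_zmultiples c) _
    · rw [hht x _ _ hxj, Nat.div_add_mod']
  · intro y hy y' hy' hyb hyb' he
    obtain ⟨x, hx, hxb, a, ha, rfl⟩ := h.mem_sup_zmultiples hn hnc hcarry hy hyb
    obtain ⟨x', hx', hxb', a', ha', rfl⟩ := h.mem_sup_zmultiples hn hnc hcarry hy' hyb'
    obtain ⟨j, hj, hxj⟩ := h.height x hx hxb
    obtain ⟨j', hj', hxj'⟩ := h.height x' hx' hxb'
    rw [hht x j a hxj, hht x' j' a' hxj'] at he
    have h1 : a * M + j = a' * M + j' := by exact_mod_cast mul_right_cancel₀ hk0.ne' he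
    have h2 : j = j' := by
      have := congrArg (· % M) h1
      simpa [Nat.mul_add_mod', Nat.mod_eq_of_lt hj, Nat.mod_eq_of_lt hj'] using this
    subst h2
    have h3 : a = a' := by
      have : a * M = a' * M := by omega
      exact Nat.eq_of_mul_eq_mul_right hM this
    rw [h3, h.eq_of_ht x hx x' hx' hxb hxb' (by rw [hxj, hxj'])]

end StepLattice

end Box

/-! ### Sublattices of a step lattice and the passage from one to a larger one -/

section Step

variable {ι : Type} [Fintype ι]

namespace StepLattice

variable {H Γ : AddSubgroup (ι → ℝ)} {k M v : ℕ}

theorem le_of_le (hk : 1 ≤ k) (hH : StepLattice H k M) (hΓ : StepLattice Γ k v) (hle : H ≤ Γ) :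
    M ≤ v := by
  have hk0 : (0 : ℝ) < k := by exact_mod_cast hk
  have := hH.pos
  obtain ⟨x, hx, hxb, hxh⟩ := hH.exists_elt (M - 1) (by omega)
  obtain ⟨j, hj, hxj⟩ := hΓ.height x (hle hx) hxb
  rw [hxh] at hxj
  have h1 := mul_right_cancel₀ hk0.ne' hxj
  have h2 : M - 1 = j := by exact_mod_cast h1
  omega

/-- In Γ a box element is known by its height, so step sublattices consist of initial segments of
the box elements. They are therefore nested and determined by their number of box elements. -/
theorem le_of_card_le {H' : AddSubgroup (ι → ℝ)} {M' : ℕ} (hΓ : StepLattice Γ k v)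
    (hH : StepLattice H k M) (hH' : StepLattice H' k M') (hle : H ≤ Γ) (hle' : H' ≤ Γ)
    (hM : M ≤ M') : H ≤ H' := by
  intro x hx
  have hf := fr_mem hH.int_le hx
  obtain ⟨j, hj, hxj⟩ := hH.height _ hf (inBox_fr x)
  obtain ⟨y, hy, hyb, hyj⟩ := hH'.exists_elt j (hj.trans_le hM)
  have := hΓ.eq_of_ht _ (hle hf) _ (hle' hy) (inBox_fr x) hyb (by rw [hxj, hyj])
  exact mem_of_fr_mem hH'.int_le (this ▸ hy)

/-- The step from a sublattice with `M` box elements to the next larger one: the box element `c` of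
height `M k` can be added without carries until a multiple of it lies in the sublattice. -/
theorem exists_step (hk : 1 ≤ k) (hH : StepLattice H k M) (hΓ : StepLattice Γ k v) (hle : H ≤ Γ)
    {c : ι → ℝ} (hc : c ∈ Γ) (hcb : InBox c) (hch : ht c = (M : ℝ) * k) :
    ∃ n : ℕ, 2 ≤ n ∧ n • c ∈ H ∧ ∀ x ∈ H, InBox x → ∀ a < n, InBox (x + a • c) := by
  classical
  have hk0 : (0 : ℝ) < k := by exact_mod_cast hk
  have hM := hH.pos
  have hac : ∀ a : ℕ, ht (a • c) = ((a * M : ℕ) : ℝ) * k := by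
    intro a
    rw [ht_nsmul, hch]
    push_cast
    ring
  -- The multiple v c would have height v M k, beyond the largest height (v - 1) k.
  have hex : ∃ a : ℕ, ¬ InBox (a • c) := by
    refine ⟨v, fun hb => ?_⟩
    obtain ⟨j, hj, hh⟩ := hΓ.height _ (nsmul_mem hc v) hb
    rw [hac] at hh
    have h1 : v * M = j := by exact_mod_cast mul_right_cancel₀ hk0.ne' hh
    have h2 := Nat.le_mul_of_pos_right v hM
    omega
  set n := Nat.find hex with hn
  have hnb : ¬ InBox (n • c) := Nat.find_spec hex
  have hbox : ∀ a < n, InBox (a • c) := fun a ha => not_not.1 (Nat.find_min hex ha)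
  have hn2 : 2 ≤ n := by
    by_contra hlt
    have h01 : n = 0 ∨ n = 1 := by omega
    rcases h01 with h0 | h0 <;> rw [h0] at hnb
    · exact hnb (by simpa using inBox_zero)
    · exact hnb (by simpa using hcb)
  have hnot : ∀ a, 0 < a → a < n → a • c ∉ H := by
    intro a ha0 ha hmem
    obtain ⟨j, hj, hh⟩ := hH.height _ hmem (hbox a ha)
    rw [hac] at hh
    have h1 : a * M = j := by exact_mod_cast mul_right_cancel₀ hk0.ne' hh
    have h2 := Nat.le_mul_of_pos_left M ha0
    omega
  have hx : ∀ j, ∃ x : ι → ℝ, j < M → x ∈ H ∧ InBox x ∧ ht x = (j : ℝ) * k := by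
    intro j
    by_cases hj : j < M
    · obtain ⟨x, h1, h2, h3⟩ := hH.exists_elt j hj
      exact ⟨x, fun _ => ⟨h1, h2, h3⟩⟩
    · exact ⟨0, fun h => absurd h hj⟩
  choose g hg using hx
  have hht : ∀ a j : ℕ, j < M → ht (g j + a • c) = ((a * M + j : ℕ) : ℝ) * k := by
    intro a j hj
    rw [ht_add, hac, (hg j hj).2.2]
    push_cast
    ring
  have hmemΓ : ∀ a j : ℕ, j < M → g j + a • c ∈ Γ := fun a j hj =>
    add_mem (hle (hg j hj).1) (nsmul_mem hc a)
  have hnn : ∀ a j : ℕ, j < M → ∀ i, 0 ≤ (g j + a • c) i := fun a j hj i => by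
    have h1 := ((hg j hj).2.1 i).1
    have h2 := (hcb i).1
    simp only [Pi.add_apply, nsmul_coord]
    positivity
  have hdiff : ∀ (x y : ι → ℝ) (a a' : ℕ), x ∈ H → y ∈ H → a' ≤ a →
      (x + a • c) - (y + a' • c) ∈ intLattice ι → (a - a') • c ∈ H := by
    intro x y a a' hx hy haa hmem
    have h1 := add_mem (sub_mem (hH.int_le hmem) hx) hy
    convert h1 using 1
    obtain ⟨b, rfl⟩ := Nat.exists_eq_add_of_le haa
    rw [Nat.add_sub_cancel_left, add_smul]
    abel
  have hcarry : ∀ a < n, ∀ j < M, InBox (g j + a • c) := by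
    intro a
    induction a using Nat.strong_induction_on with
    | _ a ih =>
    intro ha
    have hm : ∀ j, ∃ m : ℕ, j < M → ht (fr (g j + a • c)) = (m : ℝ) * k := by
      intro j
      by_cases hj : j < M
      · obtain ⟨m, -, hm⟩ := hΓ.height _ (fr_mem hΓ.int_le (hmemΓ a j hj)) (inBox_fr _)
        exact ⟨m, fun _ => hm⟩
      · exact ⟨0, fun h => absurd h hj⟩
    choose m hm using hm
    have hupper : ∀ j < M, m j ≤ a * M + j := by
      intro j hj
      have h1 := ht_fr_le (hnn a j hj)
      rw [hm j hj, hht a j hj] at h1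
      exact_mod_cast le_of_mul_le_mul_right h1 hk0
    -- A smaller height belongs to some `g j' + a' • c` with a' < a, in the box by induction. The
    -- two elements would coincide modulo 1 and put (a - a') c into H.
    have hlower : ∀ j < M, a * M ≤ m j := by
      intro j hj
      by_contra hlt
      have h1 : m j / M < a := Nat.div_lt_of_lt_mul (by rw [mul_comm]; omega)
      have h2 : m j % M < M := Nat.mod_lt _ hM
      have h3 := ih _ h1 (h1.trans ha) _ h2
      have h4 := hΓ.eq_of_ht _ (fr_mem hΓ.int_le (hmemΓ a j hj)) _ (hmemΓ _ _ h2) (inBox_fr _) h3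
        (by rw [hm j hj, hht _ _ h2, Nat.div_add_mod'])
      rw [← h3.fr_eq, fr_eq_fr_iff] at h4
      exact hnot (a - m j / M) (Nat.sub_pos_of_lt h1) ((Nat.sub_le _ _).trans_lt ha)
        (hdiff _ _ _ _ (hg j hj).1 (hg _ h2).1 h1.le h4)
    -- Reduction modulo 1 can only lower the height, and distinct j give distinct heights; hence no
    -- height is lost and no carry occurs.
    have hself := eq_self_of_injOn_of_le (n := M) (f := fun j => m j - a * M) (by
      intro i hi j hj hij
      have h1 := hlower i hi
      have h2 := hlower j hj
      have h3 : m i = m j := by omega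
      have h4 := hΓ.eq_of_ht _ (fr_mem hΓ.int_le (hmemΓ a i hi)) _
        (fr_mem hΓ.int_le (hmemΓ a j hj)) (inBox_fr _) (inBox_fr _)
        (by rw [hm i hi, hm j hj, h3])
      rw [fr_eq_fr_iff, add_sub_add_right_eq_sub] at h4
      have h5 := (hg i hi).2.1.eq_of_sub_mem (hg j hj).2.1 h4
      have h6 := (hg i hi).2.2
      rw [h5, (hg j hj).2.2] at h6
      exact_mod_cast (mul_right_cancel₀ hk0.ne' h6).symm) (by
      intro j hj
      have := hupper j hj
      omega)
    intro j hj
    refine inBox_of_ht_fr_eq (hnn a j hj) ?_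
    have h1 := hself j hj
    have h2 := hlower j hj
    rw [hm j hj, hht a j hj]
    congr 2
    omega
  refine ⟨n, hn2, ?_, fun x hx hxb a ha => ?_⟩
  · have hncΓ : n • c ∈ Γ := nsmul_mem hc n
    have hncnn : ∀ i, 0 ≤ (n • c) i := fun i => by
      have h2 := (hcb i).1
      simp only [nsmul_coord]
      positivity
    obtain ⟨m, -, hm⟩ := hΓ.height _ (fr_mem hΓ.int_le hncΓ) (inBox_fr _)
    have h1 := ht_fr_le hncnn
    have h2 : ht (fr (n • c)) ≠ ht (n • c) := fun h => hnb (inBox_of_ht_fr_eq hncnn h)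
    have h3 := lt_of_le_of_ne h1 h2
    rw [hm, hac] at h3
    have h4 : m < n * M := by exact_mod_cast lt_of_mul_lt_mul_right h3 hk0.le
    have h5 : m / M < n := Nat.div_lt_of_lt_mul (by rwa [mul_comm])
    have h6 : m % M < M := Nat.mod_lt _ hM
    have h7 := hcarry _ h5 _ h6
    have h8 := hΓ.eq_of_ht _ (fr_mem hΓ.int_le hncΓ) _ (hmemΓ _ _ h6) (inBox_fr _) h7
        (by rw [hm, hht _ _ h6, Nat.div_add_mod'])
    rw [← h7.fr_eq, fr_eq_fr_iff] at h8
    -- The multiple n c does carry, so its reduction has height below n M k and is some g + q c with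
    -- q < n. Then (n - q) c ∈ H, which `hnot` permits only for q = 0.
    have h9 := hdiff 0 _ n _ (zero_mem _) (hg _ h6).1 h5.le (by rwa [zero_add])
    rcases Nat.eq_zero_or_pos (m / M) with h0 | h0
    · rwa [h0, Nat.sub_zero] at h9
    · exact absurd h9 (hnot _ (by omega) (by omega))
  · obtain ⟨j, hj, hxj⟩ := hH.height x hx hxb
    rw [hH.eq_of_ht x hx _ (hg j hj).1 hxb (hg j hj).2.1 (by rw [hxj, (hg j hj).2.2])]
    exact hcarry a ha j hj

/-- The coordinates of the vector adjoined in a step. -/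
theorem step_coord (hk : 1 ≤ k) (hH : StepLattice H k M) {c : ι → ℝ} (hcb : InBox c) {n : ℕ}
    (hn : 2 ≤ n) (hnc : n • c ∈ H) (hcarry : ∀ x ∈ H, InBox x → ∀ a < n, InBox (x + a • c))
    (i : ι) :
    ((∀ x ∈ H, x i ∈ intReals) → c i = 0 ∨ c i = 1 / (n : ℝ)) ∧
    ((∃ x ∈ H, x i ∉ intReals) → c i = fr (n • c) i / n ∧
      ∀ x ∈ H, InBox x → fr (n • c) i ≤ 1 - x i) := by
  have hn0 : (0 : ℝ) < n := by exact_mod_cast (by omega : 0 < n)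
  have hn2 : (2 : ℝ) ≤ n := by exact_mod_cast hn
  have hc0 := (hcb i).1
  have hc1 := (hcb i).2
  obtain ⟨T, hT, hTb, -, hTle⟩ := hH.exists_top hk
  have hcT := (hcarry T hT hTb (n - 1) (by omega) i).2
  have hnci : (n • c) i = n * c i := by simp
  simp only [Pi.add_apply, nsmul_coord] at hcT
  rw [Nat.cast_sub (by omega), Nat.cast_one] at hcT
  have hT0 := (hTb i).1
  constructor
  · intro htriv
    obtain ⟨z, hz⟩ := mem_intReals.1 (htriv _ hnc)
    rw [hnci] at hz
    have h1 : (z : ℝ) < 2 := by rw [hz]; nlinarith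
    have h2 : (0 : ℝ) ≤ z := by rw [hz]; positivity
    -- Adding (n - 1) c to the top element without carry gives (n - 1) c_i < 1, so the integer n c_i
    -- is 0 or 1.
    have h3 : z < 2 := by exact_mod_cast h1
    have h4 : 0 ≤ z := by exact_mod_cast h2
    have h5 : z = 0 ∨ z = 1 := by omega
    rcases h5 with rfl | rfl
    · left
      have : (n : ℝ) * c i = 0 := by rw [← hz]; simp
      rcases mul_eq_zero.1 this with h | h
      · exact absurd h hn0.ne'
      · exact h
    · right
      rw [eq_div_iff hn0.ne', mul_comm, ← hz]
      simp
  · rintro ⟨x, hx, hxi⟩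
    obtain ⟨m, hm0, hTm, hm⟩ := hH.exists_order hT hTb hTle i
    have hm2 : 2 ≤ m := by
      by_contra hlt
      have : m = 1 := by omega
      subst this
      exact hxi (by simpa using hm x hx)
    have hm0' : (0 : ℝ) < m := by exact_mod_cast hm0
    have hm2' : (2 : ℝ) ≤ m := by exact_mod_cast hm2
    have hmi : (m : ℝ) * (1 / m) = 1 := by field_simp
    -- The gap above T_i is 1/m. Since n ≤ 2(n - 1), n c_i < 2/m ≤ 1, so nothing is lost modulo 1;
    -- and n c_i, being a multiple of 1/m, is at most 1/m = 1 - T_i.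
    have h1 : ((n : ℝ) - 1) * c i < 1 / m := by rw [hTm] at hcT; linarith
    have h2 : (n : ℝ) * c i < 2 * (1 / m) := by nlinarith
    have h3 : (1 : ℝ) / m ≤ 1 / 2 := one_div_le_one_div_of_le (by norm_num) hm2'
    have h4 : fr (n • c) i = n * c i := by
      simp only [fr]
      rw [hnci, Int.fract_eq_self]
      exact ⟨by positivity, by linarith⟩
    refine ⟨by rw [h4]; field_simp, fun y hy hyb => ?_⟩
    have h5 : fr (n • c) i ≤ 1 / m := by
      obtain ⟨z, hz⟩ := mem_intReals.1 (hm _ hnc)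
      rw [hnci] at hz
      have h6 : (z : ℝ) < 2 := by
        rw [hz]
        calc (m : ℝ) * (n * c i) < m * (2 * (1 / m)) := by gcongr
          _ = 2 := by field_simp
      have h7 : z < 2 := by exact_mod_cast h6
      have h8 : (z : ℝ) ≤ 1 := by exact_mod_cast (by omega : z ≤ 1)
      rw [h4, le_div_iff₀ hm0', mul_comm, ← hz]
      exact h8
    have := hTle y hy hyb i
    rw [hTm] at this
    linarith

end StepLattice

end Step

/-! ### Lattices generated step by step, and the symbol sets -/

section Chain

variable {ι : Type} {s : ℕ}

/-- The indices of the first `i` steps. -/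
def below (i : Fin (s + 1)) : Finset (Fin s) := Finset.univ.filter fun u => u.castSucc < i

theorem mem_below {i : Fin (s + 1)} {u : Fin s} : u ∈ below i ↔ u.castSucc < i := by simp [below]

theorem below_zero : below (0 : Fin (s + 1)) = ∅ := by
  ext u
  simp [mem_below]

theorem below_last : below (Fin.last s) = Finset.univ := by
  ext u
  simp [mem_below, Fin.castSucc_lt_last]

theorem notMem_below (j : Fin s) : j ∉ below j.castSucc := by simp [mem_below]

theorem below_succ (j : Fin s) : below j.succ = insert j (below j.castSucc) := by
  ext u
  simp only [mem_below, Finset.mem_insert, Fin.lt_def, Fin.ext_iff, Fin.val_succ, Fin.val_castSucc]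
  omega

theorem sum_below_succ {α : Type} [AddCommMonoid α] (g : Fin s → α) (j : Fin s) :
    ∑ u ∈ below j.succ, g u = g j + ∑ u ∈ below j.castSucc, g u := by
  rw [below_succ, Finset.sum_insert (notMem_below j)]

/-- The lattice generated by `ℤ^ι` and the first `i` of the vectors `c_j`. -/
def chainLattice (c : Fin s → ι → ℝ) (i : Fin (s + 1)) : AddSubgroup (ι → ℝ) :=
  Fin.induction (motive := fun _ => AddSubgroup (ι → ℝ)) (intLattice ι)
    (fun j H => H ⊔ AddSubgroup.zmultiples (c j)) i

theorem chainLattice_zero (c : Fin s → ι → ℝ) : chainLattice c 0 = intLattice ι := rfl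

theorem chainLattice_succ (c : Fin s → ι → ℝ) (j : Fin s) :
    chainLattice c j.succ = chainLattice c j.castSucc ⊔ AddSubgroup.zmultiples (c j) := by
  rw [chainLattice, Fin.induction_succ]
  rfl

theorem mem_chainLattice (c : Fin s → ι → ℝ) (i : Fin (s + 1)) (x : ι → ℝ) :
    x ∈ chainLattice c i ↔ ∃ a : Fin s → ℤ, x - ∑ u ∈ below i, a u • c u ∈ intLattice ι := by
  induction i using Fin.induction generalizing x with
  | zero => simp [below_zero, chainLattice_zero]
  | succ j ih =>
    rw [chainLattice_succ, AddSubgroup.mem_sup]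
    constructor
    · rintro ⟨y, hy, z, hz, rfl⟩
      obtain ⟨b, rfl⟩ := AddSubgroup.mem_zmultiples_iff.1 hz
      obtain ⟨a, ha⟩ := (ih y).1 hy
      refine ⟨Function.update a j b, ?_⟩
      rw [sum_below_succ, Function.update_self]
      have h : ∑ u ∈ below j.castSucc, Function.update a j b u • c u
          = ∑ u ∈ below j.castSucc, a u • c u := by
        refine Finset.sum_congr rfl fun u hu => ?_
        rw [Function.update_of_ne]
        rintro rfl
        exact notMem_below u hu
      rw [h]
      convert ha using 1
      abel
    · rintro ⟨a, ha⟩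
      refine ⟨x - a j • c j, (ih _).2 ⟨a, ?_⟩, a j • c j,
        AddSubgroup.mem_zmultiples_iff.2 ⟨a j, rfl⟩, by abel⟩
      rw [sum_below_succ] at ha
      convert ha using 1
      abel

theorem intLattice_le_chainLattice (c : Fin s → ι → ℝ) (i : Fin (s + 1)) :
    intLattice ι ≤ chainLattice c i := by
  induction i using Fin.induction with
  | zero => exact le_rfl
  | succ j ih => rw [chainLattice_succ]; exact ih.trans le_sup_left

theorem mem_chainLattice_of_mem_below (c : Fin s → ι → ℝ) (i : Fin (s + 1)) {u : Fin s}
    (hu : u ∈ below i) : c u ∈ chainLattice c i := by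
  induction i using Fin.induction with
  | zero => simp [below_zero] at hu
  | succ j ih =>
    rw [chainLattice_succ]
    rw [below_succ, Finset.mem_insert] at hu
    rcases hu with rfl | hu
    · exact AddSubgroup.mem_sup_right (AddSubgroup.mem_zmultiples _)
    · exact AddSubgroup.mem_sup_left (ih hu)

theorem chainLattice_le (c : Fin s → ι → ℝ) (i : Fin (s + 1)) {Γ : AddSubgroup (ι → ℝ)}
    (h0 : intLattice ι ≤ Γ) (h : ∀ u ∈ below i, c u ∈ Γ) : chainLattice c i ≤ Γ := by
  intro x hx
  obtain ⟨a, ha⟩ := (mem_chainLattice c i x).1 hx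
  have := add_mem (h0 ha) (sum_mem (t := below i) fun u hu => zsmul_mem (h u hu) (a u))
  simpa using this

theorem chainLattice_mono (c : Fin s → ι → ℝ) {i j : Fin (s + 1)} (h : i ≤ j) :
    chainLattice c i ≤ chainLattice c j :=
  chainLattice_le c i (intLattice_le_chainLattice c j) fun _ hu =>
    mem_chainLattice_of_mem_below c j (mem_below.2 ((mem_below.1 hu).trans_le h))

theorem symbolSet_succ (J : Fin s → Finset (Fin s)) (j : Fin s) :
    symbolSet J j.succ = (symbolSet J j.castSucc \ J j) ∪ {j} := by
  rw [symbolSet, Fin.induction_succ]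
  rfl

/-- A symbol enters once, at its own step, and never returns after removal. This non-recursive form
is what the existence proof verifies. -/
theorem mem_symbolSet (J : Fin s → Finset (Fin s)) (i : Fin (s + 1)) (u : Fin s) :
    u ∈ symbolSet J i ↔ u.castSucc < i ∧ ∀ j, u < j → j.castSucc < i → u ∉ J j := by
  induction i using Fin.induction with
  | zero => simp [symbolSet]
  | succ j ih =>
    rw [symbolSet_succ, Finset.mem_union, Finset.mem_sdiff, ih, Finset.mem_singleton]
    simp only [Fin.lt_def, Fin.val_succ, Fin.val_castSucc, Fin.ext_iff]
    constructor
    · rintro (⟨⟨h1, h2⟩, h3⟩ | h)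
      · refine ⟨by omega, fun p hp hpj => ?_⟩
        rcases Nat.lt_succ_iff_lt_or_eq.1 hpj with h | h
        · exact h2 p hp h
        · rwa [Fin.ext h]
      · exact ⟨by omega, fun p hp hpj => by omega⟩
    · rintro ⟨h1, h2⟩
      rcases Nat.lt_succ_iff_lt_or_eq.1 h1 with h | h
      · exact Or.inl ⟨⟨h, fun p hp hpj => h2 p hp (by omega)⟩, h2 j h (by omega)⟩
      · exact Or.inr h

end Chain

/-! ### Arithmetic of a datum and of its generators -/

namespace ChainDatum

variable {v : ℕ} (D : ChainDatum v)

theorem M_succ (j : Fin D.s) : D.M j.succ = D.ratio j * D.M j.castSucc :=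
  (Nat.div_mul_cancel (D.M_dvd j)).symm

theorem two_le_ratio (j : Fin D.s) : 2 ≤ D.ratio j := by
  have h1 := D.M_lt j
  have h2 := D.M_succ j
  by_contra h
  have : D.ratio j ≤ 1 := by omega
  have := Nat.mul_le_mul_right (D.M j.castSucc) this
  omega

theorem ratio_pos (j : Fin D.s) : (0 : ℝ) < D.ratio j := by
  have := D.two_le_ratio j
  exact_mod_cast (by omega : 0 < D.ratio j)

theorem M_strictMono : StrictMono D.M := Fin.strictMono_iff_lt_succ.2 D.M_lt

/-- The chain at least doubles at each step, so it is superincreasing. Positivity of the block sizes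
and uniqueness of subset sums rest on this. -/
theorem sum_M_lt (i : Fin (D.s + 1)) : ∑ u ∈ below i, D.M u.castSucc < D.M i := by
  induction i using Fin.induction with
  | zero => simp [below_zero, D.M_first]
  | succ j ih =>
    rw [sum_below_succ, D.M_succ]
    have := Nat.mul_le_mul_right (D.M j.castSucc) (D.two_le_ratio j)
    omega

theorem J_subset_below (j : Fin D.s) : D.J j ⊆ below j.castSucc := fun u hu =>
  mem_below.2 (lt_of_mem_symbolSet D.J _ u (D.J_subset j hu))

theorem sum_J_lt (j : Fin D.s) : ∑ u ∈ D.J j, D.M u.castSucc < D.M j.castSucc :=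
  (Finset.sum_le_sum_of_subset (D.J_subset_below j)).trans_lt (D.sum_M_lt _)

theorem blockSize_pos {k : ℕ} (hk : 1 ≤ k) (j : Fin D.s) : 0 < D.blockSize k j := by
  have h1 := D.sum_J_lt j
  have h2 := D.M_lt j
  exact Nat.mul_pos hk (by omega)

theorem blockSize_cast (k : ℕ) (j : Fin D.s) :
    (D.blockSize k j : ℝ) = k * ((D.M j.succ : ℝ) - ∑ u ∈ D.J j, (D.M u.castSucc : ℝ)) := by
  have h1 := D.sum_J_lt j
  have h2 := D.M_lt j
  rw [blockSize, Nat.cast_mul, Nat.cast_sub (by omega), Nat.cast_sum]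

/-- A subset of the first `i` steps is determined by the sum of its `M`-values. -/
theorem eq_of_sum_M_eq (i : Fin (D.s + 1)) {A B : Finset (Fin D.s)} (hA : A ⊆ below i)
    (hB : B ⊆ below i) (h : ∑ u ∈ A, D.M u.castSucc = ∑ u ∈ B, D.M u.castSucc) : A = B := by
  induction i using Fin.induction generalizing A B with
  | zero =>
    rw [below_zero, Finset.subset_empty] at hA hB
    rw [hA, hB]
  | succ j ih =>
    rw [below_succ] at hA hB
    have hA' : A.erase j ⊆ below j.castSucc := by rwa [← Finset.subset_insert_iff]
    have hB' : B.erase j ⊆ below j.castSucc := by rwa [← Finset.subset_insert_iff]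
    have key : ∀ {A : Finset (Fin D.s)}, A.erase j ⊆ below j.castSucc →
        ∑ u ∈ A.erase j, D.M u.castSucc < D.M j.castSucc := fun h =>
      (Finset.sum_le_sum_of_subset h).trans_lt (D.sum_M_lt _)
    have h1 := key hA'
    have h2 := key hB'
    by_cases hjA : j ∈ A <;> by_cases hjB : j ∈ B
    · rw [← Finset.add_sum_erase _ _ hjA, ← Finset.add_sum_erase _ _ hjB] at h
      have := ih hA' hB' (by omega)
      rw [← Finset.insert_erase hjA, ← Finset.insert_erase hjB, this]
    · rw [Finset.erase_eq_of_notMem hjB] at h2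
      rw [← Finset.add_sum_erase _ _ hjA] at h
      omega
    · rw [Finset.erase_eq_of_notMem hjA] at h1
      rw [← Finset.add_sum_erase _ _ hjB] at h
      omega
    · rw [Finset.erase_eq_of_notMem hjA] at hA'
      rw [Finset.erase_eq_of_notMem hjB] at hB'
      exact ih hA' hB' h

theorem gen_self (j : Fin D.s) : D.gen j j = 1 / D.ratio j := by rw [gen_eq, if_pos rfl]

theorem gen_of_ne {j b : Fin D.s} (h : b ≠ j) :
    D.gen j b = (∑ u ∈ D.J j, D.gen u b) / D.ratio j := by
  rw [gen_eq, if_neg h, Finset.sum_coe_sort (D.J j) fun u => D.gen u b]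

theorem gen_nonneg (j b : Fin D.s) : 0 ≤ D.gen j b := by
  induction j using WellFoundedLT.induction with
  | _ j ih =>
    rcases eq_or_ne b j with rfl | h
    · rw [gen_self]
      positivity
    · rw [D.gen_of_ne h]
      exact div_nonneg (Finset.sum_nonneg fun u hu => ih u (D.lt_of_mem_J hu)) (D.ratio_pos j).le

theorem gen_of_lt {j b : Fin D.s} (h : j < b) : D.gen j b = 0 := by
  induction j using WellFoundedLT.induction with
  | _ j ih =>
    rw [D.gen_of_ne h.ne', Finset.sum_eq_zero, zero_div]
    intro u hu
    exact ih u (D.lt_of_mem_J hu) ((D.lt_of_mem_J hu).trans h)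

/-- Because c_u vanishes on block j for u < j, the two cases of the recursion merge into one
relation: n_j c_j is the indicator of block j plus ∑ c_u over J_j. -/
theorem ratio_mul_gen (j b : Fin D.s) :
    D.ratio j * D.gen j b = (if b = j then 1 else 0) + ∑ u ∈ D.J j, D.gen u b := by
  have h0 := (D.ratio_pos j).ne'
  split_ifs with h
  · subst h
    rw [gen_self, Finset.sum_eq_zero fun u hu => D.gen_of_lt (D.lt_of_mem_J hu)]
    field_simp
    simp
  · rw [D.gen_of_ne h]
    field_simp
    simp

theorem sum_symbolSet_succ (g : Fin D.s → ℝ) (j : Fin D.s) :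
    ∑ u ∈ symbolSet D.J j.succ, g u
      = ∑ u ∈ symbolSet D.J j.castSucc, g u - ∑ u ∈ D.J j, g u + g j := by
  rw [symbolSet_succ, Finset.sum_union, Finset.sum_singleton,
    Finset.sum_sdiff_eq_sub (D.J_subset j)]
  rw [Finset.disjoint_singleton_right, Finset.mem_sdiff]
  rintro ⟨h, -⟩
  exact absurd (lt_of_mem_symbolSet D.J _ j h) (lt_irrefl _)

/-- The coordinate of the largest box element. -/
theorem sum_ratio_sub_one_mul_gen (i : Fin (D.s + 1)) (b : Fin D.s) :
    ∑ u ∈ below i, ((D.ratio u : ℝ) - 1) * D.gen u b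
      = (if b ∈ below i then 1 else 0) - ∑ u ∈ symbolSet D.J i, D.gen u b := by
  induction i using Fin.induction with
  | zero => simp [below_zero, symbolSet]
  | succ j ih =>
    -- Telescoping: (n_j - 1) c_j contributes the indicator of block j, adds ∑ c_u over J_j and
    -- subtracts c_j, exactly cancelling the change of the symbol set.
    rw [sum_below_succ, ih, sum_symbolSet_succ, sub_mul, ratio_mul_gen]
    have : (if b ∈ below j.succ then (1 : ℝ) else 0)
        = (if b = j then 1 else 0) + if b ∈ below j.castSucc then 1 else 0 := by
      by_cases hb : b = j
      · subst hb
        simp [below_succ, notMem_below]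
      · simp [below_succ, hb]
    rw [this]
    ring

/-- When J_j removes a symbol that is positive on b, c_j inherits positivity there and its symbol
joins the set. This makes the bound below 1 strict. -/
theorem exists_gen_pos (i : Fin (D.s + 1)) {b : Fin D.s} (hb : b ∈ below i) :
    ∃ u ∈ symbolSet D.J i, 0 < D.gen u b := by
  induction i using Fin.induction with
  | zero => simp [below_zero] at hb
  | succ j ih =>
    have hpos := D.ratio_pos j
    rw [below_succ, Finset.mem_insert] at hb
    rcases hb with rfl | hb
    · refine ⟨b, by simp [symbolSet_succ], ?_⟩
      rw [gen_self]
      positivity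
    · obtain ⟨u, hu, hub⟩ := ih hb
      by_cases huJ : u ∈ D.J j
      · refine ⟨j, by simp [symbolSet_succ], ?_⟩
        have hbj : b ≠ j := by rintro rfl; exact notMem_below b hb
        rw [D.gen_of_ne hbj]
        exact div_pos (Finset.sum_pos' (fun u _ => D.gen_nonneg u b) ⟨u, huJ, hub⟩) hpos
      · exact ⟨u, by simp [symbolSet_succ, hu, huJ], hub⟩

theorem sum_ratio_sub_one_mul_gen_lt_one (i : Fin (D.s + 1)) (b : Fin D.s) :
    ∑ u ∈ below i, ((D.ratio u : ℝ) - 1) * D.gen u b < 1 := by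
  rw [sum_ratio_sub_one_mul_gen]
  by_cases hb : b ∈ below i
  · rw [if_pos hb]
    obtain ⟨u, hu, hub⟩ := D.exists_gen_pos i hb
    have := Finset.sum_pos' (fun u _ => D.gen_nonneg u b) ⟨u, hu, hub⟩
    linarith
  · rw [if_neg hb]
    have := Finset.sum_nonneg (s := symbolSet D.J i) fun u _ => D.gen_nonneg u b
    linarith

/-! ### The lattice of a datum -/

variable {ι : Type}

/-- The generators of the datum as vectors, the coordinates being divided into blocks by `f`. -/
def vec (f : ι → Fin D.s) (j : Fin D.s) : ι → ℝ := fun i => D.gen j (f i)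

theorem vec_nonneg (f : ι → Fin D.s) (j : Fin D.s) (i : ι) : 0 ≤ D.vec f j i := D.gen_nonneg _ _

variable {D} in
theorem ratio_smul_vec_mem (f : ι → Fin D.s) (j : Fin D.s) :
    D.ratio j • D.vec f j - ∑ u ∈ D.J j, D.vec f u ∈ intLattice ι := by
  rw [mem_intLattice]
  intro i
  rw [Pi.sub_apply, nsmul_coord, Finset.sum_apply, vec, ratio_mul_gen]
  simp only [vec, add_sub_cancel_right]
  split_ifs
  · exact one_mem_intReals
  · exact zero_mem _

variable {D} in
theorem sum_vec_mem_chainLattice (f : ι → Fin D.s) {i : Fin (D.s + 1)} {A : Finset (Fin D.s)}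
    (hA : A ⊆ below i) : ∑ u ∈ A, D.vec f u ∈ chainLattice (D.vec f) i :=
  sum_mem fun _ hu => mem_chainLattice_of_mem_below _ _ (hA hu)

variable {D} in
-- Each n_u - 1 is at least 1, so the sum is dominated by the top element.
theorem inBox_sum_vec (f : ι → Fin D.s) (A : Finset (Fin D.s)) : InBox (∑ u ∈ A, D.vec f u) := by
  intro a
  rw [Finset.sum_apply]
  refine ⟨Finset.sum_nonneg fun u _ => D.vec_nonneg f u a, ?_⟩
  refine lt_of_le_of_lt ?_ (D.sum_ratio_sub_one_mul_gen_lt_one (Fin.last _) (f a))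
  rw [below_last]
  have h1 : ∀ u, D.gen u (f a) ≤ ((D.ratio u : ℝ) - 1) * D.gen u (f a) := by
    intro u
    have h2 : (2 : ℝ) ≤ D.ratio u := by exact_mod_cast D.two_le_ratio u
    have h3 := D.gen_nonneg u (f a)
    nlinarith
  calc ∑ u ∈ A, D.vec f u a ≤ ∑ u, D.vec f u a :=
        Finset.sum_le_sum_of_subset_of_nonneg (Finset.subset_univ A) fun u _ _ =>
          D.vec_nonneg f u a
    _ ≤ _ := Finset.sum_le_sum fun u _ => h1 u

variable {D} in
theorem inBox_vec (f : ι → Fin D.s) (j : Fin D.s) : InBox (D.vec f j) := by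
  simpa using inBox_sum_vec f {j}

variable [Fintype ι]

/-- The map `f` divides the coordinates into blocks of the sizes prescribed by the datum. -/
def IsBlockMap (k : ℕ) (f : ι → Fin D.s) : Prop :=
  ∀ b, (Finset.univ.filter fun i => f i = b).card = D.blockSize k b

variable {D}

/-- The block sizes are chosen for this: summing the relation for n_j c_j over all coordinates gives
k M_j in total. -/
theorem IsBlockMap.ht_vec {k : ℕ} {f : ι → Fin D.s} (hf : D.IsBlockMap k f) (j : Fin D.s) :
    ht (D.vec f j) = (D.M j.castSucc : ℝ) * k := by
  induction j using WellFoundedLT.induction with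
  | _ j ih =>
    have h0 := (D.ratio_pos j).ne'
    have h1 : (D.ratio j : ℝ) * ht (D.vec f j)
        = D.blockSize k j + ∑ u ∈ D.J j, ht (D.vec f u) := by
      rw [← ht_sum, ← hf j, Finset.card_filter]
      push_cast
      simp only [ht, Finset.mul_sum, vec, ratio_mul_gen, ← Finset.sum_add_distrib, Finset.sum_apply]
    rw [Finset.sum_congr rfl fun u hu => ih u (D.lt_of_mem_J hu), blockSize_cast, M_succ,
      ← Finset.sum_mul] at h1
    refine mul_left_cancel₀ h0 ?_
    rw [h1]
    push_cast
    ring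

theorem stepLattice_intLattice (k : ℕ) : StepLattice (intLattice ι) k 1 := by
  have h0 : ∀ x ∈ intLattice ι, InBox x → x = 0 := fun x hx hxb =>
    hxb.eq_of_sub_mem inBox_zero (by simpa using hx)
  refine ⟨le_rfl, fun x hx hxb => ⟨0, one_pos, ?_⟩, fun j hj => ⟨0, zero_mem _, inBox_zero, ?_⟩,
    fun x hx y hy hxb hyb _ => by rw [h0 x hx hxb, h0 y hy hyb]⟩
  · rw [h0 x hx hxb, ht_zero]
    simp
  · rw [ht_zero, show j = 0 by omega]
    simp

/-- The bound by the top element is carried through the induction, since it is what excludes carries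
in the next step. -/
theorem IsBlockMap.stepLattice_chainLattice_aux {k : ℕ} (hk : 1 ≤ k) {f : ι → Fin D.s}
    (hf : D.IsBlockMap k f) (i : Fin (D.s + 1)) :
    StepLattice (chainLattice (D.vec f) i) k (D.M i) ∧
      ∀ x ∈ chainLattice (D.vec f) i, InBox x →
        ∀ a, x a ≤ ∑ u ∈ below i, ((D.ratio u : ℝ) - 1) * D.gen u (f a) := by
  induction i using Fin.induction with
  | zero =>
    rw [D.M_first, chainLattice_zero]
    refine ⟨stepLattice_intLattice k, fun x hx hxb a => ?_⟩
    rw [hxb.eq_of_sub_mem inBox_zero (by simpa using hx)]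
    simp [below_zero]
  | succ j ih =>
    obtain ⟨ih1, ih2⟩ := ih
    have hr := D.two_le_ratio j
    have hmem : D.ratio j • D.vec f j ∈ chainLattice (D.vec f) j.castSucc := by
      have := add_mem (intLattice_le_chainLattice (D.vec f) j.castSucc (ratio_smul_vec_mem f j))
        (sum_vec_mem_chainLattice f (D.J_subset_below j))
      simpa using this
    have hle : ∀ x ∈ chainLattice (D.vec f) j.castSucc, InBox x → ∀ b < D.ratio j, ∀ a,
        (x + b • D.vec f j) a
          ≤ ∑ u ∈ below j.succ, ((D.ratio u : ℝ) - 1) * D.gen u (f a) := by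
      intro x hx hxb b hb a
      have h1 := ih2 x hx hxb a
      have h2 : (b : ℝ) ≤ (D.ratio j : ℝ) - 1 := by
        rw [le_sub_iff_add_le]
        exact_mod_cast hb
      have h3 := mul_le_mul_of_nonneg_right h2 (D.gen_nonneg j (f a))
      rw [sum_below_succ, Pi.add_apply, nsmul_coord, vec]
      linarith
    have hcarry : ∀ x ∈ chainLattice (D.vec f) j.castSucc, InBox x → ∀ b < D.ratio j,
        InBox (x + b • D.vec f j) := by
      intro x hx hxb b hb a
      refine ⟨?_, (hle x hx hxb b hb a).trans_lt (D.sum_ratio_sub_one_mul_gen_lt_one _ _)⟩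
      have h1 := (hxb a).1
      have h2 := D.vec_nonneg f j a
      rw [Pi.add_apply, nsmul_coord]
      positivity
    rw [chainLattice_succ, D.M_succ]
    refine ⟨ih1.extend hk (hf.ht_vec j) (by omega) hmem hcarry, fun y hy hyb a => ?_⟩
    obtain ⟨x, hx, hxb, b, hb, rfl⟩ := ih1.mem_sup_zmultiples (by omega) hmem hcarry hy hyb
    exact hle x hx hxb b hb a

theorem IsBlockMap.stepLattice_chainLattice {k : ℕ} (hk : 1 ≤ k) {f : ι → Fin D.s}
    (hf : D.IsBlockMap k f) (i : Fin (D.s + 1)) :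
    StepLattice (chainLattice (D.vec f) i) k (D.M i) :=
  (hf.stepLattice_chainLattice_aux hk i).1

variable (D) in
/-- The lattice `Γ` is the lattice of the datum `D`, for some division of the coordinates into
blocks. -/
def IsLatticeOf (k : ℕ) (Γ : AddSubgroup (ι → ℝ)) : Prop :=
  ∃ f : ι → Fin D.s, D.IsBlockMap k f ∧ Γ = chainLattice (D.vec f) (Fin.last D.s)

theorem IsLatticeOf.stepLattice {k : ℕ} (hk : 1 ≤ k) {Γ : AddSubgroup (ι → ℝ)}
    (h : D.IsLatticeOf k Γ) : StepLattice Γ k v := by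
  obtain ⟨f, hf, rfl⟩ := h
  have := hf.stepLattice_chainLattice hk (Fin.last D.s)
  rwa [D.M_last] at this

theorem IsLatticeOf.exists_notMem {k : ℕ} {Γ : AddSubgroup (ι → ℝ)}
    (h : D.IsLatticeOf k Γ) (i : ι) : ∃ x ∈ Γ, x i ∉ intReals := by
  obtain ⟨f, -, rfl⟩ := h
  refine ⟨D.vec f (f i), mem_chainLattice_of_mem_below _ _ (by simp [below_last]), fun h => ?_⟩
  have hb := inBox_vec f (f i) i
  have h0 := eq_zero_of_mem_intReals h (by linarith [hb.1]) hb.2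
  have := D.ratio_pos (f i)
  rw [vec, gen_self] at h0
  exact (one_div_pos.2 this).ne' h0

end ChainDatum

/-! ### A lattice determines its datum -/

section Unique

variable {ι : Type} [Fintype ι] {Γ : AddSubgroup (ι → ℝ)} {k v : ℕ}

/-- The first `M` box elements of `Γ` belong to a sublattice without further box elements. -/
def IsBreak (Γ : AddSubgroup (ι → ℝ)) (k M : ℕ) : Prop :=
  ∃ H ≤ Γ, StepLattice H k M

theorem StepLattice.mem_of_ht (hΓ : StepLattice Γ k v) {H : AddSubgroup (ι → ℝ)} {M j : ℕ}
    (hH : StepLattice H k M) (hle : H ≤ Γ) {c : ι → ℝ} (hc : c ∈ Γ) (hcb : InBox c)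
    (hch : ht c = (j : ℝ) * k) (hj : j < M) : c ∈ H := by
  obtain ⟨y, hy, hyb, hyh⟩ := hH.exists_elt j hj
  rwa [hΓ.eq_of_ht c hc y (hle hy) hcb hyb (by rw [hch, hyh])]

namespace ChainDatum

variable {D : ChainDatum v}

/-- A step sublattice with more than M_{j-1} box elements contains the (j-1)-st chain lattice and
also c_j, whose height is M_{j-1} k; so it contains the j-th one and has at least M_j box elements.
The chain is thus intrinsic to the lattice. -/
theorem IsBlockMap.isBreak_iff (hk : 1 ≤ k) {f : ι → Fin D.s} (hf : D.IsBlockMap k f) (M : ℕ) :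
    IsBreak (chainLattice (D.vec f) (Fin.last D.s)) k M ↔ M ∈ Set.range D.M := by
  have hΓ := hf.stepLattice_chainLattice hk (Fin.last D.s)
  constructor
  · rintro ⟨H, hle, hH⟩
    have key : ∀ i, M < D.M i → M ∈ Set.range D.M := by
      intro i
      induction i using Fin.induction with
      | zero =>
        intro h
        have := hH.pos
        rw [D.M_first] at h
        omega
      | succ j ih =>
        intro h
        rcases lt_trichotomy M (D.M j.castSucc) with h1 | h1 | h1
        · exact ih h1
        · exact ⟨_, h1.symm⟩
        · exfalso
          have hsub : chainLattice (D.vec f) j.succ ≤ H := by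
            rw [chainLattice_succ, sup_le_iff]
            refine ⟨hΓ.le_of_card_le (hf.stepLattice_chainLattice hk _) hH
              (chainLattice_mono _ (Fin.le_last _)) hle h1.le, ?_⟩
            rw [AddSubgroup.zmultiples_le]
            exact hΓ.mem_of_ht hH hle (mem_chainLattice_of_mem_below _ _ (by simp [below_last]))
              (inBox_vec f j) (hf.ht_vec j) h1
          have := (hf.stepLattice_chainLattice hk j.succ).le_of_le hk hH hsub
          omega
    rcases (hH.le_of_le hk hΓ hle).lt_or_eq with h | h
    · exact key _ h
    · exact ⟨_, h.symm⟩
  · rintro ⟨i, rfl⟩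
    exact ⟨_, chainLattice_mono _ (Fin.le_last i), hf.stepLattice_chainLattice hk i⟩

/-- A lattice is the lattice of at most one datum. -/
theorem IsLatticeOf.unique (hk : 1 ≤ k) {D' : ChainDatum v} (h : D.IsLatticeOf k Γ)
    (h' : D'.IsLatticeOf k Γ) : D = D' := by
  have hΓ := h.stepLattice hk
  have hk0 : (0 : ℝ) < k := by exact_mod_cast hk
  obtain ⟨f, hf, hfΓ⟩ := h
  obtain ⟨f', hf', hfΓ'⟩ := h'
  have hrange : Set.range D.M = Set.range D'.M := by
    ext M
    rw [← hf.isBreak_iff hk, ← hf'.isBreak_iff hk, ← hfΓ, ← hfΓ']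
  have hs : D.s = D'.s := by
    have h1 := Set.ncard_range_of_injective D.M_strictMono.injective
    have h2 := Set.ncard_range_of_injective D'.M_strictMono.injective
    rw [hrange, h2] at h1
    simpa using h1.symm
  have hmono := D.M_strictMono
  have hmono' := D'.M_strictMono
  obtain ⟨s, M, hM0, hM1, hM2, hM3, J, hJ⟩ := D
  obtain ⟨s', M', hM0', hM1', hM2', hM3', J', hJ'⟩ := D'
  obtain rfl : s = s' := hs
  obtain rfl : M = M' := (StrictMono.range_inj hmono hmono').1 hrange
  suffices hJJ : J = J' by subst hJJ; rfl
  have hmem : ∀ u, ChainDatum.vec _ f u ∈ Γ := fun u => by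
    rw [hfΓ]
    exact mem_chainLattice_of_mem_below _ _ (mem_below.2 (Fin.castSucc_lt_last u))
  have hmem' : ∀ u, ChainDatum.vec _ f' u ∈ Γ := fun u => by
    rw [hfΓ']
    exact mem_chainLattice_of_mem_below _ _ (mem_below.2 (Fin.castSucc_lt_last u))
  have hvec : ∀ u : Fin s, ChainDatum.vec _ f u = ChainDatum.vec _ f' u := fun u =>
    hΓ.eq_of_ht _ (hmem u) _ (hmem' u) (inBox_vec f u) (inBox_vec f' u)
      ((hf.ht_vec u).trans (hf'.ht_vec u).symm)
  funext j
  refine eq_of_sum_M_eq ⟨s, M, hM0, hM1, hM2, hM3, J, hJ⟩ (Fin.castSucc j)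
    (J_subset_below ⟨s, M, hM0, hM1, hM2, hM3, J, hJ⟩ j)
    (J_subset_below ⟨s, M, hM0', hM1', hM2', hM3', J', hJ'⟩ j) ?_
  -- Modulo integers n_j c_j equals both sums of generators. Both lie in the box, so they agree, and
  -- their heights give equal subset sums of the M-values.
  have h1 := ratio_smul_vec_mem f j
  have h2 := ratio_smul_vec_mem f' j
  rw [hvec j] at h1
  have h4 := sub_mem h2 h1
  have h5 := (inBox_sum_vec f (J j)).eq_of_sub_mem (inBox_sum_vec f' (J' j)) (by
    convert h4 using 1
    exact (sub_sub_sub_cancel_left _ _ _).symm)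
  have h6 := congrArg ht h5
  rw [ht_sum, ht_sum, Finset.sum_congr rfl fun u _ => hf.ht_vec u,
    Finset.sum_congr rfl fun u _ => hf'.ht_vec u, ← Finset.sum_mul, ← Finset.sum_mul] at h6
  exact_mod_cast mul_right_cancel₀ hk0.ne' h6

end ChainDatum

end Unique

/-! ### Every step lattice without trivial coordinates comes from a datum -/

section Existence

variable {ι : Type} [Fintype ι] {Γ : AddSubgroup (ι → ℝ)} {k v : ℕ}

theorem StepLattice.eq_of_card_eq {H H' : AddSubgroup (ι → ℝ)} {M : ℕ} (hΓ : StepLattice Γ k v)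
    (hH : StepLattice H k M) (hH' : StepLattice H' k M) (hle : H ≤ Γ) (hle' : H' ≤ Γ) : H = H' :=
  le_antisymm (hΓ.le_of_card_le hH hH' hle hle' le_rfl) (hΓ.le_of_card_le hH' hH hle' hle le_rfl)

/-- The lattice `Γ` is built up from `ℤ^ι` by adjoining the vectors `c_j` one after the other, no
carries occurring. -/
structure IsStepChain {s : ℕ} (Γ : AddSubgroup (ι → ℝ)) (k v : ℕ) (M : Fin (s + 1) → ℕ)
    (n : Fin s → ℕ) (c : Fin s → ι → ℝ) : Prop where
  M_first : M 0 = 1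
  M_last : M (Fin.last s) = v
  M_succ : ∀ j : Fin s, M j.succ = n j * M j.castSucc
  two_le : ∀ j, 2 ≤ n j
  step : ∀ i, StepLattice (chainLattice c i) k (M i)
  eq_last : chainLattice c (Fin.last s) = Γ
  inBox : ∀ j, InBox (c j)
  ht_eq : ∀ j : Fin s, ht (c j) = (M j.castSucc : ℝ) * k
  smul_mem : ∀ j : Fin s, n j • c j ∈ chainLattice c j.castSucc
  carry : ∀ j : Fin s, ∀ x ∈ chainLattice c j.castSucc, InBox x → ∀ a < n j, InBox (x + a • c j)

theorem StepLattice.exists_isStepChain (hk : 1 ≤ k) (hΓ : StepLattice Γ k v) :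
    ∃ (s : ℕ) (M : Fin (s + 1) → ℕ) (n : Fin s → ℕ) (c : Fin s → ι → ℝ),
      IsStepChain Γ k v M n c := by
  classical
  set S : Finset ℕ := (Finset.range (v + 1)).filter (IsBreak Γ k) with hS
  have hmemS : ∀ M, M ∈ S ↔ IsBreak Γ k M := by
    intro M
    rw [hS, Finset.mem_filter, Finset.mem_range, and_iff_right_iff_imp]
    rintro ⟨H, hle, hH⟩
    have := hH.le_of_le hk hΓ hle
    omega
  have h1S : 1 ∈ S := (hmemS 1).2 ⟨_, hΓ.int_le, ChainDatum.stepLattice_intLattice k⟩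
  have hvS : v ∈ S := (hmemS v).2 ⟨_, le_rfl, hΓ⟩
  obtain ⟨s, hs⟩ : ∃ s, S.card = s + 1 :=
    Nat.exists_eq_succ_of_ne_zero (Finset.card_ne_zero_of_mem h1S)
  set M : Fin (s + 1) → ℕ := fun i => S.orderEmbOfFin hs i with hM
  have hmono : StrictMono M := (S.orderEmbOfFin hs).strictMono
  have hrange : ∀ b ∈ S, ∃ i, M i = b := fun b hb => by
    have : b ∈ Set.range (S.orderEmbOfFin hs) := by rwa [Finset.range_orderEmbOfFin]
    exact this
  have hbreak : ∀ i, IsBreak Γ k (M i) := fun i => (hmemS _).1 (S.orderEmbOfFin_mem hs i)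
  have hM0 : M 0 = 1 := by
    obtain ⟨i, hi⟩ := hrange 1 h1S
    have h1 : M 0 ≤ M i := hmono.monotone (Fin.zero_le i)
    obtain ⟨H, -, hH⟩ := hbreak 0
    have := hH.pos
    omega
  have hMv : M (Fin.last s) = v := by
    obtain ⟨i, hi⟩ := hrange v hvS
    have h1 : M i ≤ M (Fin.last s) := hmono.monotone (Fin.le_last i)
    obtain ⟨H, hle, hH⟩ := hbreak (Fin.last s)
    have := hH.le_of_le hk hΓ hle
    omega
  choose H hle hH using hbreak
  have hlt : ∀ j : Fin s, M j.castSucc < M j.succ := fun j => hmono Fin.castSucc_lt_succ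
  have hc : ∀ j : Fin s, ∃ c ∈ Γ, InBox c ∧ ht c = (M j.castSucc : ℝ) * k := fun j =>
    hΓ.exists_elt _ ((hlt j).trans_le ((hH _).le_of_le hk hΓ (hle _)))
  choose c hcΓ hcb hch using hc
  have hn := fun j : Fin s =>
    (hH j.castSucc).exists_step hk hΓ (hle _) (hcΓ j) (hcb j) (hch j)
  choose n hn2 hnc hcarry using hn
  have hext := fun j : Fin s => (hH j.castSucc).extend hk (hch j)
    (by have := hn2 j; omega) (hnc j) (hcarry j)
  have hextle : ∀ j : Fin s, H j.castSucc ⊔ AddSubgroup.zmultiples (c j) ≤ Γ := fun j =>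
    sup_le (hle _) ((AddSubgroup.zmultiples_le).2 (hcΓ j))
  -- The extension by c_j has n_j M_j box elements, hence occurs in the list of all breaks, at or
  -- after the next entry; conversely, the next sublattice contains c_j and so the whole extension.
  have hMs : ∀ j : Fin s, M j.succ = n j * M j.castSucc := by
    intro j
    apply le_antisymm
    · obtain ⟨i, hi⟩ := hrange _ ((hmemS _).2 ⟨_, hextle j, hext j⟩)
      rw [← hi]
      apply hmono.monotone
      have h1 : M j.castSucc < M i := by
        rw [hi]
        have h2 := (hH j.castSucc).pos
        have h3 := Nat.mul_le_mul_right (M j.castSucc) (hn2 j)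
        omega
      exact Fin.castSucc_lt_iff_succ_le.1 (hmono.lt_iff_lt.1 h1)
    · refine (hext j).le_of_le hk (hH j.succ) (sup_le ?_ ?_)
      · exact hΓ.le_of_card_le (hH _) (hH _) (hle _) (hle _) (hlt j).le
      · rw [AddSubgroup.zmultiples_le]
        exact hΓ.mem_of_ht (hH _) (hle _) (hcΓ j) (hcb j) (hch j) (hlt j)
  have hHc : ∀ i, H i = chainLattice c i := by
    intro i
    induction i using Fin.induction with
    | zero =>
      rw [chainLattice_zero]
      have h0 := hH 0
      simp only [hM0] at h0
      exact hΓ.eq_of_card_eq h0 (ChainDatum.stepLattice_intLattice k) (hle _) hΓ.int_le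
    | succ j ih =>
      rw [chainLattice_succ, ← ih]
      refine hΓ.eq_of_card_eq (hH j.succ) ?_ (hle _) (hextle j)
      rw [hMs]
      exact hext j
  refine ⟨s, M, n, c, hM0, hMv, hMs, hn2, fun i => hHc i ▸ hH i, ?_, hcb, hch,
    fun j => hHc j.castSucc ▸ hnc j, fun j => hHc j.castSucc ▸ hcarry j⟩
  rw [← hHc]
  refine hΓ.eq_of_card_eq (hH _) ?_ (hle _) le_rfl
  rwa [hMv]

namespace IsStepChain

variable {s : ℕ} {M : Fin (s + 1) → ℕ} {n : Fin s → ℕ} {c : Fin s → ι → ℝ}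

theorem ratio_pos (h : IsStepChain Γ k v M n c) (j : Fin s) : (0 : ℝ) < n j := by
  have := h.two_le j
  exact_mod_cast (by omega : 0 < n j)

/-- Equality holds exactly, not just modulo integers, because no carries occur. -/
theorem exists_digits (h : IsStepChain Γ k v M n c) (i : Fin (s + 1)) {x : ι → ℝ}
    (hx : x ∈ chainLattice c i) (hxb : InBox x) :
    ∃ a : Fin s → ℕ, x = ∑ u ∈ below i, a u • c u := by
  induction i using Fin.induction generalizing x with
  | zero =>
    refine ⟨0, ?_⟩
    rw [chainLattice_zero] at hx
    rw [hxb.eq_of_sub_mem inBox_zero (by simpa using hx)]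
    simp [below_zero]
  | succ j ih =>
    rw [chainLattice_succ] at hx
    obtain ⟨y, hy, hyb, b, -, rfl⟩ := (h.step j.castSucc).mem_sup_zmultiples
      (by have := h.two_le j; omega) (h.smul_mem j) (h.carry j) hx hxb
    obtain ⟨a, ha⟩ := ih hy hyb
    refine ⟨Function.update a j b, ?_⟩
    rw [sum_below_succ, Function.update_self, ha, add_comm]
    congr 1
    refine Finset.sum_congr rfl fun u hu => ?_
    rw [Function.update_of_ne]
    rintro rfl
    exact notMem_below u hu

/-- The vector with all digits maximal; comparison with it bounds the digits of n_j c_j in the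
construction of the datum. -/
theorem sum_top (h : IsStepChain Γ k v M n c) (i : Fin (s + 1)) :
    ∑ u ∈ below i, (n u - 1) • c u ∈ chainLattice c i ∧
      InBox (∑ u ∈ below i, (n u - 1) • c u) := by
  induction i using Fin.induction with
  | zero => simp [below_zero, inBox_zero, zero_mem]
  | succ j ih =>
    have := h.two_le j
    rw [sum_below_succ, add_comm]
    exact ⟨add_mem (chainLattice_mono c (Fin.castSucc_lt_succ).le ih.1)
      (nsmul_mem (mem_chainLattice_of_mem_below c _ (by simp [below_succ])) _),
      h.carry j _ ih.1 ih.2 _ (by omega)⟩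

/-- The coordinate `i` becomes nontrivial in exactly one step. -/
theorem exists_block (h : IsStepChain Γ k v M n c) {i : ι} (hi : ∃ x ∈ Γ, x i ∉ intReals) :
    ∃ j : Fin s, (∀ x ∈ chainLattice c j.castSucc, x i ∈ intReals) ∧
      ∃ x ∈ chainLattice c j.succ, x i ∉ intReals := by
  have key : ∀ p : Fin (s + 1), (∃ x ∈ chainLattice c p, x i ∉ intReals) →
      ∃ j : Fin s, (∀ x ∈ chainLattice c j.castSucc, x i ∈ intReals) ∧
        ∃ x ∈ chainLattice c j.succ, x i ∉ intReals := by
    intro p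
    induction p using Fin.induction with
    | zero =>
      rintro ⟨x, hx, hxi⟩
      exact absurd (mem_intLattice.1 hx i) hxi
    | succ j ih =>
      intro hj
      by_cases h' : ∃ x ∈ chainLattice c j.castSucc, x i ∉ intReals
      · exact ih h'
      · push Not at h'
        exact ⟨j, h', hj⟩
  exact key (Fin.last s) (by rwa [h.eq_last])

end IsStepChain

/-- Every nondegenerate step lattice is the lattice of a datum. -/
theorem StepLattice.exists_datum (hk : 1 ≤ k) (hΓ : StepLattice Γ k v)
    (hnd : ∀ i, ∃ x ∈ Γ, x i ∉ intReals) : ∃ D : ChainDatum v, D.IsLatticeOf k Γ := by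
  classical
  have hk0 : (0 : ℝ) < k := by exact_mod_cast hk
  obtain ⟨s, M, n, c, h⟩ := hΓ.exists_isStepChain hk
  choose f hf1 hf2 using fun i => h.exists_block (hnd i)
  set z : Fin s → ι → ℝ := fun j => fr (n j • c j) with hz
  have hzmem : ∀ j : Fin s, z j ∈ chainLattice c j.castSucc := fun j =>
    fr_mem (h.step _).int_le (h.smul_mem j)
  have hzb : ∀ j, InBox (z j) := fun j => inBox_fr _
  have hcoord := fun j => (h.step (Fin.castSucc j)).step_coord hk (h.inBox j) (h.two_le j)
    (h.smul_mem j) (h.carry j)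
  have hnontriv : ∀ i, ∀ j : Fin s, f i < j → ∃ x ∈ chainLattice c j.castSucc, x i ∉ intReals := by
    intro i j hij
    obtain ⟨x, hx, hxi⟩ := hf2 i
    exact ⟨x, chainLattice_mono c (Fin.succ_le_castSucc_iff.2 hij) hx, hxi⟩
  -- The coordinate becomes nontrivial when `c (f i)` is adjoined, so this vector cannot vanish
  -- there.
  have hcf : ∀ i, c (f i) i = 1 / n (f i) := by
    intro i
    rcases (hcoord (f i) i).1 (hf1 i) with h0 | h0
    · exfalso
      obtain ⟨x, hx, hxi⟩ := hf2 i
      rw [chainLattice_succ] at hx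
      obtain ⟨y, hy, w, hw, rfl⟩ := AddSubgroup.mem_sup.1 hx
      obtain ⟨b, rfl⟩ := AddSubgroup.mem_zmultiples_iff.1 hw
      apply hxi
      simpa [h0] using hf1 i y hy
    · exact h0
  have hnc : ∀ j i, (n j : ℝ) * c j i = (if f i = j then 1 else 0) + z j i := by
    intro j i
    have hn0 := h.ratio_pos j
    rcases lt_trichotomy (f i) j with hij | hij | hij
    · rw [if_neg hij.ne, ((hcoord j i).2 (hnontriv i j hij)).1]
      field_simp
      simp [hz]
    · have h0 : z j i = 0 := by
        subst hij
        exact eq_zero_of_mem_intReals (hf1 i _ (hzmem _)) (by linarith [(hzb (f i) i).1])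
          (hzb (f i) i).2
      rw [if_pos hij, h0]
      subst hij
      rw [hcf]
      field_simp
      simp
    · have hsub : chainLattice c j.succ ≤ chainLattice c (f i).castSucc :=
        chainLattice_mono c (Fin.succ_le_castSucc_iff.2 hij)
      have h0 : z j i = 0 :=
        eq_zero_of_mem_intReals
          (hf1 i _ (hsub (chainLattice_mono c (Fin.castSucc_lt_succ).le (hzmem j))))
          (by linarith [(hzb j i).1]) (hzb j i).2
      have h1 : c j i = 0 :=
        eq_zero_of_mem_intReals
          (hf1 i _ (hsub (mem_chainLattice_of_mem_below c _ (by simp [below_succ]))))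
          (by linarith [(h.inBox j i).1]) (h.inBox j i).2
      rw [if_neg hij.ne', h0, h1]
      simp
  have hcoordsum : ∀ j, (n j : ℝ) * ht (c j)
      = ((Finset.univ.filter fun i => f i = j).card : ℝ) + ht (z j) := by
    intro j
    rw [Finset.card_filter]
    push_cast
    simp only [ht, Finset.mul_sum, hnc, ← Finset.sum_add_distrib]
  -- With an empty block, n_u c_u and its reduction would have equal heights, but the first is n_u
  -- M_u k and the second is below M_u k. Nonemptiness lets the inequality `hzle` be tested on the
  -- block of any u.
  have hblock : ∀ u, ∃ i, f i = u := by
    intro u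
    by_contra hne
    push Not at hne
    have h1 := hcoordsum u
    rw [Finset.filter_false_of_mem fun i _ => hne i] at h1
    obtain ⟨b, hb, hzh⟩ := (h.step _).height _ (hzmem u) (hzb u)
    rw [hzh, h.ht_eq] at h1
    simp only [Finset.card_empty, Nat.cast_zero, zero_add] at h1
    rw [← mul_assoc] at h1
    have h2 : n u * M u.castSucc = b := by exact_mod_cast mul_right_cancel₀ hk0.ne' h1
    have := Nat.mul_le_mul_right (M u.castSucc) (h.two_le u)
    omega
  choose a ha using fun j => h.exists_digits _ (hzmem j) (hzb j)
  have hcnn : ∀ u i, 0 ≤ c u i := fun u i => (h.inBox u i).1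
  have hzi : ∀ j i, z j i = ∑ u ∈ below j.castSucc, (a j u : ℝ) * c u i := by
    intro j i
    rw [ha j, Finset.sum_apply]
    simp only [nsmul_coord]
  have hzge : ∀ j, ∀ u ∈ below (Fin.castSucc j), ∀ i, (a j u : ℝ) * c u i ≤ z j i := by
    intro j u hu i
    rw [hzi]
    exact Finset.single_le_sum (f := fun u => (a j u : ℝ) * c u i)
      (fun u _ => mul_nonneg (Nat.cast_nonneg _) (hcnn u i)) hu
  have hzle : ∀ j i, f i < j →
      z j i + ∑ u ∈ below j.castSucc, ((n u : ℝ) - 1) * c u i ≤ 1 := by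
    intro j i hij
    obtain ⟨h1, h2⟩ := h.sum_top j.castSucc
    have h3 := ((hcoord j i).2 (hnontriv i j hij)).2 _ h1 h2
    rw [Finset.sum_apply] at h3
    have h4 : ∑ u ∈ below j.castSucc, ((n u - 1) • c u) i
        = ∑ u ∈ below j.castSucc, ((n u : ℝ) - 1) * c u i := by
      refine Finset.sum_congr rfl fun u _ => ?_
      have := h.two_le u
      rw [nsmul_coord, Nat.cast_sub (by omega), Nat.cast_one]
    rw [h4] at h3
    simp only [hz]
    linarith
  have hterm : ∀ u i, 0 ≤ ((n u : ℝ) - 1) * c u i := fun u i => by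
    have : (2 : ℝ) ≤ n u := by exact_mod_cast h.two_le u
    exact mul_nonneg (by linarith) (hcnn u i)
  have hmul : ∀ i, (n (f i) : ℝ) * c (f i) i = 1 := fun i => by
    have := h.ratio_pos (f i)
    rw [hcf]
    field_simp
  have hcpos : ∀ i, 0 < c (f i) i := fun i => by rw [hcf]; exact one_div_pos.2 (h.ratio_pos _)
  -- On block u one has 1 - (n_u - 1) c_u = c_u, so the top element leaves room for only one copy of
  -- c_u.
  have ha1 : ∀ j, ∀ u ∈ below (Fin.castSucc j), a j u ≤ 1 := by
    intro j u hu
    obtain ⟨i, rfl⟩ := hblock u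
    have hij : f i < j := Fin.castSucc_lt_castSucc_iff.1 (mem_below.1 hu)
    have h1 := hzle j i hij
    have h2 := hzge j _ hu i
    have h3 := Finset.single_le_sum (f := fun u => ((n u : ℝ) - 1) * c u i)
      (fun u _ => hterm u i) hu
    have h4 := hmul i
    have h5 := hcpos i
    have h6 : (a j (f i) : ℝ) * c (f i) i ≤ 1 * c (f i) i := by
      linarith
    exact_mod_cast le_of_mul_le_mul_right h6 h5
  -- On block u, c_u and (n_u - 1) c_u already add up to 1, so a later c_p with p < j must vanish
  -- there; but if u was used at step p, then n_p c_p ≥ c_u > 0.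
  have hdisj : ∀ j, ∀ u ∈ below (Fin.castSucc j), a j u ≠ 0 →
      ∀ p, u < p → p < j → a p u = 0 := by
    intro j u hu hau p hup hpj
    by_contra hpu
    obtain ⟨i, rfl⟩ := hblock u
    have hij : f i < j := Fin.castSucc_lt_castSucc_iff.1 (mem_below.1 hu)
    have h1 := hzle j i hij
    have h2 := hzge j _ hu i
    have hp : p ∈ below j.castSucc := mem_below.2 (Fin.castSucc_lt_castSucc_iff.2 hpj)
    have h3 : ∑ u ∈ {f i, p}, ((n u : ℝ) - 1) * c u i
        ≤ ∑ u ∈ below j.castSucc, ((n u : ℝ) - 1) * c u i := by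
      refine Finset.sum_le_sum_of_subset_of_nonneg ?_ fun u _ _ => hterm u i
      rw [Finset.insert_subset_iff, Finset.singleton_subset_iff]
      exact ⟨hu, hp⟩
    rw [Finset.sum_pair hup.ne] at h3
    have h4 := hmul i
    have h5 := hcpos i
    have h6 : (1 : ℝ) ≤ a j (f i) := by exact_mod_cast Nat.one_le_iff_ne_zero.2 hau
    have h7 : (1 : ℝ) ≤ a p (f i) := by exact_mod_cast Nat.one_le_iff_ne_zero.2 hpu
    have h8 := hzge p (f i) (mem_below.2 (Fin.castSucc_lt_castSucc_iff.2 hup)) i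
    have h9 : (0 : ℝ) < n p * c p i := by
      rw [hnc, if_neg hup.ne]
      nlinarith
    have h10 := h.ratio_pos p
    have h11 : 0 < c p i := pos_of_mul_pos_right h9 h10.le
    have h12 : (2 : ℝ) ≤ n p := by exact_mod_cast h.two_le p
    nlinarith
  set J : Fin s → Finset (Fin s) := fun j => (below j.castSucc).filter fun u => a j u ≠ 0 with hJ
  have hzJ : ∀ j, z j = ∑ u ∈ J j, c u := by
    intro j
    rw [hJ, Finset.sum_filter]
    refine (ha j).trans (Finset.sum_congr rfl fun u hu => ?_)
    have h1 := ha1 j u hu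
    split_ifs with h2
    · rw [show a j u = 1 by omega, one_smul]
    · rw [not_not.1 h2, zero_smul]
  have hlt : ∀ j : Fin s, M j.castSucc < M j.succ := by
    intro j
    have h1 := (h.step j.castSucc).pos
    have h2 := Nat.mul_le_mul_right (M j.castSucc) (h.two_le j)
    rw [h.M_succ]
    omega
  let D : ChainDatum v :=
    { s := s
      M := M
      M_first := h.M_first
      M_last := h.M_last
      M_lt := hlt
      M_dvd := fun j => ⟨n j, by rw [h.M_succ, mul_comm]⟩
      J := J
      J_subset := by
        intro j u hu
        rw [hJ, Finset.mem_filter] at hu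
        rw [mem_symbolSet]
        refine ⟨mem_below.1 hu.1, fun p hup hpj hup' => ?_⟩
        rw [hJ, Finset.mem_filter] at hup'
        exact hup'.2 (hdisj j u hu.1 hu.2 p hup (Fin.castSucc_lt_castSucc_iff.1 hpj)) }
  have hratio : ∀ j : Fin s, D.ratio j = n j := fun j => by
    show M j.succ / M j.castSucc = n j
    rw [h.M_succ, Nat.mul_div_cancel _ (h.step j.castSucc).pos]
  have hgen : ∀ (j : Fin s) i, D.gen j (f i) = c j i := by
    intro j i
    induction j using WellFoundedLT.induction with
    | _ j ih =>
      have h1 := D.ratio_mul_gen j (f i)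
      rw [hratio] at h1
      have h2 : ∑ u ∈ D.J j, D.gen u (f i) = z j i := by
        rw [hzJ, Finset.sum_apply]
        exact Finset.sum_congr rfl fun u hu => ih u (D.lt_of_mem_J hu)
      rw [h2] at h1
      exact mul_left_cancel₀ (h.ratio_pos j).ne' (h1.trans (hnc j i).symm)
  have hvec : D.vec f = c := funext fun j => funext fun i => hgen j i
  refine ⟨D, f, fun j => ?_, ?_⟩
  · have h1 := hcoordsum j
    rw [hzJ, ht_sum, Finset.sum_congr rfl fun u _ => h.ht_eq u, h.ht_eq, ← Finset.sum_mul] at h1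
    have h2 := D.blockSize_cast k j
    have h3 : ((D.M j.succ : ℕ) : ℝ) = n j * M j.castSucc := by
      rw [← Nat.cast_mul, ← h.M_succ]
    rw [h3] at h2
    have h4 : (((Finset.univ.filter fun i => f i = j).card : ℕ) : ℝ) = D.blockSize k j := by
      rw [h2]
      have h5 : ∑ u ∈ D.J j, (D.M u.castSucc : ℝ) = ∑ u ∈ J j, (M u.castSucc : ℝ) := rfl
      rw [h5]
      linarith
    exact_mod_cast h4
  · rw [hvec]
    exact h.eq_last.symm

end Existence

/-! ### Simplices and their lattices -/

section Simplex

variable {ι : Type} {d : ℕ}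

theorem toReal_mem (z : Fin d → ℤ) : toReal z ∈ intLattice (Fin d) :=
  mem_intLattice.2 fun i => intCast_mem_intReals (z i)

theorem mem_intLattice_iff_toReal {y : Fin d → ℝ} :
    y ∈ intLattice (Fin d) ↔ ∃ z : Fin d → ℤ, y = toReal z := by
  rw [mem_intLattice]
  constructor
  · intro h
    choose z hz using fun i => mem_intReals.1 (h i)
    exact ⟨z, funext fun i => (hz i).symm⟩
  · rintro ⟨z, rfl⟩ i
    exact intCast_mem_intReals (z i)

theorem toReal_injective : Function.Injective (toReal : (Fin d → ℤ) → Fin d → ℝ) := by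
  intro a b h
  funext i
  have h1 : (a i : ℝ) = b i := congrFun h i
  exact_mod_cast h1

theorem eq_of_forall_inBox {Γ Γ' : AddSubgroup (ι → ℝ)} (h : intLattice ι ≤ Γ)
    (h' : intLattice ι ≤ Γ') (hb : ∀ x, InBox x → (x ∈ Γ ↔ x ∈ Γ')) : Γ = Γ' := by
  ext x
  exact ⟨fun hx => mem_of_fr_mem h' ((hb _ (inBox_fr x)).1 (fr_mem h hx)),
    fun hx => mem_of_fr_mem h ((hb _ (inBox_fr x)).2 (fr_mem h' hx))⟩

theorem range_comp_equiv {ι' : Type} (σ : ι ≃ ι') (w : ι' → Fin d → ℤ) :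
    (Set.range fun i => toReal ((w ∘ σ) i)) = Set.range fun i => toReal (w i) :=
  σ.surjective.range_comp fun i => toReal (w i)

/-- The affine map given by an integer matrix and a lattice vector. -/
def affMapHom (U : Matrix (Fin d) (Fin d) ℤ) (t : Fin d → ℤ) : (Fin d → ℝ) →ᵃ[ℝ] (Fin d → ℝ) :=
  (Matrix.vecMulLinear (U.map (Int.cast : ℤ → ℝ))).toAffineMap + AffineMap.const ℝ _ (toReal t)

theorem coe_affMapHom (U : Matrix (Fin d) (Fin d) ℤ) (t : Fin d → ℤ) :
    ⇑(affMapHom U t) = affMap U t := by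
  funext x
  simp [affMapHom, affMap]

theorem affMap_image_convexHull (U : Matrix (Fin d) (Fin d) ℤ) (t : Fin d → ℤ)
    (S : Set (Fin d → ℝ)) : affMap U t '' convexHull ℝ S = convexHull ℝ (affMap U t '' S) := by
  rw [← coe_affMapHom, AffineMap.image_convexHull]

theorem vecMul_toReal (U : Matrix (Fin d) (Fin d) ℤ) (z : Fin d → ℤ) :
    Matrix.vecMul (toReal z) (U.map (Int.cast : ℤ → ℝ)) = toReal (Matrix.vecMul z U) := by
  funext i
  simp [toReal, Matrix.vecMul, dotProduct]

theorem affMap_toReal (U : Matrix (Fin d) (Fin d) ℤ) (t z : Fin d → ℤ) :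
    affMap U t (toReal z) = toReal (Matrix.vecMul z U + t) := by
  rw [affMap, vecMul_toReal]
  funext i
  simp [toReal]

theorem affMap_image_range (U : Matrix (Fin d) (Fin d) ℤ) (t : Fin d → ℤ) (w : ι → Fin d → ℤ) :
    affMap U t '' convexHull ℝ (Set.range fun i => toReal (w i))
      = convexHull ℝ (Set.range fun i => toReal (Matrix.vecMul (w i) U + t)) := by
  rw [affMap_image_convexHull, ← Set.range_comp]
  congr 2
  funext i
  exact affMap_toReal U t (w i)

theorem affMap_inv_cancel {U : Matrix (Fin d) (Fin d) ℤ} (hU : IsUnit U.det) (t : Fin d → ℤ)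
    (x : Fin d → ℝ) : affMap U⁻¹ (-Matrix.vecMul t U⁻¹) (affMap U t x) = x := by
  have h0 : toReal (0 : Fin d → ℤ) = 0 := by funext i; simp [toReal]
  rw [affMap_affMap, Matrix.mul_nonsing_inv _ hU]
  simp [affMap, h0, Matrix.map_one]

theorem affineIndependent_affMap {U : Matrix (Fin d) (Fin d) ℤ} (hU : IsUnit U.det)
    (t : Fin d → ℤ) {w : ι → Fin d → ℤ} (hw : AffineIndependent ℝ fun i => toReal (w i)) :
    AffineIndependent ℝ fun i => toReal (Matrix.vecMul (w i) U + t) := by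
  have h : (fun i => toReal (Matrix.vecMul (w i) U + t))
      = affMapHom U t ∘ fun i => toReal (w i) := by
    funext i
    rw [Function.comp_apply, coe_affMapHom, affMap_toReal]
  rw [h]
  refine hw.map' _ fun x y hxy => ?_
  rw [coe_affMapHom] at hxy
  rw [← affMap_inv_cancel hU t x, hxy, affMap_inv_cancel hU t y]

variable [Fintype ι]

theorem convexHull_range_eq {E : Type} [AddCommGroup E] [Module ℝ E] (p : ι → E) (z : E) :
    z ∈ convexHull ℝ (Set.range p) ↔
      ∃ x : ι → ℝ, (∀ i, 0 ≤ x i) ∧ ∑ i, x i = 1 ∧ ∑ i, x i • p i = z := by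
  classical
  have h1 : Set.range p = (Fintype.linearCombination ℝ p) '' Set.range fun i => Pi.single i 1 := by
    rw [← Set.range_comp]
    congr 1
    funext i
    simp
  rw [h1, ← LinearMap.image_convexHull, convexHull_rangle_single_eq_stdSimplex]
  constructor
  · rintro ⟨x, ⟨h2, h3⟩, rfl⟩
    exact ⟨x, h2, h3, by simp [Fintype.linearCombination_apply]⟩
  · rintro ⟨x, h2, h3, rfl⟩
    exact ⟨x, ⟨h2, h3⟩, by simp [Fintype.linearCombination_apply]⟩

/-- The map sending `x` to `∑ x_i (w_i, 1)`. -/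
def combo (w : ι → Fin d → ℤ) : (ι → ℝ) →ₗ[ℝ] (Fin d → ℝ) × ℝ :=
  (Fintype.linearCombination ℝ fun i => toReal (w i)).prod
    (Fintype.linearCombination ℝ fun _ => (1 : ℝ))

theorem combo_apply (w : ι → Fin d → ℤ) (x : ι → ℝ) :
    combo w x = (∑ i, x i • toReal (w i), ∑ i, x i) := by
  simp [combo, Fintype.linearCombination_apply]

theorem affineIndependent_iff_combo (w : ι → Fin d → ℤ) :
    AffineIndependent ℝ (fun i => toReal (w i)) ↔ Function.Injective (combo w) := by
  classical
  rw [affineIndependent_iff, injective_iff_map_eq_zero]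
  constructor
  · intro h x hx
    rw [combo_apply, Prod.mk_eq_zero] at hx
    funext i
    exact h Finset.univ x hx.2 hx.1 i (Finset.mem_univ i)
  · intro h s x h1 h2 i hi
    have h3 := h (fun i => if i ∈ s then x i else 0) (by
      rw [combo_apply, Prod.mk_eq_zero]
      simp only [ite_smul, zero_smul, Finset.sum_ite_mem, Finset.univ_inter]
      exact ⟨h2, h1⟩)
    have h4 := congrFun h3 i
    simpa [hi] using h4

/-- The lattice of all `x` such that `∑ x_i (w_i, 1)` is a lattice point. -/
def relLattice (w : ι → Fin d → ℤ) : AddSubgroup (ι → ℝ) :=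
  ((intLattice (Fin d)).prod intReals).comap (combo w).toAddMonoidHom

theorem mem_relLattice (w : ι → Fin d → ℤ) (x : ι → ℝ) :
    x ∈ relLattice w ↔ ∑ i, x i • toReal (w i) ∈ intLattice (Fin d) ∧ ∑ i, x i ∈ intReals := by
  rw [relLattice, AddSubgroup.mem_comap, LinearMap.toAddMonoidHom_coe, combo_apply,
    AddSubgroup.mem_prod]

theorem mem_intLattice_smul {y : Fin d → ℝ} (hy : y ∈ intLattice (Fin d)) {r : ℝ}
    (hr : r ∈ intReals) : r • y ∈ intLattice (Fin d) := by
  rw [mem_intLattice] at hy ⊢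
  exact fun i => mul_mem_intReals hr (hy i)

theorem intLattice_le_relLattice (w : ι → Fin d → ℤ) : intLattice ι ≤ relLattice w := by
  intro x hx
  rw [mem_intLattice] at hx
  rw [mem_relLattice]
  exact ⟨sum_mem fun i _ => mem_intLattice_smul (toReal_mem _) (hx i), sum_mem fun i _ => hx i⟩

theorem mem_latticeGroup (w : ι → Fin d → ℤ) (x : ι → ℝ) :
    x ∈ latticeGroup w ↔ InBox x ∧ x ∈ relLattice w := by
  rw [mem_relLattice, mem_intLattice_iff_toReal, mem_intReals]
  simp only [latticeGroup, Set.mem_ofPred_eq, InBox, eq_comm]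

theorem mem_convexHull_iff (w : ι → Fin d → ℤ) (z : Fin d → ℝ) :
    z ∈ convexHull ℝ (Set.range fun i => toReal (w i)) ↔
      ∃ x : ι → ℝ, (∀ i, 0 ≤ x i) ∧ combo w x = (z, 1) := by
  rw [convexHull_range_eq]
  simp only [combo_apply, Prod.mk.injEq]
  exact exists_congr fun x => and_congr_right fun _ => and_comm

/-! ### Labellings of the vertices -/

/-- Uniqueness of barycentric coordinates makes each vertex an extreme point, and the extreme points
of a convex hull lie in the generating set. -/
theorem exists_mem_range_of_convexHull_eq {w : ι → Fin d → ℤ}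
    (hw : AffineIndependent ℝ fun i => toReal (w i)) {S : Set (Fin d → ℝ)}
    (h : convexHull ℝ (Set.range fun i => toReal (w i)) = convexHull ℝ S) (i : ι) :
    toReal (w i) ∈ S := by
  classical
  have hinj := (affineIndependent_iff_combo w).1 hw
  apply extremePoints_convexHull_subset (𝕜 := ℝ)
  rw [← h, mem_extremePoints_iff_left]
  refine ⟨subset_convexHull ℝ _ ⟨i, rfl⟩, fun y hy z hz hseg => ?_⟩
  obtain ⟨Y, hY0, hY⟩ := (mem_convexHull_iff w y).1 hy
  obtain ⟨Z, hZ0, hZ⟩ := (mem_convexHull_iff w z).1 hz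
  obtain ⟨a, b, ha, hb, hab, he⟩ := hseg
  have h1 : combo w (a • Y + b • Z) = combo w (Pi.single i 1) := by
    rw [map_add, map_smul, map_smul, hY, hZ, combo_apply]
    ext1
    · simp [he, Pi.single_apply]
    · simp [hab]
  have h2 := hinj h1
  have h3 : ∀ j, j ≠ i → Y j = 0 := by
    intro j hj
    have h4 := congrFun h2 j
    simp only [Pi.add_apply, Pi.smul_apply, smul_eq_mul, Pi.single_eq_of_ne hj] at h4
    have h5 := mul_nonneg ha.le (hY0 j)
    have h6 := mul_nonneg hb.le (hZ0 j)
    have h7 : a * Y j = 0 := by linarith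
    exact (mul_eq_zero.1 h7).resolve_left ha.ne'
  rw [combo_apply, Prod.mk.injEq] at hY
  have h8 : Y i = 1 := by
    rw [← hY.2, Finset.sum_eq_single i (fun j _ hj => h3 j hj) (by simp)]
  rw [← hY.1, Finset.sum_eq_single i (fun j _ hj => by rw [h3 j hj, zero_smul]) (by simp), h8,
    one_smul]

theorem exists_label_equiv {ι' : Type} [Fintype ι'] {w : ι → Fin d → ℤ} {w' : ι' → Fin d → ℤ}
    (hw : AffineIndependent ℝ fun i => toReal (w i))
    (hw' : AffineIndependent ℝ fun i => toReal (w' i))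
    (h : convexHull ℝ (Set.range fun i => toReal (w i))
      = convexHull ℝ (Set.range fun i => toReal (w' i))) :
    ∃ σ : ι ≃ ι', ∀ i, w' (σ i) = w i := by
  have h1 : ∀ i, ∃ j, toReal (w' j) = toReal (w i) := exists_mem_range_of_convexHull_eq hw h
  have h2 : ∀ j, ∃ i, toReal (w i) = toReal (w' j) :=
    exists_mem_range_of_convexHull_eq hw' h.symm
  choose f hf using h1
  choose g hg using h2
  refine ⟨⟨f, g, fun i => hw.injective ?_, fun j => hw'.injective ?_⟩,
    fun i => toReal_injective (hf i)⟩
  · simp only [hg, hf]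
  · simp only [hg, hf]

theorem mem_relLattice_comp {ι' : Type} [Fintype ι'] (σ : ι ≃ ι') (w : ι' → Fin d → ℤ)
    (x : ι' → ℝ) : x ∘ σ ∈ relLattice (w ∘ σ) ↔ x ∈ relLattice w := by
  rw [mem_relLattice, mem_relLattice]
  simp only [Function.comp_apply]
  rw [Equiv.sum_comp σ fun i => x i • toReal (w i), Equiv.sum_comp σ x]

/-! ### Unimodular equivalence -/

theorem relLattice_le_affMap (U : Matrix (Fin d) (Fin d) ℤ) (t : Fin d → ℤ)
    (w : ι → Fin d → ℤ) : relLattice w ≤ relLattice fun i => Matrix.vecMul (w i) U + t := by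
  intro x hx
  rw [mem_relLattice] at hx ⊢
  refine ⟨?_, hx.2⟩
  have h1 : ∑ i, x i • toReal (Matrix.vecMul (w i) U + t)
      = Matrix.vecMul (∑ i, x i • toReal (w i)) (U.map (Int.cast : ℤ → ℝ))
        + (∑ i, x i) • toReal t := by
    rw [Finset.sum_smul, Matrix.sum_vecMul, ← Finset.sum_add_distrib]
    refine Finset.sum_congr rfl fun i _ => ?_
    rw [← affMap_toReal, affMap, smul_add, Matrix.smul_vecMul]
  rw [h1]
  refine add_mem ?_ (mem_intLattice_smul (toReal_mem t) hx.2)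
  obtain ⟨z, hz⟩ := mem_intLattice_iff_toReal.1 hx.1
  rw [hz, vecMul_toReal]
  exact toReal_mem _

theorem vecMul_inv_cancel {U : Matrix (Fin d) (Fin d) ℤ} (hU : IsUnit U.det) (t z : Fin d → ℤ) :
    Matrix.vecMul (Matrix.vecMul z U + t) U⁻¹ + -Matrix.vecMul t U⁻¹ = z := by
  rw [Matrix.add_vecMul, Matrix.vecMul_vecMul, Matrix.mul_nonsing_inv _ hU, Matrix.vecMul_one]
  abel

theorem relLattice_affMap {U : Matrix (Fin d) (Fin d) ℤ} (hU : IsUnit U.det) (t : Fin d → ℤ)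
    (w : ι → Fin d → ℤ) : relLattice (fun i => Matrix.vecMul (w i) U + t) = relLattice w := by
  refine le_antisymm ?_ (relLattice_le_affMap U t w)
  have h := relLattice_le_affMap U⁻¹ (-Matrix.vecMul t U⁻¹) fun i => Matrix.vecMul (w i) U + t
  simpa only [vecMul_inv_cancel hU] using h

theorem exists_matrix_of_integral (L : (Fin d → ℝ) →ₗ[ℝ] (Fin d → ℝ))
    (hL : ∀ j, L (Pi.single j 1) ∈ intLattice (Fin d)) :
    ∃ U : Matrix (Fin d) (Fin d) ℤ, ∀ x, L x = Matrix.vecMul x (U.map (Int.cast : ℤ → ℝ)) := by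
  choose z hz using fun j => mem_intLattice_iff_toReal.1 (hL j)
  refine ⟨Matrix.of z, fun x => ?_⟩
  have h : L = Matrix.vecMulLinear ((Matrix.of z).map (Int.cast : ℤ → ℝ)) := by
    refine LinearMap.pi_ext' fun j => LinearMap.ext_ring ?_
    simp only [LinearMap.comp_apply, LinearMap.single_apply, hz, Matrix.vecMulLinear_apply]
    funext i
    simp [toReal]
  rw [h, Matrix.vecMulLinear_apply]

theorem isUnit_det_of_vecMul {U V : Matrix (Fin d) (Fin d) ℤ}
    (h : ∀ x : Fin d → ℝ, Matrix.vecMul (Matrix.vecMul x (U.map (Int.cast : ℤ → ℝ)))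
      (V.map (Int.cast : ℤ → ℝ)) = x) : IsUnit U.det := by
  have h1 : U * V = 1 := by
    ext i j
    have h2 := congrFun (h (toReal (Pi.single i 1))) j
    rw [vecMul_toReal, vecMul_toReal, Matrix.vecMul_vecMul] at h2
    have h3 : Matrix.vecMul (Pi.single i 1) (U * V) j = (Pi.single i 1 : Fin d → ℤ) j := by
      simp only [toReal] at h2
      exact_mod_cast h2
    rw [Matrix.single_one_vecMul] at h3
    simpa [Matrix.one_apply, Pi.single_apply, eq_comm] using h3
  exact IsUnit.of_mul_eq_one V.det (by rw [← Matrix.det_mul, h1, Matrix.det_one])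

/-- The isomorphism `x ↦ ∑ x_i (w_i, 1)` for a full-dimensional simplex. -/
def comboEquiv {w : ι → Fin d → ℤ} (hw : AffineIndependent ℝ fun i => toReal (w i))
    (hcard : Fintype.card ι = d + 1) : (ι → ℝ) ≃ₗ[ℝ] (Fin d → ℝ) × ℝ :=
  LinearEquiv.ofInjectiveOfFinrankEq (combo w) ((affineIndependent_iff_combo w).1 hw)
    (by simp [hcard])

theorem comboEquiv_apply {w : ι → Fin d → ℤ} (hw : AffineIndependent ℝ fun i => toReal (w i))
    (hcard : Fintype.card ι = d + 1) (x : ι → ℝ) : comboEquiv hw hcard x = combo w x := rfl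

theorem combo_comboEquiv_symm {w : ι → Fin d → ℤ}
    (hw : AffineIndependent ℝ fun i => toReal (w i)) (hcard : Fintype.card ι = d + 1)
    (y : (Fin d → ℝ) × ℝ) : combo w ((comboEquiv hw hcard).symm y) = y := by
  rw [← comboEquiv_apply hw hcard, LinearEquiv.apply_symm_apply]

theorem combo_snd (w : ι → Fin d → ℤ) (x : ι → ℝ) : (combo w x).2 = ∑ i, x i := by
  rw [combo_apply]

theorem combo_single [DecidableEq ι] (w : ι → Fin d → ℤ) (i : ι) :
    combo w (Pi.single i 1) = (toReal (w i), 1) := by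
  rw [combo_apply]
  ext1
  · simp [Pi.single_apply]
  · simp

theorem mem_relLattice_iff_combo (w : ι → Fin d → ℤ) (x : ι → ℝ) :
    x ∈ relLattice w ↔ (combo w x).1 ∈ intLattice (Fin d) ∧ (combo w x).2 ∈ intReals := by
  rw [mem_relLattice, combo_apply]

/-- The linear part sends ∑ x_i w_i to ∑ x_i w'_i for x of sum zero. It and its inverse preserve
ℤ^d, because both families have the same relation lattice. -/
theorem unimodEquiv_of_relLattice_eq {w w' : ι → Fin d → ℤ}
    (hw : AffineIndependent ℝ fun i => toReal (w i))
    (hw' : AffineIndependent ℝ fun i => toReal (w' i)) (hcard : Fintype.card ι = d + 1)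
    (h : relLattice w = relLattice w') :
    UnimodEquiv (convexHull ℝ (Set.range fun i => toReal (w i)))
      (convexHull ℝ (Set.range fun i => toReal (w' i))) := by
  classical
  let T : ∀ {w w' : ι → Fin d → ℤ} (_ : AffineIndependent ℝ fun i => toReal (w i)),
      (Fin d → ℝ) →ₗ[ℝ] (Fin d → ℝ) := fun {w w'} hw =>
    LinearMap.fst ℝ _ _ ∘ₗ combo w' ∘ₗ (comboEquiv hw hcard).symm.toLinearMap ∘ₗ
      LinearMap.inl ℝ _ _
  have hT : ∀ {w w' : ι → Fin d → ℤ} (hw : AffineIndependent ℝ fun i => toReal (w i)) x,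
      combo w' ((comboEquiv hw hcard).symm (x, 0)) = (T (w' := w') hw x, 0) := by
    intro w w' hw x
    refine Prod.ext rfl ?_
    rw [combo_snd, ← combo_snd w, combo_comboEquiv_symm]
  have hint : ∀ {w w' : ι → Fin d → ℤ} (hw : AffineIndependent ℝ fun i => toReal (w i)),
      relLattice w = relLattice w' → ∀ j, T (w' := w') hw (Pi.single j 1) ∈ intLattice (Fin d) := by
    intro w w' hw h j
    have h1 : (comboEquiv hw hcard).symm (Pi.single j 1, 0) ∈ relLattice w := by
      rw [mem_relLattice_iff_combo, combo_comboEquiv_symm]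
      refine ⟨mem_intLattice.2 fun i => ?_, zero_mem _⟩
      simp only [Pi.single_apply]
      split_ifs
      · exact one_mem_intReals
      · exact zero_mem _
    rw [h, mem_relLattice_iff_combo, hT] at h1
    exact h1.1
  obtain ⟨U, hU⟩ := exists_matrix_of_integral _ (hint hw h)
  obtain ⟨V, hV⟩ := exists_matrix_of_integral _ (hint hw' h.symm)
  have hdet : IsUnit U.det := isUnit_det_of_vecMul (V := V) fun x => by
    rw [← hU, ← hV]
    have h1 : (comboEquiv hw' hcard).symm (T (w' := w') hw x, 0)
        = (comboEquiv hw hcard).symm (x, 0) := by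
      rw [LinearEquiv.symm_apply_eq, comboEquiv_apply, hT]
    have h2 := hT (w' := w) hw' (T (w' := w') hw x)
    rw [h1, combo_comboEquiv_symm] at h2
    exact (congrArg Prod.fst h2).symm
  have hsum : ∀ x, (∑ i, x i) = 0 → Matrix.vecMul (combo w x).1 (U.map (Int.cast : ℤ → ℝ))
      = (combo w' x).1 := by
    intro x hx
    rw [← hU]
    have h1 := hT (w' := w') hw (combo w x).1
    have h2 : ((combo w x).1, (0 : ℝ)) = combo w x := by
      refine Prod.ext rfl ?_
      rw [combo_snd, hx]
    rw [h2, ← comboEquiv_apply hw hcard, LinearEquiv.symm_apply_apply] at h1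
    rw [h1]
    rfl
  have hpos : 0 < Fintype.card ι := by omega
  obtain ⟨i₀⟩ := Fintype.card_pos_iff.1 hpos
  -- The linear part matches differences of vertices; the translation is fixed by one vertex.
  refine ⟨U, w' i₀ - Matrix.vecMul (w i₀) U, hdet, ?_⟩
  rw [affMap_image_range]
  congr 3
  funext i
  have h1 := hsum (Pi.single i 1 - Pi.single i₀ 1) (by simp)
  rw [map_sub, map_sub, combo_single, combo_single, combo_single, combo_single] at h1
  simp only [Prod.fst_sub, Matrix.sub_vecMul, vecMul_toReal] at h1
  funext j
  have h2 := congrFun h1 j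
  simp only [toReal, Pi.sub_apply, Pi.add_apply] at h2 ⊢
  push_cast
  linarith

end Simplex

/-! ### The group of a datum in terms of lattices and vertex labellings -/

section Associated

variable {ι : Type} {d k v : ℕ}

theorem mem_intLattice_comp {ι' : Type} (σ : ι ≃ ι') (x : ι' → ℝ) :
    x ∘ σ ∈ intLattice ι ↔ x ∈ intLattice ι' := by
  rw [mem_intLattice, mem_intLattice]
  exact σ.forall_congr_left.trans (by simp)

theorem mem_chainLattice_comp {ι' : Type} {s : ℕ} (σ : ι ≃ ι') (c : Fin s → ι' → ℝ)
    (i : Fin (s + 1)) (x : ι' → ℝ) :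
    x ∘ σ ∈ chainLattice (fun j => c j ∘ σ) i ↔ x ∈ chainLattice c i := by
  rw [mem_chainLattice, mem_chainLattice]
  refine exists_congr fun a => ?_
  rw [← mem_intLattice_comp σ]
  have : (x - ∑ u ∈ below i, a u • c u) ∘ σ = x ∘ σ - ∑ u ∈ below i, a u • (c u ∘ σ) := by
    funext p
    simp [Finset.sum_apply]
  rw [this]

theorem ChainDatum.mem_group (D : ChainDatum v) (x : D.Coord k → ℝ) :
    x ∈ D.group k ↔
      InBox x ∧ x ∈ chainLattice (D.vec fun i : D.Coord k => i.1) (Fin.last D.s) := by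
  rw [mem_chainLattice, below_last]
  have key : ∀ a : Fin D.s → ℤ,
      (∀ i : D.Coord k, x i = Int.fract (∑ j, (a j : ℝ) * D.gen j i.1)) ↔
      InBox x ∧ x - ∑ u, a u • D.vec (fun i : D.Coord k => i.1) u ∈ intLattice _ := by
    intro a
    have h1 : (∑ u, a u • D.vec (fun i : D.Coord k => i.1) u)
        = fun i : D.Coord k => ∑ j, (a j : ℝ) * D.gen j i.1 := by
      funext i
      simp [ChainDatum.vec, Finset.sum_apply]
    rw [h1, ← fr_eq_fr_iff]
    constructor
    · intro h
      have h2 : x = fr fun i : D.Coord k => ∑ j, (a j : ℝ) * D.gen j i.1 := funext h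
      have hb : InBox x := by rw [h2]; exact inBox_fr _
      exact ⟨hb, by rw [hb.fr_eq]; exact h2⟩
    · rintro ⟨hb, h⟩ i
      rw [hb.fr_eq] at h
      exact congrFun h i
  constructor
  · rintro ⟨a, ha⟩
    obtain ⟨h1, h2⟩ := (key a).1 ha
    exact ⟨h1, a, h2⟩
  · rintro ⟨h1, a, h2⟩
    exact ⟨a, (key a).2 ⟨h1, h2⟩⟩

theorem latticeGroup_eq_group_iff (D : ChainDatum v) (w : D.Coord k → Fin d → ℤ) :
    latticeGroup w = D.group k ↔
      relLattice w = chainLattice (D.vec fun i : D.Coord k => i.1) (Fin.last D.s) := by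
  constructor
  · intro h
    refine eq_of_forall_inBox (intLattice_le_relLattice w) (intLattice_le_chainLattice _ _)
      fun x hx => ?_
    have h1 := Set.ext_iff.1 h x
    rw [mem_latticeGroup, ChainDatum.mem_group] at h1
    simpa [hx] using h1
  · intro h
    ext x
    rw [mem_latticeGroup, ChainDatum.mem_group, h]

theorem ChainDatum.isBlockMap_fst (D : ChainDatum v) (k : ℕ) :
    D.IsBlockMap k fun i : D.Coord k => i.1 := by
  intro b
  rw [← Fintype.card_subtype, Fintype.card_congr (Equiv.sigmaSubtype b), Fintype.card_fin]

theorem ChainDatum.IsBlockMap.exists_equiv [Fintype ι] {D : ChainDatum v} {f : ι → Fin D.s}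
    (hf : D.IsBlockMap k f) : ∃ σ : ι ≃ D.Coord k, ∀ i, (σ i).1 = f i := by
  have h : ∀ b, Nonempty ({i // f i = b} ≃ Fin (D.blockSize k b)) := fun b =>
    ⟨Fintype.equivFinOfCardEq (by rw [Fintype.card_subtype]; exact hf b)⟩
  have e := fun b => (h b).some
  exact ⟨(Equiv.sigmaFiberEquiv f).symm.trans (Equiv.sigmaCongrRight fun b => (e b)), fun i => rfl⟩

variable [Fintype ι]

/-- A simplex is associated with a datum if and only if, for any labelling of its vertices, its
lattice is the lattice of the datum. -/
theorem isAssociated_iff {w : ι → Fin d → ℤ} (hw : AffineIndependent ℝ fun i => toReal (w i))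
    (D : ChainDatum v) :
    IsAssociated k (convexHull ℝ (Set.range fun i => toReal (w i))) D ↔
      D.IsLatticeOf k (relLattice w) := by
  constructor
  · rintro ⟨w', hw', hP, hgrp⟩
    rw [latticeGroup_eq_group_iff] at hgrp
    obtain ⟨σ, hσ⟩ := exists_label_equiv hw hw' hP
    have hwσ : w = w' ∘ σ := funext fun i => (hσ i).symm
    refine ⟨fun i => (σ i).1, fun b => ?_, ?_⟩
    · rw [← D.isBlockMap_fst k b]
      refine Finset.card_equiv σ fun i => ?_
      simp
    · ext x
      have hx : x = (x ∘ σ.symm) ∘ σ := by funext i; simp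
      rw [hx, hwσ, mem_relLattice_comp, hgrp, ← mem_chainLattice_comp σ]
      rfl
  · rintro ⟨f, hf, hΓ⟩
    obtain ⟨σ, hσ⟩ := hf.exists_equiv
    have hf' : f = fun i => (σ i).1 := funext fun i => (hσ i).symm
    refine ⟨w ∘ σ.symm, ?_, ?_, ?_⟩
    · exact hw.comp_embedding σ.symm.toEmbedding
    · rw [range_comp_equiv]
    · rw [latticeGroup_eq_group_iff]
      ext x
      have hx : x = (x ∘ σ) ∘ σ.symm := by funext i; simp
      rw [hx, mem_relLattice_comp, hΓ, ← mem_chainLattice_comp σ, hf']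
      have hx' : ((x ∘ σ) ∘ σ.symm) ∘ σ = x ∘ σ := by funext i; simp
      rw [hx']
      rfl

end Associated

/-! ### Realizing a lattice by a simplex -/

section Realization

variable {d : ℕ}

/-- Every lattice between `ℤ^(d+1)` and a multiple `(1/m) ℤ^(d+1)` all of whose elements have
integral height is the lattice of a simplex. -/
theorem exists_relLattice_eq (Γ : AddSubgroup (Fin (d + 1) → ℝ)) (h0 : intLattice _ ≤ Γ)
    (hht : ∀ x ∈ Γ, ht x ∈ intReals) {m : ℕ} (hm : 0 < m)
    (hden : ∀ x ∈ Γ, ∀ i, (m : ℝ) * x i ∈ intReals) :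
    ∃ w : Fin (d + 1) → Fin d → ℤ, AffineIndependent ℝ (fun i => toReal (w i)) ∧
      relLattice w = Γ := by
  classical
  have hm0 : (0 : ℝ) < m := by exact_mod_cast hm
  let tail : (Fin (d + 1) → ℝ) →+ (Fin d → ℝ) :=
    { toFun := fun x i => x i.succ
      map_zero' := rfl
      map_add' := fun _ _ => rfl }
  let L : Submodule ℤ (Fin d → ℝ) := AddSubgroup.toIntSubmodule (Γ.map tail)
  have hL : ∀ y, y ∈ L ↔ ∃ x ∈ Γ, tail x = y := fun y => Iff.rfl
  -- Integral heights determine the coordinate 0 modulo 1 from the others, so Γ is recovered from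
  -- its projection L.
  have hadj : ∀ (x : Fin (d + 1) → ℝ), tail x ∈ L → x 0 + ∑ i, tail x i ∈ intReals → x ∈ Γ := by
    intro x hx hs
    obtain ⟨y, hy, hyx⟩ := (hL _).1 hx
    have h1 : ∀ i : Fin d, y i.succ = x i.succ := fun i => congrFun hyx i
    have h2 := hht y hy
    rw [ht, Fin.sum_univ_succ] at h2
    have h3 : x - y ∈ intLattice (Fin (d + 1)) := by
      rw [mem_intLattice]
      intro i
      refine Fin.cases ?_ (fun i => ?_) i
      · have h4 := sub_mem hs h2
        have h5 : ∑ i : Fin d, y i.succ = ∑ i, tail x i := Finset.sum_congr rfl fun i _ => h1 i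
        rw [h5] at h4
        simpa using h4
      · rw [Pi.sub_apply, h1, sub_self]
        exact zero_mem _
    have h4 := add_mem (h0 h3) hy
    simpa using h4
  have hsingle : ∀ j : Fin d, (Pi.single j 1 : Fin d → ℝ) ∈ L := by
    intro j
    refine (hL _).2 ⟨Pi.single j.succ 1, h0 (mem_intLattice.2 fun i => ?_), ?_⟩
    · simp only [Pi.single_apply]
      split_ifs
      · exact one_mem_intReals
      · exact zero_mem _
    · funext i
      simp [tail, Pi.single_apply]
  -- Coordinates of elements of L are multiples of 1/m, so the ball of radius 1/m contains only the
  -- zero vector of L.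
  have hdisc : DiscreteTopology L := by
    rw [discreteTopology_iff_isOpen_singleton_zero]
    refine ⟨Metric.ball 0 (1 / m), Metric.isOpen_ball, ?_⟩
    ext ⟨y, hy⟩
    rw [Set.mem_preimage, Set.mem_singleton_iff, mem_ball_zero_iff, pi_norm_lt_iff (by positivity)]
    constructor
    · intro h
      obtain ⟨x, hx, hxy⟩ := (hL y).1 hy
      ext i
      have h1 : (m : ℝ) * y i ∈ intReals := by
        rw [← hxy]
        exact hden x hx i.succ
      have h2 := h i
      rw [Real.norm_eq_abs, lt_div_iff₀ hm0, ← abs_of_pos hm0, ← abs_mul, mul_comm, abs_lt] at h2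
      exact (mul_eq_zero.1 (eq_zero_of_mem_intReals h1 h2.1 h2.2)).resolve_left hm0.ne'
    · intro h i
      have h' : y = 0 := congrArg Subtype.val h
      show ‖y i‖ < 1 / m
      rw [h']
      simpa using hm
  have hspan : IsZLattice ℝ L := ⟨by
    rw [eq_top_iff, ← (Pi.basisFun ℝ (Fin d)).span_eq, Submodule.span_le]
    rintro _ ⟨j, rfl⟩
    refine Submodule.subset_span ?_
    rw [Pi.basisFun_apply]
    exact hsingle j⟩
  have hfin : Module.Finite ℤ L := ZLattice.module_finite ℝ L
  have hfree : Module.Free ℤ L := ZLattice.module_free ℝ L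
  let b : Module.Basis (Fin d) ℤ L := Module.finBasisOfFinrankEq ℤ L (by
    rw [ZLattice.rank ℝ L]
    simp)
  let B : Module.Basis (Fin d) ℝ (Fin d → ℝ) := b.ofZLatticeBasis ℝ L
  have hB : ∀ y, y ∈ L ↔ B.equivFun y ∈ intLattice (Fin d) := by
    intro y
    have h := B.mem_span_iff_repr_mem ℤ y
    rw [b.ofZLatticeBasis_span ℝ L] at h
    rw [mem_intLattice]
    exact h
  -- In a basis of L, the lattice L becomes ℤ^d; the simplex has as vertices the origin and the unit
  -- vectors written in this basis.
  choose w hw using fun j => mem_intLattice_iff_toReal.1 ((hB _).1 (hsingle j))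
  have hw0 : toReal (0 : Fin d → ℤ) = 0 := by funext i; simp [toReal]
  let w' : Fin (d + 1) → Fin d → ℤ := Fin.cons 0 w
  have hcombo : ∀ x, ∑ i, x i • toReal (w' i) = B.equivFun (tail x) := by
    intro x
    rw [Fin.sum_univ_succ]
    simp only [w', Fin.cons_zero, Fin.cons_succ, hw0, smul_zero, zero_add, ← hw]
    simp only [← map_smul, ← map_sum]
    congr 1
    funext i
    simp [Finset.sum_apply, Pi.single_apply, tail]
  refine ⟨w', ?_, ?_⟩
  · rw [affineIndependent_iff_combo, injective_iff_map_eq_zero]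
    intro x hx
    rw [combo_apply, Prod.mk_eq_zero, hcombo] at hx
    have h1 : tail x = 0 := by simpa using hx.1
    have h2 : ∀ i : Fin d, x i.succ = 0 := fun i => congrFun h1 i
    have h3 := hx.2
    rw [Fin.sum_univ_succ, Finset.sum_eq_zero fun i _ => h2 i, add_zero] at h3
    funext i
    exact Fin.cases h3 h2 i
  · ext x
    rw [mem_relLattice, hcombo, ← hB, Fin.sum_univ_succ]
    constructor
    · rintro ⟨h1, h2⟩
      exact hadj x h1 h2
    · intro hx
      refine ⟨(hL _).2 ⟨x, hx, rfl⟩, ?_⟩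
      have := hht x hx
      rwa [ht, Fin.sum_univ_succ] at this

end Realization

/-! ### The Ehrhart series as a sum over the box elements -/

section Ehrhart

open PowerSeries

variable {ι : Type} [Fintype ι] {d : ℕ}

theorem mem_smul_convexHull_iff (w : ι → Fin d → ℤ) {r : ℝ} (hr : 0 < r) (z : Fin d → ℝ) :
    z ∈ r • convexHull ℝ (Set.range fun i => toReal (w i)) ↔
      ∃ x : ι → ℝ, (∀ i, 0 ≤ x i) ∧ combo w x = (z, r) := by
  rw [Set.mem_smul_set]
  constructor
  · rintro ⟨y, hy, rfl⟩
    obtain ⟨x, hx, hxy⟩ := (mem_convexHull_iff w y).1 hy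
    exact ⟨r • x, fun i => mul_nonneg hr.le (hx i), by rw [map_smul, hxy]; simp⟩
  · rintro ⟨x, hx, hxz⟩
    refine ⟨r⁻¹ • z, (mem_convexHull_iff w _).2 ⟨r⁻¹ • x, fun i => ?_, ?_⟩, ?_⟩
    · exact mul_nonneg (inv_nonneg.2 hr.le) (hx i)
    · rw [map_smul, hxz]
      simp [hr.ne']
    · rw [smul_smul, mul_inv_cancel₀ hr.ne', one_smul]

theorem latticeCount_eq {w : ι → Fin d → ℤ} (hw : AffineIndependent ℝ fun i => toReal (w i))
    {m : ℕ} (hm : 0 < m) :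
    latticeCount (convexHull ℝ (Set.range fun i => toReal (w i))) m
      = Set.ncard {x : ι → ℝ | (∀ i, 0 ≤ x i) ∧ x ∈ relLattice w ∧ ht x = m} := by
  have hm0 : (0 : ℝ) < m := by exact_mod_cast hm
  have hinj := (affineIndependent_iff_combo w).1 hw
  rw [latticeCount, ← Set.ncard_image_of_injective _ toReal_injective]
  have h1 : Set.InjOn (fun x => (combo w x).1)
      {x : ι → ℝ | (∀ i, 0 ≤ x i) ∧ x ∈ relLattice w ∧ ht x = m} := by
    rintro x ⟨-, -, hx⟩ y ⟨-, -, hy⟩ hxy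
    refine hinj (Prod.ext hxy ?_)
    rw [combo_snd, combo_snd]
    exact hx.trans hy.symm
  rw [← h1.ncard_image]
  congr 1
  ext z
  simp only [Set.mem_image, Set.mem_ofPred_eq]
  constructor
  · rintro ⟨y, hy, rfl⟩
    obtain ⟨x, hx, hxy⟩ := (mem_smul_convexHull_iff w hm0 _).1 hy
    refine ⟨x, ⟨hx, ?_, ?_⟩, by rw [hxy]⟩
    · rw [mem_relLattice_iff_combo, hxy]
      exact ⟨toReal_mem y, natCast_mem_intReals m⟩
    · rw [ht, ← combo_snd w, hxy]
  · rintro ⟨x, ⟨hx, hxΓ, hxm⟩, rfl⟩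
    rw [mem_relLattice_iff_combo] at hxΓ
    obtain ⟨y, hy⟩ := mem_intLattice_iff_toReal.1 hxΓ.1
    refine ⟨y, (mem_smul_convexHull_iff w hm0 _).2 ⟨x, hx, Prod.ext hy ?_⟩, hy.symm⟩
    rw [combo_snd]
    exact hxm

theorem finite_intReals (C : ℝ) : {r : ℝ | r ∈ intReals ∧ |r| ≤ C}.Finite := by
  refine ((Set.finite_Icc (-⌈C⌉) ⌈C⌉).image (Int.cast : ℤ → ℝ)).subset ?_
  rintro _ ⟨⟨z, rfl⟩, hz⟩
  refine ⟨z, ?_, rfl⟩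
  have h1 := hz.trans (Int.le_ceil C)
  simp only [Int.coe_castAddHom] at h1
  rw [abs_le] at h1
  exact ⟨by exact_mod_cast h1.1, by exact_mod_cast h1.2⟩

/-- The box has bounded image under the injective map `combo w`, and its elements in the lattice map
to integral points. -/
theorem finite_latticeGroup {w : ι → Fin d → ℤ}
    (hw : AffineIndependent ℝ fun i => toReal (w i)) : (latticeGroup w).Finite := by
  have hinj := (affineIndependent_iff_combo w).1 hw
  refine Set.Finite.of_finite_image (f := combo w) ?_ hinj.injOn
  refine ((Set.Finite.pi' fun j => finite_intReals (∑ i, |(w i j : ℝ)|)).prod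
    (finite_intReals (Fintype.card ι))).subset ?_
  rintro _ ⟨x, hx, rfl⟩
  rw [mem_latticeGroup, mem_relLattice_iff_combo, mem_intLattice] at hx
  obtain ⟨hb, h1, h2⟩ := hx
  have habs : ∀ i, |x i| ≤ 1 := fun i => by
    rw [abs_of_nonneg (hb i).1]
    exact (hb i).2.le
  refine ⟨fun j => ⟨h1 j, ?_⟩, h2, ?_⟩
  · rw [combo_apply]
    simp only [Finset.sum_apply]
    refine (Finset.abs_sum_le_sum_abs _ _).trans (Finset.sum_le_sum fun i _ => ?_)
    rw [Pi.smul_apply, smul_eq_mul, abs_mul]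
    exact mul_le_of_le_one_left (abs_nonneg _) (habs i)
  · rw [combo_snd]
    refine (Finset.abs_sum_le_sum_abs _ _).trans ((Finset.sum_le_sum fun i _ => habs i).trans ?_)
    simp

/-- The height of an element of the group of a simplex, as a natural number. -/
def natHt (x : ι → ℝ) : ℕ := ⌊ht x⌋₊

theorem natHt_cast {x : ι → ℝ} (hx : ∀ i, 0 ≤ x i) (h : ht x ∈ intReals) :
    (natHt x : ℝ) = ht x := by
  obtain ⟨z, hz⟩ := mem_intReals.1 h
  have h0 := ht_nonneg hx
  rw [← hz] at h0
  have h1 : 0 ≤ z := by exact_mod_cast h0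
  obtain ⟨n, rfl⟩ := Int.eq_ofNat_of_zero_le h1
  rw [natHt, ← hz]
  simp

theorem ht_natCast (a : ι → ℕ) : ht (fun i => (a i : ℝ)) = ((∑ i, a i : ℕ) : ℝ) := by
  simp [ht]

/-- Lattice points of the cone over a simplex, counted by fractional parts. -/
theorem ncard_cone_eq [DecidableEq ι] {w : ι → Fin d → ℤ} {F : Finset (ι → ℝ)}
    (hF : ∀ x, x ∈ F ↔ InBox x ∧ x ∈ relLattice w) (m : ℕ) :
    Set.ncard {x : ι → ℝ | (∀ i, 0 ≤ x i) ∧ x ∈ relLattice w ∧ ht x = m}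
      = ∑ y ∈ F, if natHt y ≤ m then
          ((Finset.univ : Finset ι).finsuppAntidiag (m - natHt y)).card else 0 := by
  classical
  -- Pairs of fractional and integral part of a cone point; the guard is needed because `m - natHt
  -- y` is truncated subtraction.
  let T : Finset (Σ _ : ι → ℝ, ι →₀ ℕ) := F.sigma fun y =>
    if natHt y ≤ m then (Finset.univ : Finset ι).finsuppAntidiag (m - natHt y) else ∅
  let g : (Σ _ : ι → ℝ, ι →₀ ℕ) → ι → ℝ := fun p i => p.1 i + (p.2 i : ℝ)
  have hint : ∀ a : ι →₀ ℕ, (fun i => (a i : ℝ)) ∈ intLattice ι := fun a =>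
    mem_intLattice.2 fun i => natCast_mem_intReals _
  have hht : ∀ x, x ∈ relLattice w → ht x ∈ intReals := fun x hx =>
    ((mem_relLattice w x).1 hx).2
  have hmem : ∀ y (a : ι →₀ ℕ), (⟨y, a⟩ : Σ _ : ι → ℝ, ι →₀ ℕ) ∈ T ↔
      y ∈ F ∧ natHt y + ∑ i, a i = m := by
    intro y a
    simp only [T, Finset.mem_sigma]
    refine and_congr_right fun _ => ?_
    split_ifs with h
    · rw [Finset.mem_finsuppAntidiag]
      simp only [Finset.subset_univ, and_true]
      change ∑ i, a i = m - natHt y ↔ _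
      omega
    · simp only [Finset.notMem_empty, false_iff]
      omega
  have hinj : Set.InjOn g T := by
    rintro ⟨y, a⟩ hya ⟨y', a'⟩ hya' h
    rw [Finset.mem_coe, hmem] at hya hya'
    have h1 := (hF y).1 hya.1
    have h2 := (hF y').1 hya'.1
    have h3 : y = y' := by
      refine h1.1.eq_of_sub_mem h2.1 ?_
      have h4 := sub_mem (hint a') (hint a)
      convert h4 using 1
      funext i
      have h5 := congrFun h i
      simp only [g] at h5
      simp only [Pi.sub_apply]
      linarith
    subst h3
    congr 1
    ext i
    have h5 := congrFun h i
    simp only [g, add_right_inj] at h5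
    exact_mod_cast h5
  have himage : {x : ι → ℝ | (∀ i, 0 ≤ x i) ∧ x ∈ relLattice w ∧ ht x = m}
      = ((T.image g : Finset (ι → ℝ)) : Set (ι → ℝ)) := by
    ext x
    simp only [Set.mem_ofPred_eq, Finset.coe_image, Set.mem_image, Finset.mem_coe]
    constructor
    · rintro ⟨hx0, hx, hxm⟩
      have hfl : ∀ i, ((⌊x i⌋₊ : ℕ) : ℝ) = (⌊x i⌋ : ℝ) := fun i =>
        natCast_floor_eq_intCast_floor (hx0 i)
      have hy := fr_mem (intLattice_le_relLattice w) hx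
      let a : ι →₀ ℕ := Finsupp.equivFunOnFinite.symm fun i => ⌊x i⌋₊
      have hxa : x = fr x + fun i => (a i : ℝ) := by
        funext i
        simp only [Pi.add_apply, fr, a, Finsupp.equivFunOnFinite_symm_apply_apply, hfl]
        rw [Int.fract_add_floor]
      refine ⟨⟨fr x, a⟩, (hmem _ _).2 ⟨(hF _).2 ⟨inBox_fr x, hy⟩, ?_⟩, hxa.symm⟩
      have h1 := congrArg ht hxa
      rw [ht_add, ht_natCast, hxm, ← natHt_cast (fun i => (inBox_fr x i).1) (hht _ hy)] at h1
      exact_mod_cast h1.symm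
    · rintro ⟨⟨y, a⟩, hya, rfl⟩
      rw [hmem] at hya
      obtain ⟨hyb, hyΓ⟩ := (hF y).1 hya.1
      refine ⟨fun i => add_nonneg (hyb i).1 (Nat.cast_nonneg _), ?_, ?_⟩
      · exact add_mem hyΓ (intLattice_le_relLattice w (hint a))
      · have h1 : g ⟨y, a⟩ = y + fun i => (a i : ℝ) := rfl
        rw [h1, ht_add, ht_natCast, ← natHt_cast (fun i => (hyb i).1) (hht _ hyΓ)]
        exact_mod_cast hya.2
  rw [himage, Set.ncard_coe_finset, Finset.card_image_of_injOn hinj, Finset.card_sigma]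
  refine Finset.sum_congr rfl fun y _ => ?_
  split_ifs <;> simp

theorem coeff_mk_one_pow [DecidableEq ι] (n : ℕ) :
    coeff n ((PowerSeries.mk 1 : PowerSeries ℤ) ^ Fintype.card ι)
      = ((Finset.univ : Finset ι).finsuppAntidiag n).card := by
  have h := PowerSeries.coeff_prod (fun _ : ι => (PowerSeries.mk 1 : PowerSeries ℤ)) n Finset.univ
  rw [Finset.prod_const, Finset.card_univ] at h
  rw [h]
  simp

/-- Splitting a cone point into a box element and a vector in ℕ^ι factors the generating function;
the second factor is a power of the geometric series. -/
theorem ehrhartSeries_eq {w : ι → Fin d → ℤ} (hw : AffineIndependent ℝ fun i => toReal (w i))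
    {F : Finset (ι → ℝ)} (hF : ∀ x, x ∈ F ↔ InBox x ∧ x ∈ relLattice w) :
    ehrhartSeries (convexHull ℝ (Set.range fun i => toReal (w i)))
      = (∑ y ∈ F, (X : PowerSeries ℤ) ^ natHt y) * PowerSeries.mk 1 ^ Fintype.card ι := by
  classical
  -- The constant term of the Ehrhart series is 1 by definition, in agreement with the single cone
  -- point of height 0.
  have h0 : {x : ι → ℝ | (∀ i, 0 ≤ x i) ∧ x ∈ relLattice w ∧ ht x = ((0 : ℕ) : ℝ)} = {0} := by
    ext x
    simp only [Set.mem_ofPred_eq, Set.mem_singleton_iff, Nat.cast_zero]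
    constructor
    · rintro ⟨h1, -, h2⟩
      exact (eq_of_le_of_ht_eq h1 (by rw [h2]; exact ht_zero)).symm
    · rintro rfl
      exact ⟨fun i => le_rfl, zero_mem _, ht_zero⟩
  have h1 : ∀ m, coeff m (ehrhartSeries (convexHull ℝ (Set.range fun i => toReal (w i))))
      = (Set.ncard {x : ι → ℝ | (∀ i, 0 ≤ x i) ∧ x ∈ relLattice w ∧ ht x = m} : ℤ) := by
    intro m
    rw [ehrhartSeries, coeff_mk]
    split_ifs with h
    · subst h
      rw [h0, Set.ncard_singleton]
      rfl
    · rw [latticeCount_eq hw (Nat.pos_of_ne_zero h)]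
  ext m
  rw [h1, ncard_cone_eq hF, Finset.sum_mul, map_sum]
  push_cast
  refine Finset.sum_congr rfl fun y _ => ?_
  rw [coeff_X_pow_mul', coeff_mk_one_pow]

theorem hasHStar_iff {w : ι → Fin d → ℤ} (hw : AffineIndependent ℝ fun i => toReal (w i))
    (hcard : Fintype.card ι = d + 1)
    {F : Finset (ι → ℝ)} (hF : ∀ x, x ∈ F ↔ InBox x ∧ x ∈ relLattice w) (h : Polynomial ℤ) :
    HasHStar (convexHull ℝ (Set.range fun i => toReal (w i))) h ↔
      ∑ y ∈ F, (X : PowerSeries ℤ) ^ natHt y = (h : PowerSeries ℤ) := by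
  rw [HasHStar, ehrhartSeries_eq hw hF, hcard, mul_assoc, ← mul_pow,
    PowerSeries.mk_one_mul_one_sub_eq_one, one_pow, mul_one]

/-- The `h^*`-polynomial is `1 + t^k + ⋯ + t^((v-1)k)` if and only if the lattice of the simplex is
a step lattice. -/
theorem hasHStar_iff_stepLattice {k v : ℕ} (hk : 1 ≤ k) {w : ι → Fin d → ℤ}
    (hw : AffineIndependent ℝ fun i => toReal (w i)) (hcard : Fintype.card ι = d + 1) :
    HasHStar (convexHull ℝ (Set.range fun i => toReal (w i)))
        (∑ i ∈ Finset.range v, (Polynomial.X : Polynomial ℤ) ^ (i * k)) ↔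
      StepLattice (relLattice w) k v := by
  classical
  set F := (finite_latticeGroup hw).toFinset with hFdef
  have hF : ∀ x, x ∈ F ↔ InBox x ∧ x ∈ relLattice w := fun x => by
    rw [hFdef, Set.Finite.mem_toFinset, mem_latticeGroup]
  have hp : ((∑ i ∈ Finset.range v, (Polynomial.X : Polynomial ℤ) ^ (i * k) : Polynomial ℤ) :
      PowerSeries ℤ) = ∑ i ∈ Finset.range v, (X : PowerSeries ℤ) ^ (i * k) := by
    rw [← Polynomial.coeToPowerSeries.ringHom_apply, map_sum]
    simp
  have hcast : ∀ x ∈ F, (natHt x : ℝ) = ht x := fun x hx =>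
    natHt_cast (fun i => (((hF x).1 hx).1 i).1) ((mem_relLattice w x).1 ((hF x).1 hx).2).2
  have hiff : ∀ x ∈ F, ∀ j : ℕ, natHt x = j * k ↔ ht x = (j : ℝ) * k := fun x hx j => by
    rw [← hcast x hx]
    exact_mod_cast Iff.rfl
  rw [hasHStar_iff hw hcard hF, hp]
  constructor
  · intro h
    have hcoeff : ∀ n, (F.filter fun y => n = natHt y).card
        = ((Finset.range v).filter fun i => n = i * k).card := by
      intro n
      have h1 := congrArg (coeff n) h
      simp only [map_sum, coeff_X_pow, Finset.sum_boole] at h1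
      exact_mod_cast h1
    have hone : ∀ n, ((Finset.range v).filter fun i => n = i * k).card ≤ 1 := by
      intro n
      rw [Finset.card_le_one]
      intro a ha b hb
      rw [Finset.mem_filter] at ha hb
      exact Nat.eq_of_mul_eq_mul_right hk (ha.2.symm.trans hb.2)
    refine ⟨intLattice_le_relLattice w, fun x hx hxb => ?_, fun j hj => ?_,
      fun x hx y hy hxb hyb he => ?_⟩
    · have hxF := (hF x).2 ⟨hxb, hx⟩
      have h1 : 0 < (F.filter fun y => natHt x = natHt y).card :=
        Finset.card_pos.2 ⟨x, Finset.mem_filter.2 ⟨hxF, rfl⟩⟩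
      rw [hcoeff] at h1
      obtain ⟨j, hj⟩ := Finset.card_pos.1 h1
      rw [Finset.mem_filter, Finset.mem_range] at hj
      exact ⟨j, hj.1, (hiff x hxF j).1 hj.2⟩
    · have h1 : 0 < ((Finset.range v).filter fun i => j * k = i * k).card :=
        Finset.card_pos.2 ⟨j, Finset.mem_filter.2 ⟨Finset.mem_range.2 hj, rfl⟩⟩
      rw [← hcoeff] at h1
      obtain ⟨x, hx⟩ := Finset.card_pos.1 h1
      rw [Finset.mem_filter] at hx
      exact ⟨x, ((hF x).1 hx.1).2, ((hF x).1 hx.1).1, (hiff x hx.1 j).1 hx.2.symm⟩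
    · have hxF := (hF x).2 ⟨hxb, hx⟩
      have hyF := (hF y).2 ⟨hyb, hy⟩
      have h1 : (F.filter fun y => natHt x = natHt y).card ≤ 1 := by
        rw [hcoeff]
        exact hone _
      refine Finset.card_le_one.1 h1 x (Finset.mem_filter.2 ⟨hxF, rfl⟩) y
        (Finset.mem_filter.2 ⟨hyF, ?_⟩)
      rw [natHt, natHt, he]
  · intro h
    have hdiv : ∀ x ∈ F, ∃ j < v, natHt x = j * k := fun x hx => by
      obtain ⟨j, hj, hxj⟩ := h.height x ((hF x).1 hx).2 ((hF x).1 hx).1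
      exact ⟨j, hj, (hiff x hx j).2 hxj⟩
    refine Finset.sum_bij (fun y _ => natHt y / k) ?_ ?_ ?_ ?_
    · intro y hy
      obtain ⟨j, hj, hyj⟩ := hdiv y hy
      rw [hyj, Nat.mul_div_cancel _ hk]
      exact Finset.mem_range.2 hj
    · intro y hy y' hy' he
      obtain ⟨j, hj, hyj⟩ := hdiv y hy
      obtain ⟨j', hj', hyj'⟩ := hdiv y' hy'
      rw [hyj, hyj', Nat.mul_div_cancel _ hk, Nat.mul_div_cancel _ hk] at he
      refine h.eq_of_ht y ((hF y).1 hy).2 y' ((hF y').1 hy').2 ((hF y).1 hy).1 ((hF y').1 hy').1 ?_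
      rw [(hiff y hy j).1 hyj, (hiff y' hy' j').1 hyj', he]
    · intro j hj
      obtain ⟨x, hx, hxb, hxj⟩ := h.exists_elt j (Finset.mem_range.1 hj)
      have hxF := (hF x).2 ⟨hxb, hx⟩
      refine ⟨x, hxF, ?_⟩
      rw [(hiff x hxF j).2 hxj, Nat.mul_div_cancel _ hk]
    · intro y hy
      obtain ⟨j, hj, hyj⟩ := hdiv y hy
      rw [hyj, Nat.mul_div_cancel _ hk]

end Ehrhart

/-! ### Pyramids and trivial coordinates -/

section Pyramid

variable {ι : Type} [Fintype ι] {d e : ℕ}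

theorem isLatticePolytope_range [Nonempty ι] (w : ι → Fin d → ℤ) :
    IsLatticePolytope (convexHull ℝ (Set.range fun i => toReal (w i))) := by
  classical
  refine ⟨Finset.univ.image w, Finset.univ_nonempty.image w, ?_⟩
  rw [Finset.coe_image, Finset.coe_univ, Set.image_univ, ← Set.range_comp]
  rfl

/-- Appending a zero coordinate. -/
def appendZero (n : ℕ) : (Fin n → ℝ) →ₗ[ℝ] (Fin (n + 1) → ℝ) where
  toFun x := Fin.snoc (α := fun _ => ℝ) x 0
  map_add' x y := by
    funext i
    refine Fin.lastCases ?_ (fun i => ?_) i <;> simp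
  map_smul' r x := by
    funext i
    refine Fin.lastCases ?_ (fun i => ?_) i <;> simp

theorem appendZero_castSucc {n : ℕ} (x : Fin n → ℝ) (i : Fin n) :
    appendZero n x i.castSucc = x i := by simp [appendZero]

theorem appendZero_last {n : ℕ} (x : Fin n → ℝ) : appendZero n x (Fin.last n) = 0 := by
  simp [appendZero]

theorem pyr_convexHull (S : Set (Fin d → ℝ)) :
    pyr (convexHull ℝ S) = convexHull ℝ (appendZero d '' S ∪ {Pi.single (Fin.last d) 1}) := by
  have h : pyr (convexHull ℝ S)
      = convexHull ℝ (appendZero d '' convexHull ℝ S ∪ {Pi.single (Fin.last d) 1}) := rfl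
  rw [h, LinearMap.image_convexHull]
  exact (convexHull ℝ).closure_sup_closure_left _ _

/-- A simplex with a coordinate that is integral on its lattice is a lattice pyramid. -/
theorem isLatticePyramid_of_last {w : Fin (e + 2) → Fin (e + 1) → ℤ}
    (hw : AffineIndependent ℝ fun i => toReal (w i)) {m : ℕ} (hm : 0 < m)
    (hden : ∀ x ∈ relLattice w, ∀ i, (m : ℝ) * x i ∈ intReals)
    (hlast : ∀ x ∈ relLattice w, x (Fin.last (e + 1)) ∈ intReals) :
    IsLatticePyramid (convexHull ℝ (Set.range fun i => toReal (w i))) := by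
  classical
  have hsum : ∀ y, ht (appendZero (e + 1) y) = ht y := by
    intro y
    simp only [ht, Fin.sum_univ_castSucc, appendZero_castSucc, appendZero_last, add_zero]
  -- Since the last coordinate is integral, the lattice is its slice at last coordinate 0 times ℤ.
  -- The slice is realized by the base.
  obtain ⟨w₁, hw₁, hΓ⟩ := exists_relLattice_eq
    ((relLattice w).comap (appendZero (e + 1)).toAddMonoidHom) (by
      intro y hy
      refine intLattice_le_relLattice w (mem_intLattice.2 fun i => ?_)
      refine Fin.lastCases ?_ (fun i => ?_) i
      · rw [LinearMap.toAddMonoidHom_coe, appendZero_last]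
        exact zero_mem _
      · rw [LinearMap.toAddMonoidHom_coe, appendZero_castSucc]
        exact mem_intLattice.1 hy i) (by
      intro y hy
      rw [← hsum]
      exact ((mem_relLattice w _).1 hy).2) hm (by
      intro y hy i
      have h1 := hden _ hy i.castSucc
      rwa [LinearMap.toAddMonoidHom_coe, appendZero_castSucc] at h1)
  have hmem₁ : ∀ y, y ∈ relLattice w₁ ↔ appendZero (e + 1) y ∈ relLattice w := fun y => by
    rw [hΓ]
    rfl
  -- The vertices of the pyramid over w₁, the apex being last. Its lattice is again slice times ℤ,
  -- so it is equivalent to the given simplex.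
  let w₂ : Fin (e + 2) → Fin (e + 1) → ℤ :=
    Fin.snoc (α := fun _ => Fin (e + 1) → ℤ) (fun i => Fin.snoc (α := fun _ => ℤ) (w₁ i) 0)
      (Pi.single (Fin.last e) 1)
  have hw₂c : ∀ i : Fin (e + 1), toReal (w₂ i.castSucc) = appendZero e (toReal (w₁ i)) := by
    intro i
    funext j
    refine Fin.lastCases ?_ (fun j => ?_) j
    · simp [w₂, toReal, appendZero_last]
    · simp [w₂, toReal, appendZero_castSucc]
  have hw₂l : toReal (w₂ (Fin.last (e + 1))) = Pi.single (Fin.last e) 1 := by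
    funext j
    simp only [w₂, toReal, Fin.snoc_last, Pi.single_apply]
    split_ifs <;> simp
  have hcombo : ∀ x : Fin (e + 2) → ℝ, ∑ i, x i • toReal (w₂ i)
      = appendZero e (∑ i : Fin (e + 1), x i.castSucc • toReal (w₁ i))
        + x (Fin.last (e + 1)) • Pi.single (Fin.last e) 1 := by
    intro x
    rw [Fin.sum_univ_castSucc, hw₂l]
    simp only [hw₂c, map_sum, map_smul]
  have hcoordc : ∀ (x : Fin (e + 2) → ℝ) (j : Fin e), (∑ i, x i • toReal (w₂ i)) j.castSucc
      = (∑ i : Fin (e + 1), x i.castSucc • toReal (w₁ i)) j := by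
    intro x j
    rw [hcombo, Pi.add_apply, appendZero_castSucc]
    simp [(Fin.castSucc_lt_last j).ne]
  have hcoordl : ∀ x : Fin (e + 2) → ℝ, (∑ i, x i • toReal (w₂ i)) (Fin.last e)
      = x (Fin.last (e + 1)) := by
    intro x
    rw [hcombo, Pi.add_apply, appendZero_last]
    simp
  have hw₂ : AffineIndependent ℝ fun i => toReal (w₂ i) := by
    rw [affineIndependent_iff_combo, injective_iff_map_eq_zero]
    intro x hx
    rw [combo_apply, Prod.mk_eq_zero] at hx
    have h1 : x (Fin.last (e + 1)) = 0 := by rw [← hcoordl x, hx.1]; rfl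
    have h2 : combo w₁ (fun i => x i.castSucc) = 0 := by
      rw [combo_apply, Prod.mk_eq_zero]
      refine ⟨funext fun j => by rw [← hcoordc x, hx.1]; rfl, ?_⟩
      have h3 := hx.2
      rwa [Fin.sum_univ_castSucc, h1, add_zero] at h3
    have h3 := (injective_iff_map_eq_zero _).1 ((affineIndependent_iff_combo w₁).1 hw₁) _ h2
    funext i
    exact Fin.lastCases h1 (fun i => congrFun h3 i) i
  have hdecomp : ∀ x : Fin (e + 2) → ℝ, x
      = appendZero (e + 1) (fun i => x i.castSucc)
        + Pi.single (Fin.last (e + 1)) (x (Fin.last (e + 1))) := by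
    intro x
    funext i
    refine Fin.lastCases ?_ (fun i => ?_) i
    · simp [appendZero_last]
    · simp [appendZero_castSucc, (Fin.castSucc_lt_last i).ne]
  have hsingle : ∀ r ∈ intReals, (Pi.single (Fin.last (e + 1)) r : Fin (e + 2) → ℝ)
      ∈ intLattice (Fin (e + 2)) := by
    intro r hr
    refine mem_intLattice.2 fun i => ?_
    simp only [Pi.single_apply]
    split_ifs
    · exact hr
    · exact zero_mem _
  have hrel : relLattice w₂ = relLattice w := by
    ext x
    have h1 : x ∈ relLattice w₂ ↔ x (Fin.last (e + 1)) ∈ intReals ∧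
        (fun i : Fin (e + 1) => x i.castSucc) ∈ relLattice w₁ := by
      rw [mem_relLattice, mem_relLattice, mem_intLattice, mem_intLattice, Fin.forall_fin_succ',
        hcoordl]
      simp only [hcoordc]
      rw [Fin.sum_univ_castSucc x]
      constructor
      · rintro ⟨⟨h1, h2⟩, h3⟩
        refine ⟨h2, h1, ?_⟩
        have h4 := sub_mem h3 h2
        rwa [add_sub_cancel_right] at h4
      · rintro ⟨h2, h1, h3⟩
        exact ⟨⟨h1, h2⟩, add_mem h3 h2⟩
    rw [h1, hmem₁]
    constructor
    · rintro ⟨h2, h3⟩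
      rw [hdecomp x]
      exact add_mem h3 (intLattice_le_relLattice w (hsingle _ h2))
    · intro hx
      have h2 := hlast x hx
      refine ⟨h2, ?_⟩
      have h3 := sub_mem hx (intLattice_le_relLattice w (hsingle _ h2))
      rwa [sub_eq_of_eq_add (hdecomp x)] at h3
  refine ⟨convexHull ℝ (Set.range fun i => toReal (w₁ i)), isLatticePolytope_range w₁, ?_⟩
  have hpyr : pyr (convexHull ℝ (Set.range fun i => toReal (w₁ i)))
      = convexHull ℝ (Set.range fun i => toReal (w₂ i)) := by
    rw [pyr_convexHull]
    congr 1
    ext y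
    simp only [Set.mem_union, Set.mem_image, Set.mem_range, exists_exists_eq_and,
      Set.mem_singleton_iff]
    have h := Fin.exists_fin_succ' (P := fun i => toReal (w₂ i) = y)
    rw [h, hw₂l]
    simp only [hw₂c, eq_comm]
  rw [hpyr]
  exact unimodEquiv_of_relLattice_eq hw₂ hw (by simp) hrel

theorem isLatticePyramid_of_forall_mem {w : ι → Fin d → ℤ}
    (hw : AffineIndependent ℝ fun i => toReal (w i)) (hcard : Fintype.card ι = d + 1)
    (hd : 0 < d) {m : ℕ} (hm : 0 < m)
    (hden : ∀ x ∈ relLattice w, ∀ i, (m : ℝ) * x i ∈ intReals)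
    {i₀ : ι} (hi₀ : ∀ x ∈ relLattice w, x i₀ ∈ intReals) :
    IsLatticePyramid (convexHull ℝ (Set.range fun i => toReal (w i))) := by
  classical
  obtain ⟨e, rfl⟩ := Nat.exists_eq_succ_of_ne_zero hd.ne'
  let τ : Fin (e + 2) ≃ ι := (Fintype.equivFinOfCardEq hcard).symm
  let σ : Fin (e + 2) ≃ ι := (Equiv.swap (Fin.last (e + 1)) (τ.symm i₀)).trans τ
  have hσ : σ (Fin.last (e + 1)) = i₀ := by simp [σ]
  have hmem : ∀ x, x ∈ relLattice (w ∘ σ) → x ∘ σ.symm ∈ relLattice w := by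
    intro x hx
    rw [← mem_relLattice_comp σ]
    convert hx using 1
    funext i
    simp
  rw [← range_comp_equiv σ]
  refine isLatticePyramid_of_last (hw.comp_embedding σ.toEmbedding) hm ?_ ?_
  · intro x hx i
    have h1 := hden _ (hmem x hx) (σ i)
    simpa using h1
  · intro x hx
    have h1 := hi₀ _ (hmem x hx)
    simpa [← hσ] using h1

/-- After a unimodular map all vertices but the apex have last coordinate 0, so the last coordinate
of ∑ x_i w_i is the coefficient x of the apex. -/
theorem exists_of_isLatticePyramid {w : ι → Fin d → ℤ}
    (hw : AffineIndependent ℝ fun i => toReal (w i))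
    (h : IsLatticePyramid (convexHull ℝ (Set.range fun i => toReal (w i)))) :
    ∃ i, ∀ x ∈ relLattice w, x i ∈ intReals := by
  classical
  cases d with
  | zero => exact h.elim
  | succ e =>
    obtain ⟨Q, ⟨S, -, rfl⟩, hQ⟩ := h
    obtain ⟨U, t, hU, heq⟩ := hQ.symm
    rw [affMap_image_range, pyr_convexHull] at heq
    rw [← relLattice_affMap hU t]
    have hw' := affineIndependent_affMap hU t hw
    set w' := fun i => Matrix.vecMul (w i) U + t with hw'def
    have hvert := exists_mem_range_of_convexHull_eq hw' heq.symm
    have hzero : ∀ i, toReal (w' i) ≠ Pi.single (Fin.last e) 1 →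
        toReal (w' i) (Fin.last e) = 0 := by
      intro i hi
      rcases hvert i with ⟨y, -, hy⟩ | hy
      · rw [← hy, appendZero_last]
      · exact absurd hy hi
    obtain ⟨i₀, hi₀⟩ : ∃ i, toReal (w' i) = Pi.single (Fin.last e) 1 := by
      by_contra hne
      push Not at hne
      have h1 : (Pi.single (Fin.last e) 1 : Fin (e + 1) → ℝ)
          ∈ convexHull ℝ (Set.range fun i => toReal (w' i)) := by
        rw [← heq]
        exact subset_convexHull ℝ _ (Or.inr rfl)
      obtain ⟨x, -, hx⟩ := (mem_convexHull_iff w' _).1 h1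
      rw [combo_apply, Prod.mk.injEq] at hx
      have h2 := congrFun hx.1 (Fin.last e)
      rw [Finset.sum_apply, Finset.sum_eq_zero fun i _ => by
        rw [Pi.smul_apply, hzero i (hne i), smul_zero]] at h2
      simp at h2
    refine ⟨i₀, fun x hx => ?_⟩
    have h1 := mem_intLattice.1 ((mem_relLattice w' x).1 hx).1 (Fin.last e)
    rw [Finset.sum_apply, Finset.sum_eq_single i₀] at h1
    · rw [Pi.smul_apply, hi₀] at h1
      simpa using h1
    · intro i _ hi
      rw [Pi.smul_apply, hzero i, smul_zero]
      intro h2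
      exact hi (hw'.injective (h2.trans hi₀.symm))
    · simp

end Pyramid

/-! ### Reflexivity and the Gorenstein property -/

section Gorenstein

variable {ι : Type} [Fintype ι] {d : ℕ}

theorem zero_mem_interior_convexHull {p : ι → Fin d → ℤ}
    (hp : AffineIndependent ℝ fun i => toReal (p i)) (hcard : Fintype.card ι = d + 1)
    {β : ι → ℝ} (hβ : ∀ i, 0 < β i) (hβp : combo p β = (0, 1)) :
    (0 : Fin d → ℝ) ∈ interior (convexHull ℝ (Set.range fun i => toReal (p i))) := by
  have hcont : Continuous fun z : Fin d → ℝ => (comboEquiv hp hcard).symm (z, 1) :=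
    ((comboEquiv hp hcard).symm.toLinearMap.continuous_of_finiteDimensional).comp
      (continuous_id.prodMk continuous_const)
  rw [mem_interior]
  refine ⟨⋂ i, {z | 0 < (comboEquiv hp hcard).symm (z, 1) i}, ?_, ?_, ?_⟩
  · intro z hz
    rw [Set.mem_iInter] at hz
    exact (mem_convexHull_iff p z).2 ⟨_, fun i => (hz i).le, combo_comboEquiv_symm hp hcard _⟩
  · exact isOpen_iInter_of_finite fun i =>
      isOpen_lt continuous_const ((continuous_apply i).comp hcont)
  · rw [Set.mem_iInter]
    intro i
    have h : (comboEquiv hp hcard).symm (0, 1) = β := by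
      rw [LinearEquiv.symm_apply_eq, comboEquiv_apply, hβp]
    rw [Set.mem_ofPred_eq, h]
    exact hβ i

/-- A simplex with the origin in its interior is reflexive if its facets are given by integral
functionals. -/
theorem isReflexive_of_integral {p : ι → Fin d → ℤ}
    (hp : AffineIndependent ℝ fun i => toReal (p i)) (hcard : Fintype.card ι = d + 1)
    {β : ι → ℝ} (hβ : ∀ i, 0 < β i) (hβp : combo p β = (0, 1))
    (hint : ∀ j i, (comboEquiv hp hcard).symm (Pi.single j 1, 0) i / β i ∈ intReals) :
    IsReflexive (convexHull ℝ (Set.range fun i => toReal (p i))) := by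
  classical
  have hne : Nonempty ι := Fintype.card_pos_iff.1 (by omega)
  refine ⟨isLatticePolytope_range p, zero_mem_interior_convexHull hp hcard hβ hβp, ?_⟩
  -- `Y i` is the normal of the facet opposite vertex i: by `hYa` it takes the value 1 - a_i/β_i at
  -- a point with barycentric coordinates a, hence 1 where a_i = 0.
  choose Y hY using fun i j => mem_intReals.1 (neg_mem (hint j i))
  have hYz : ∀ (i : ι) (z : Fin d → ℝ),
      z ⬝ᵥ toReal (Y i) = -((comboEquiv hp hcard).symm (z, 0) i / β i) := by
    intro i z
    have h1 : (z, (0 : ℝ)) = ∑ j, z j • ((Pi.single j 1 : Fin d → ℝ), (0 : ℝ)) := by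
      ext1
      · rw [Prod.fst_sum]
        funext l
        simp [Finset.sum_apply, Pi.single_apply]
      · simp [Prod.snd_sum]
    rw [h1, map_sum, Finset.sum_apply, Finset.sum_div, ← Finset.sum_neg_distrib, dotProduct]
    refine Finset.sum_congr rfl fun j _ => ?_
    rw [toReal, hY, map_smul, Pi.smul_apply, smul_eq_mul]
    ring
  have hYa : ∀ (i : ι) (z : Fin d → ℝ) (a : ι → ℝ), combo p a = (z, 1) →
      z ⬝ᵥ toReal (Y i) = 1 - a i / β i := by
    intro i z a ha
    have h1 : (comboEquiv hp hcard).symm (z, 0) = a - β := by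
      rw [LinearEquiv.symm_apply_eq, comboEquiv_apply, map_sub, ha, hβp]
      simp
    have := (hβ i).ne'
    rw [hYz, h1, Pi.sub_apply]
    field_simp
    ring
  have hdual : dualPolytope (convexHull ℝ (Set.range fun i => toReal (p i)))
      = convexHull ℝ (Set.range fun i => toReal (Y i)) := by
    ext y
    rw [convexHull_range_eq]
    constructor
    · intro hy
      have hy' : ∀ l, toReal (p l) ⬝ᵥ y ≤ 1 := fun l => hy _ (subset_convexHull ℝ _ ⟨l, rfl⟩)
      have hpair : ∀ a : ι → ℝ, ∑ l, a l * (toReal (p l) ⬝ᵥ y) = (combo p a).1 ⬝ᵥ y := by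
        intro a
        rw [combo_apply, sum_dotProduct]
        simp only [smul_dotProduct, smul_eq_mul]
      have hsum : ∑ l, β l = 1 := by rw [← combo_snd p, hβp]
      have hsumt : ∑ l, β l * (1 - toReal (p l) ⬝ᵥ y) = 1 := by
        simp only [mul_sub, mul_one, Finset.sum_sub_distrib]
        rw [hpair, hβp, hsum, zero_dotProduct, sub_zero]
      -- The weight of `Y l` is β_l times the slack of y at the vertex `p l`; that these weights
      -- represent y is checked by pairing with every z.
      refine ⟨fun l => β l * (1 - toReal (p l) ⬝ᵥ y), fun l =>
        mul_nonneg (hβ l).le (by linarith [hy' l]), hsumt, ?_⟩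
      have hz : ∀ z : Fin d → ℝ,
          z ⬝ᵥ (∑ i, (β i * (1 - toReal (p i) ⬝ᵥ y)) • toReal (Y i)) = z ⬝ᵥ y := by
        intro z
        have ha := combo_comboEquiv_symm hp hcard (z, 1)
        set a := (comboEquiv hp hcard).symm (z, 1) with hadef
        have hasum : ∑ l, a l = 1 := by rw [← combo_snd p, ha]
        have h1 : ∀ i, (β i * (1 - toReal (p i) ⬝ᵥ y)) * (1 - a i / β i)
            = β i * (1 - toReal (p i) ⬝ᵥ y) - (a i - a i * (toReal (p i) ⬝ᵥ y)) := by
          intro i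
          have := (hβ i).ne'
          field_simp
        rw [dotProduct_sum]
        simp only [dotProduct_smul, smul_eq_mul, hYa _ z a ha, h1, Finset.sum_sub_distrib]
        rw [hsumt, hasum, hpair, ha]
        ring
      funext j
      have h1 := hz (Pi.single j 1)
      rwa [single_one_dotProduct, single_one_dotProduct] at h1
    · rintro ⟨t, ht0, ht1, rfl⟩ x hx
      obtain ⟨a, ha0, ha⟩ := (mem_convexHull_iff p x).1 hx
      rw [dotProduct_sum]
      simp only [dotProduct_smul, smul_eq_mul, hYa _ x a ha]
      rw [← ht1]
      refine Finset.sum_le_sum fun i _ => ?_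
      have h1 := div_nonneg (ha0 i) (hβ i).le
      nlinarith [ht0 i, mul_nonneg (ht0 i) h1]
  rw [hdual]
  exact isLatticePolytope_range Y

/-- A simplex whose lattice is a step lattice is Gorenstein. -/
theorem isGorenstein_of_stepLattice {k v : ℕ} (hk : 1 ≤ k) {w : ι → Fin d → ℤ}
    (hw : AffineIndependent ℝ fun i => toReal (w i)) (hcard : Fintype.card ι = d + 1)
    (h : StepLattice (relLattice w) k v) :
    IsGorenstein (convexHull ℝ (Set.range fun i => toReal (w i))) := by
  classical
  have hne : Nonempty ι := Fintype.card_pos_iff.1 (by omega)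
  obtain ⟨T, hT, hTb, -, hTle⟩ := h.exists_top hk
  choose m hm0 hTm hm using h.exists_order hT hTb hTle
  have hm0' : ∀ i, (0 : ℝ) < m i := fun i => by exact_mod_cast hm0 i
  -- This is the all-ones vector minus T. Its height r is the dilation factor, and ∑ c_i w_i is the
  -- interior lattice point of the dilate that is moved to the origin.
  let c : ι → ℝ := fun i => 1 / m i
  have hcpos : ∀ i, 0 < c i := fun i => one_div_pos.2 (hm0' i)
  have hc : c ∈ relLattice w := by
    have h1 : (fun _ => 1 : ι → ℝ) ∈ relLattice w :=
      intLattice_le_relLattice w (mem_intLattice.2 fun _ => one_mem_intReals)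
    have h2 := sub_mem h1 hT
    convert h2 using 1
    funext i
    rw [Pi.sub_apply, hTm]
    simp [c]
  have hcpos' : 0 < ht c := Finset.sum_pos (fun i _ => hcpos i) Finset.univ_nonempty
  rw [mem_relLattice] at hc
  obtain ⟨⟨zc, hzc⟩, hcz⟩ := And.intro (mem_intLattice_iff_toReal.1 hc.1) hc.2
  obtain ⟨r, hr⟩ : ∃ r : ℕ, (r : ℝ) = ht c := ⟨natHt c, natHt_cast (fun i => (hcpos i).le) hcz⟩
  have hr0' : (0 : ℝ) < r := by rw [hr]; exact hcpos'
  have hr0 : 0 < r := by exact_mod_cast hr0'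
  let p : ι → Fin d → ℤ := fun i => Matrix.vecMul ((r : ℤ) • w i) 1 + -zc
  have hpreal : ∀ i, toReal (p i) = (r : ℝ) • toReal (w i) - toReal zc := by
    intro i
    funext j
    simp [p, toReal, sub_eq_add_neg]
  have hcombo : ∀ x, combo p x = ((r : ℝ) • (combo w x).1 - (∑ i, x i) • toReal zc, ∑ i, x i) := by
    intro x
    rw [combo_apply, combo_apply]
    simp only [hpreal, smul_sub, Finset.sum_sub_distrib, Finset.smul_sum, Finset.sum_smul,
      smul_comm _ (r : ℝ)]
  have hp : AffineIndependent ℝ fun i => toReal (p i) := by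
    rw [affineIndependent_iff_combo, injective_iff_map_eq_zero]
    intro x hx
    rw [hcombo, Prod.mk_eq_zero] at hx
    obtain ⟨h1, h2⟩ := hx
    rw [h2, zero_smul, sub_zero, smul_eq_zero] at h1
    refine (injective_iff_map_eq_zero _).1 ((affineIndependent_iff_combo w).1 hw) x ?_
    refine Prod.ext (h1.resolve_left hr0'.ne') ?_
    rw [combo_snd]
    exact h2
  have hβp : combo p ((r : ℝ)⁻¹ • c) = (0, 1) := by
    have h1 : ∑ i, ((r : ℝ)⁻¹ • c) i = 1 := by
      simp only [Pi.smul_apply, smul_eq_mul, ← Finset.mul_sum]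
      rw [hr, ht]
      exact inv_mul_cancel₀ hcpos'.ne'
    rw [hcombo, h1, map_smul, Prod.smul_fst, smul_smul, mul_inv_cancel₀ hr0'.ne', combo_apply, hzc]
    simp
  refine ⟨r, hr0, convexHull ℝ (Set.range fun i => toReal (p i)),
    isReflexive_of_integral hp hcard (fun i => ?_) hβp ?_, 1, -zc, by simp, ?_⟩
  · rw [Pi.smul_apply, smul_eq_mul]
    exact mul_pos (inv_pos.2 hr0') (hcpos i)
  · intro j i
    have h1 := combo_comboEquiv_symm hp hcard (Pi.single j 1, 0)
    set x := (comboEquiv hp hcard).symm (Pi.single j 1, 0) with hx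
    rw [hcombo, Prod.mk.injEq] at h1
    obtain ⟨h2, h3⟩ := h1
    rw [h3, zero_smul, sub_zero] at h2
    -- In terms of w, the vector r x represents the lattice point (e_j, 0). So m_i r x_i, which is
    -- x_i divided by c_i/r, is an integer.
    have h4 : (r : ℝ) • x ∈ relLattice w := by
      rw [mem_relLattice_iff_combo, map_smul, Prod.smul_fst, Prod.smul_snd, h2, combo_snd, h3,
        smul_zero]
      refine ⟨mem_intLattice.2 fun l => ?_, zero_mem _⟩
      simp only [Pi.single_apply]
      split_ifs
      · exact one_mem_intReals
      · exact zero_mem _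
    have h5 := hm i _ h4
    convert h5 using 1
    have := hm0' i
    simp only [Pi.smul_apply, smul_eq_mul, c]
    field_simp
  · rw [← convexHull_smul]
    have h1 : (r : ℝ) • (Set.range fun i => toReal (w i))
        = Set.range fun i => toReal ((r : ℤ) • w i) := by
      rw [Set.smul_set_range]
      congr 1
      funext i j
      simp [toReal]
    rw [h1, affMap_image_range]

end Gorenstein

/-! ### The bijection -/

section Classification

variable {k v d : ℕ}

/-- The hypotheses on a simplex, in terms of its lattice. -/
theorem isGood_iff (hk : 1 ≤ k) (hv : 2 ≤ v) {w : Fin (d + 1) → Fin d → ℤ}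
    (hw : AffineIndependent ℝ fun i => toReal (w i)) :
    (IsGorenstein (convexHull ℝ (Set.range fun i => toReal (w i))) ∧
      ¬ IsLatticePyramid (convexHull ℝ (Set.range fun i => toReal (w i))) ∧
      HasHStar (convexHull ℝ (Set.range fun i => toReal (w i)))
        (∑ i ∈ Finset.range v, (Polynomial.X : Polynomial ℤ) ^ (i * k))) ↔
    StepLattice (relLattice w) k v ∧ ∀ i, ∃ x ∈ relLattice w, x i ∉ intReals := by
  have hcard : Fintype.card (Fin (d + 1)) = d + 1 := Fintype.card_fin _
  rw [hasHStar_iff_stepLattice hk hw hcard]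
  constructor
  · rintro ⟨-, hpyr, hstep⟩
    refine ⟨hstep, ?_⟩
    by_contra hne
    push Not at hne
    obtain ⟨i, hi⟩ := hne
    rcases Nat.eq_zero_or_pos d with rfl | hd
    -- In dimension 0 nothing counts as a pyramid; there an integral coordinate makes the whole
    -- lattice ℤ, so v ≤ 1.
    · have h1 : relLattice w ≤ intLattice _ := fun x hx => mem_intLattice.2 fun j => by
        rw [Subsingleton.elim (α := Fin 1) j i]
        exact hi x hx
      have := hstep.le_of_le hk (ChainDatum.stepLattice_intLattice k) h1
      omega
    · obtain ⟨m, hm, hden⟩ := hstep.exists_denominator hk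
      exact hpyr (isLatticePyramid_of_forall_mem hw hcard hd hm hden hi)
  · rintro ⟨hstep, hnd⟩
    refine ⟨isGorenstein_of_stepLattice hk hw hcard hstep, fun hpyr => ?_, hstep⟩
    obtain ⟨i, hi⟩ := exists_of_isLatticePyramid hw hpyr
    obtain ⟨x, hx, hxi⟩ := hnd i
    exact hxi (hi x hx)

theorem GoodSimplex.existsUnique_datum (hk : 1 ≤ k) (hv : 2 ≤ v) (P : GoodSimplex v k d) :
    ∃! D : ChainDatum v, IsAssociated k P.1 D := by
  obtain ⟨P, ⟨w, hw, rfl⟩, hG, hpyr, hstar⟩ := P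
  obtain ⟨hstep, hnd⟩ := (isGood_iff hk hv hw).1 ⟨hG, hpyr, hstar⟩
  obtain ⟨D, hD⟩ := hstep.exists_datum hk hnd
  exact ⟨D, (isAssociated_iff hw D).2 hD,
    fun D' hD' => ((isAssociated_iff hw D').1 hD').unique hk hD⟩

theorem IsAssociated.of_unimodEquiv {P Q : Set (Fin d → ℝ)} {D : ChainDatum v}
    (hP : IsAssociated k P D) (h : UnimodEquiv P Q) : IsAssociated k Q D := by
  obtain ⟨w, hw, rfl, hgrp⟩ := hP
  obtain ⟨U, t, hU, rfl⟩ := h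
  refine ⟨_, affineIndependent_affMap hU t hw, affMap_image_range U t w, ?_⟩
  rw [latticeGroup_eq_group_iff] at hgrp ⊢
  rw [relLattice_affMap hU, hgrp]

theorem IsAssociated.card_coord {P : Set (Fin d → ℝ)} {D : ChainDatum v}
    (hP : IsAssociated k P D) (hs : IsLatticeSimplex P) :
    Fintype.card (D.Coord k) = d + 1 := by
  obtain ⟨w, hw, rfl, -⟩ := hP
  obtain ⟨w', hw', h⟩ := hs
  obtain ⟨σ, -⟩ := exists_label_equiv hw hw' h
  rw [Fintype.card_congr σ, Fintype.card_fin]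

theorem IsAssociated.unimodEquiv {P Q : Set (Fin d → ℝ)} {D : ChainDatum v}
    (hP : IsAssociated k P D) (hQ : IsAssociated k Q D) (hs : IsLatticeSimplex P) :
    UnimodEquiv P Q := by
  have hcard := hP.card_coord hs
  obtain ⟨w, hw, rfl, h⟩ := hP
  obtain ⟨w', hw', rfl, h'⟩ := hQ
  rw [latticeGroup_eq_group_iff] at h h'
  exact unimodEquiv_of_relLattice_eq hw hw' hcard (h.trans h'.symm)

/-- Every datum is realized by a simplex. -/
theorem ChainDatum.exists_goodSimplex (hk : 1 ≤ k) (hv : 2 ≤ v) (D : ChainDatum v) :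
    ∃ (d : ℕ) (P : GoodSimplex v k d), IsAssociated k P.1 D := by
  -- With s = 0 there would be no coordinates at all and no dimension N - 1; v ≥ 2 excludes this.
  have hs : 0 < D.s := by
    by_contra h0
    have h1 : Fin.last D.s = 0 := Fin.ext (by simp; omega)
    have h2 := D.M_last
    rw [h1, D.M_first] at h2
    omega
  have hpos : 0 < Fintype.card (D.Coord k) :=
    Fintype.card_pos_iff.2 ⟨⟨⟨0, hs⟩, ⟨0, D.blockSize_pos hk _⟩⟩⟩
  obtain ⟨d, hd⟩ := Nat.exists_eq_succ_of_ne_zero hpos.ne'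
  let σ : Fin (d + 1) ≃ D.Coord k := (Fintype.equivFinOfCardEq hd).symm
  let f : Fin (d + 1) → Fin D.s := fun i => (σ i).1
  have hf : D.IsBlockMap k f := fun b => by
    rw [← D.isBlockMap_fst k b]
    refine Finset.card_equiv σ fun i => ?_
    simp [f]
  have hlat : D.IsLatticeOf k (chainLattice (D.vec f) (Fin.last D.s)) := ⟨f, hf, rfl⟩
  have hstep := hlat.stepLattice hk
  obtain ⟨m, hm, hden⟩ := hstep.exists_denominator hk
  obtain ⟨w, hw, hΓ⟩ := exists_relLattice_eq _ hstep.int_le (fun x hx => by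
    obtain ⟨j, -, hj⟩ := hstep.height _ (fr_mem hstep.int_le hx) (inBox_fr x)
    have h1 : ht x = ht (fr x) + ht (x - fr x) := by rw [← ht_add]; congr 1; abel
    rw [h1, hj]
    refine add_mem (mul_mem_intReals (natCast_mem_intReals j) (natCast_mem_intReals k)) ?_
    exact sum_mem fun i _ => mem_intLattice.1 (sub_fr_mem x) i) hm hden
  rw [← hΓ] at hlat
  exact ⟨d, ⟨_, ⟨w, hw, rfl⟩, (isGood_iff hk hv hw).2
    ⟨hlat.stepLattice hk, hlat.exists_notMem⟩⟩, (isAssociated_iff hw D).2 hlat⟩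

/-- The datum of a class of simplices. -/
def SimplexClass.datum (hk : 1 ≤ k) (hv : 2 ≤ v) (c : SimplexClass v k) : ChainDatum v :=
  Quotient.lift (fun P : GoodSimplex v k c.1 => (P.existsUnique_datum hk hv).choose)
    (fun P Q h => by
      have h1 := (P.existsUnique_datum hk hv).choose_spec.1.of_unimodEquiv h
      exact (Q.existsUnique_datum hk hv).unique h1 (Q.existsUnique_datum hk hv).choose_spec.1) c.2

theorem SimplexClass.datum_toClass_eq_iff (hk : 1 ≤ k) (hv : 2 ≤ v) (P : GoodSimplex v k d)
    (D : ChainDatum v) : SimplexClass.datum hk hv P.toClass = D ↔ IsAssociated k P.1 D := by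
  have h := (P.existsUnique_datum hk hv).choose_spec.1
  constructor
  · rintro rfl
    exact h
  · intro hD
    exact (P.existsUnique_datum hk hv).unique h hD

theorem SimplexClass.datum_bijective (hk : 1 ≤ k) (hv : 2 ≤ v) :
    Function.Bijective (SimplexClass.datum (k := k) (v := v) hk hv) := by
  constructor
  · rintro ⟨d, ⟨P⟩⟩ ⟨d', ⟨Q⟩⟩ h
    have hP := (SimplexClass.datum_toClass_eq_iff hk hv P _).1 rfl
    have hQ := (SimplexClass.datum_toClass_eq_iff hk hv Q _).1 h.symm
    obtain rfl : d = d' :=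
      Nat.succ_injective ((hP.card_coord P.2.1).symm.trans (hQ.card_coord Q.2.1))
    exact congrArg (Sigma.mk d) (Quotient.sound (hP.unimodEquiv hQ P.2.1))
  · intro D
    obtain ⟨d, P, hP⟩ := D.exists_goodSimplex hk hv
    exact ⟨P.toClass, (SimplexClass.datum_toClass_eq_iff hk hv P D).2 hP⟩

end Classification

end GorSimplex

end

theorem theorem1p1 (k v : ℕ) (hk : 1 ≤ k) (hv : 2 ≤ v) :
    ∃ e : GorSimplex.SimplexClass v k ≃ GorSimplex.ChainDatum v,
      ∀ (d : ℕ) (P : GorSimplex.GoodSimplex v k d) (D : GorSimplex.ChainDatum v),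
        e P.toClass = D ↔ GorSimplex.IsAssociated k P.1 D :=
  ⟨Equiv.ofBijective _ (GorSimplex.SimplexClass.datum_bijective hk hv),
    fun _ P D => GorSimplex.SimplexClass.datum_toClass_eq_iff hk hv P D⟩
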